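/- Let $r\ge 2$, $\varepsilon>0$, let $d_1\ge 2$ and $d_2,\dots,d_r\ge 1$ be integers, $n=\sum_{i=1}^r d_i$, and let $\mu_1=d_1-1$ and $\mu_2=\dots=\mu_r=0$ (the Einstein constants of the unit sphere $S^{d_1}$ and of Ricci flat manifolds $(M_i,g_i)$ of dimension $d_i$). For the metric $dt^2+\sum_{i=1}^r f_i(t)^2g_i$ on $(0,\infty)\times S^{d_1}\times M_2\times\dots\times M_r$ and a potential $u=u(t)$, with $f_i>0$ and $u$ smooth on $(0,\infty)$, put $\ell_i=\dot f_i/f_i$ and $\operatorname{tr}L=\sum_i d_i\ell_i$. The gradient Ricci soliton equation $\mathrm{Ric}+\mathrm{Hess}\,u+\frac{\varepsilon}{2}g=0$ becomes, for $t>0$, $$\frac{d}{dt}\left(-\dot u+\operatorname{tr}L\right)=-\sum_i d_i\ell_i^2+\frac{\varepsilon}{2},\qquad \dot\ell_i=-\left(-\dot u+\operatorname{tr}L\right)\ell_i+\frac{\mu_i}{f_i^2}+\frac{\varepsilon}{2}\quad(1\le i\le r).$$ For $\bar f_2,\dots,\bar f_r>0$ and $C<0$, a solution on $(0,\infty)$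 has initial data $(\bar f_2,\dots,\bar f_r,C)$ if, as $t\to0^+$, $f_1\to0$, $\dot f_1\to1$, $f_i\to\bar f_i$, $\dot f_i\to0$ for $i\ge2$, and $u\to0$, $\dot u\to0$, $\ddot u\to\frac{C}{d_1+1}$. The trajectory corresponding to it is the curve $(\mathcal L,X_i,Y_i)$ given by $$\mathcal L=\frac{1}{-\dot u+\operatorname{tr}L},\qquad X_i=\mathcal L\,\frac{\dot f_i}{f_i},\qquad Y_i=\frac{\mathcal L}{f_i},$$ in a time parameter $s\in\mathbb R$ with $\frac{dt}{ds}=\mathcal L$, where $t\to0$ as $s\to-\infty$ and $t\to\infty$ as $s\to\infty$. A curve $(\mathcal L,X_i,Y_i)$, $s\in\mathbb R$, is called a regular trajectory if it solves $$\mathcal L'=\mathcal L\Big(\sum_j d_jX_j^2-\tfrac{\varepsilon}{2}\mathcal L^2\Big),\quad X_i'=X_i\Big(\sum_j d_jX_j^2-\tfrac{\varepsilon}{2}\mathcal L^2-1\Big)+\mu_iY_i^2+\tfrac{\varepsilon}{2}\mathcal L^2,\quad Y_i'=Y_i\Big(\sum_j d_jX_j^2-\tfrac{\varepsilon}{2}\mathcal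 L^2-X_i\Big),$$ converges as $s\to-\infty$ to the stationary point $\mathcal L=0$, $X_1=Y_1=\frac1{d_1}$, $X_i=Y_i=0$ $(i\ge2)$, and satisfies $\mathcal L,X_i,Y_i>0$, $\sum_i d_iX_i^2+\sum_i d_i\mu_iY_i^2+(n-1)\frac{\varepsilon}{2}\mathcal L^2<1$ and $\sum_i d_iX_i<1$ for all $s$. Put $\sigma_1^{-1}=\lim_{t\to\infty}\dot f_1=\lim_{s\to\infty}\frac{X_1}{Y_1}$. Fix $\bar f_2,\dots,\bar f_r>0$. Then as $C$ ranges over $(-\infty,0)$, the trajectories with initial data $(\bar f_2,\dots,\bar f_r,C)$ realize every value $\sigma_1\in(0,\infty)$. Precisely: for every $\sigma\in(0,\infty)$ there is $C<0$ such that a solution on $(0,\infty)$ with initial data $(\bar f_2,\dots,\bar f_r,C)$ and a corresponding trajectory exist, and every trajectory corresponding to a solution with these initial data is regular and has $\sigma_1=\sigma$, i.e. $\lim_{t\to\infty}\dot f_1(t)=\lim_{s\to\infty}\frac{X_1(s)}{Y_1(s)}=\sigma^{-1}$. -/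

import Mathlib

open Set Filter Topology
open scoped ContDiff

/-! Multiple warped product gradient Ricci solitons
`dt² + ∑ i, f i (t)² g_i` on `(0, ∞) × S^{d 0} × M_1 × ⋯ × M_m`.
The index `0` is the round unit sphere, the indices `1, …, m` are the Einstein factors with
`Ric g_i = μ i • g_i` and `dim M_i = d i`; there are `m + 1` factors in total. -/

namespace WarpedSoliton

noncomputable section

/-- The eigenvalue `f_i' / f_i` of the shape operator of the hypersurface `{t} × S^{d 0} × ⋯`
on the `i`-th factor. -/
def shape {m : ℕ} (f : Fin (m + 1) → ℝ → ℝ) (i : Fin (m + 1)) (t : ℝ) : ℝ :=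
  deriv (f i) t / f i t

/-- The trace of the shape operator. -/
def trShape {m : ℕ} (d : Fin (m + 1) → ℕ) (f : Fin (m + 1) → ℝ → ℝ) (t : ℝ) : ℝ :=
  ∑ i, (d i : ℝ) * shape f i t

/-- The trace of the square of the shape operator. -/
def trShapeSq {m : ℕ} (d : Fin (m + 1) → ℕ) (f : Fin (m + 1) → ℝ → ℝ) (t : ℝ) : ℝ :=
  ∑ i, (d i : ℝ) * shape f i t ^ 2

/-- The generalized mean curvature `-u' + tr L`. -/
def genMean {m : ℕ} (d : Fin (m + 1) → ℕ) (f : Fin (m + 1) → ℝ → ℝ) (u : ℝ → ℝ) (t : ℝ) : ℝ :=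
  -deriv u t + trShape d f t

/-- `(f, u)` is a smooth solution, on the whole of `(0, ∞)`, of the gradient Ricci soliton
equation `Ric + Hess u + (ε/2) g = 0` for the metric `dt² + ∑ f_i² g_i` and the potential
`u = u(t)`. -/
structure IsSoliton {m : ℕ} (d : Fin (m + 1) → ℕ) (μ : Fin (m + 1) → ℝ) (ε : ℝ)
    (f : Fin (m + 1) → ℝ → ℝ) (u : ℝ → ℝ) : Prop where
  smooth_f : ∀ i, ContDiffOn ℝ ∞ (f i) (Ioi 0)
  smooth_u : ContDiffOn ℝ ∞ u (Ioi 0)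
  pos : ∀ i, ∀ t, 0 < t → 0 < f i t
  eq_mean : ∀ t, 0 < t → deriv (genMean d f u) t = -trShapeSq d f t + ε / 2
  eq_shape : ∀ i, ∀ t, 0 < t →
    deriv (shape f i) t = -genMean d f u t * shape f i t + μ i / f i t ^ 2 + ε / 2

/-- The initial conditions with parameters `(fbar, C)`: the sphere collapses smoothly,
`f_0(0) = 0`, `f_0'(0) = 1`, the other factors satisfy `f_i(0) = fbar_i`, `f_i'(0) = 0`, and
`u(0) = 0`, `u'(0) = 0`, `u''(0) = C / (d 0 + 1)`. -/
structure HasInitialData {m : ℕ} (d : Fin (m + 1) → ℕ) (fbar : Fin m → ℝ) (C : ℝ)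
    (f : Fin (m + 1) → ℝ → ℝ) (u : ℝ → ℝ) : Prop where
  sphere : Tendsto (f 0) (𝓝[>] 0) (𝓝 0)
  sphere_deriv : Tendsto (deriv (f 0)) (𝓝[>] 0) (𝓝 1)
  factor : ∀ i : Fin m, Tendsto (f i.succ) (𝓝[>] 0) (𝓝 (fbar i))
  factor_deriv : ∀ i : Fin m, Tendsto (deriv (f i.succ)) (𝓝[>] 0) (𝓝 0)
  potential : Tendsto u (𝓝[>] 0) (𝓝 0)
  potential_deriv : Tendsto (deriv u) (𝓝[>] 0) (𝓝 0)
  potential_deriv_two : Tendsto (deriv (deriv u)) (𝓝[>] 0) (𝓝 (C / ((d 0 : ℝ) + 1)))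

/-- The curve `s ↦ (Λ, X_i, Y_i)(s)`, `s ∈ ℝ`, is induced by `(f, u)`: after a change of time
`t = τ(s)` from `ℝ` onto `(0, ∞)` with `dt/ds = Λ`, it is given by `Λ = 1 / (-u' + tr L)`,
`X_i = Λ f_i' / f_i` and `Y_i = Λ / f_i`. -/
def Induces {m : ℕ} (d : Fin (m + 1) → ℕ) (f : Fin (m + 1) → ℝ → ℝ) (u : ℝ → ℝ)
    (Λ : ℝ → ℝ) (X Y : Fin (m + 1) → ℝ → ℝ) : Prop :=
  ∃ τ : ℝ → ℝ, (∀ s, 0 < τ s) ∧ Tendsto τ atBot (𝓝 0) ∧ Tendsto τ atTop atTop ∧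
    (∀ s, HasDerivAt τ (Λ s) s) ∧
    (∀ s, Λ s = 1 / genMean d f u (τ s)) ∧
    (∀ i s, X i s = Λ s * shape f i (τ s)) ∧
    (∀ i s, Y i s = Λ s / f i (τ s))

/-- `(Λ, X, Y)` is a trajectory, defined for all `s ∈ ℝ`, of the rescaled Ricci soliton ODE. -/
structure IsTrajectory {m : ℕ} (d : Fin (m + 1) → ℕ) (μ : Fin (m + 1) → ℝ) (ε : ℝ)
    (Λ : ℝ → ℝ) (X Y : Fin (m + 1) → ℝ → ℝ) : Prop where
  ode_L : ∀ s, HasDerivAt Λ (Λ s * (∑ j, (d j : ℝ) * X j s ^ 2 - ε / 2 * Λ s ^ 2)) s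
  ode_X : ∀ i s, HasDerivAt (X i)
    (X i s * (∑ j, (d j : ℝ) * X j s ^ 2 - ε / 2 * Λ s ^ 2 - 1)
      + μ i * Y i s ^ 2 + ε / 2 * Λ s ^ 2) s
  ode_Y : ∀ i s, HasDerivAt (Y i)
    (Y i s * (∑ j, (d j : ℝ) * X j s ^ 2 - ε / 2 * Λ s ^ 2 - X i s)) s

/-- `S₁ = ∑ d_i X_i² + ∑ d_i μ_i Y_i² + (n - 1) (ε/2) Λ² - 1`, where `n = ∑ d_i`. -/
def S1 {m : ℕ} (d : Fin (m + 1) → ℕ) (μ : Fin (m + 1) → ℝ) (ε : ℝ)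
    (Λ : ℝ → ℝ) (X Y : Fin (m + 1) → ℝ → ℝ) (s : ℝ) : ℝ :=
  ∑ i, (d i : ℝ) * X i s ^ 2 + ∑ i, (d i : ℝ) * μ i * Y i s ^ 2
    + ((∑ i, (d i : ℝ)) - 1) * (ε / 2) * Λ s ^ 2 - 1

/-- `S₂ = ∑ d_i X_i - 1`. -/
def S2 {m : ℕ} (d : Fin (m + 1) → ℕ) (X : Fin (m + 1) → ℝ → ℝ) (s : ℝ) : ℝ :=
  ∑ i, (d i : ℝ) * X i s - 1

/-- Regular trajectories: trajectories in the unstable manifold of the stationary point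
`Λ = 0`, `X_0 = Y_0 = 1 / d 0`, `X_i = Y_i = 0` for `i ≠ 0`, with all coordinates positive,
along which `S₁ < 0` and `S₂ < 0`. -/
structure IsRegular {m : ℕ} (d : Fin (m + 1) → ℕ) (μ : Fin (m + 1) → ℝ) (ε : ℝ)
    (Λ : ℝ → ℝ) (X Y : Fin (m + 1) → ℝ → ℝ) : Prop where
  trajectory : IsTrajectory d μ ε Λ X Y
  lim_L : Tendsto Λ atBot (𝓝 0)
  lim_X_zero : Tendsto (X 0) atBot (𝓝 (1 / (d 0 : ℝ)))
  lim_Y_zero : Tendsto (Y 0) atBot (𝓝 (1 / (d 0 : ℝ)))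
  lim_X : ∀ i : Fin m, Tendsto (X i.succ) atBot (𝓝 0)
  lim_Y : ∀ i : Fin m, Tendsto (Y i.succ) atBot (𝓝 0)
  pos_L : ∀ s, 0 < Λ s
  pos_X : ∀ i s, 0 < X i s
  pos_Y : ∀ i s, 0 < Y i s
  S1_neg : ∀ s, S1 d μ ε Λ X Y s < 0
  S2_neg : ∀ s, S2 d X s < 0

end

end WarpedSoliton

/-! Write `N = d 0`, `D` for the total dimension of the flat factors, `K = -C`. Each flat factor
satisfies the same linear equation `ℓ' = -Mℓ + ε/2` with `M = -u' + tr L`, so only the weighted mean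
`h` of these `ℓ` enters `M`. Together with the first integral, whose value is fixed by `C`, this
reduces the problem to an autonomous system for `x = (f, y, p, h, v) = (f, f', -u', h, -u)`, where
`f` is the warping function of the sphere. The system is singular at `f = 0` and does not involve
the constants `fbar`. They only scale the flat warping functions, so the same `K` serves for all of
them.

Existence and uniqueness. After blowing up `f` and `v` at `t = 0`, the system becomes `t w' + (k +
1) w = Q(t, K, w)` with `Q` contracting in `w`. A fixed point argument gives local solutions that
are continuous in `K` (`exists_local_family`, `RedSol.eq_near`). Positivity of all variables
(`RedSol.pos_all`) and exponential bounds exclude blow-up (`RedSol.exists_global`), and Gronwall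
gives continuity in `K` at every later time (`RedSol.continuousAt_param`).

Asymptotics. Put `Z = K + εv` and `W = (N - 1) + (ε/2) f²`. Then `Z' = εp`, `p' = -Mp + Z`, while
`W' = ε f y`, `(fy)' = -M fy + W + 2y²`. So `Z` and `W` solve the same second order equation up to
the term `2y²`. Comparing their Wronskian with `0` shows that `W/Z` increases, and that `(W + c)/Z`
decreases as soon as `2y² ≤ c`. The bound on `y` comes from a forward invariant region
(`RedSol.trapped_forward`) which every global solution enters because `Z → ∞`. Hence `W/Z` has a
limit `S`, with error at most `c/Z(t)` at time `t`. The first integral gives `p/√Z → 1`, and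
therefore `f' → √(εS/2)` (`RedSol.tendsto_y`).

Surjectivity. The invariant region is open, so the bound `c` is uniform for nearby `K`, and `S` is
continuous in `K` (`RedSol.continuousAt_limit`). Since `W/Z` starts at `(N - 1)/K`, one has `S ≥ (N
- 1)/K`. For large `K` the bound `y < 2` holds from the start, so `S ≤ (N + 7)/K`. Thus `S` takes
every positive value (`RedSol.exists_param`), and uniqueness transfers the slope to every soliton
with the given data. Regularity of the trajectory is positivity together with the first integral. -/

namespace WarpedSoliton

/-! ### Differential inequalities on the line -/

/-- A function with `g' ≥ -M g`, `M ≥ 0`, that tends to `0` at the left end is nonnegative. -/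
lemma nonneg_of_deriv_ge {g g' M : ℝ → ℝ} {T : ℝ}
    (hg : ∀ t ∈ Ioo 0 T, HasDerivAt g (g' t) t) (hM : ∀ t ∈ Ioo 0 T, 0 ≤ M t)
    (hle : ∀ t ∈ Ioo 0 T, -M t * g t ≤ g' t) (h0 : Tendsto g (𝓝[>] 0) (𝓝 0)) :
    ∀ t ∈ Ioo 0 T, 0 ≤ g t := by
  intro t ht
  -- The barrier `η (1 + s)` has slope `η > 0`, whereas at a contact point `-g' ≤ M g = -M η (1 + s)
  -- ≤ 0`, so `-g` cannot cross it. Then `η → 0`.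
  have key : ∀ η > 0, -g t ≤ η * (1 + t) := by
    intro η hη
    have h1 : ∀ᶠ a in 𝓝[>] (0 : ℝ), -g a < η ∧ a ∈ Ioo 0 t := by
      refine ((h0.neg.eventually (gt_mem_nhds (by simpa using hη)))).and ?_
      exact Ioo_mem_nhdsGT ht.1
    obtain ⟨a, ha, hat⟩ := h1.exists
    have hsub : ∀ s ∈ Icc a t, s ∈ Ioo 0 T := fun s hs =>
      ⟨hat.1.trans_le hs.1, hs.2.trans_lt ht.2⟩
    have := image_le_of_deriv_right_lt_deriv_boundary (f := fun s => -g s)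
      (f' := fun s => -g' s) (a := a) (b := t) (B := fun s => η * (1 + s))
      (B' := fun _ => η)
      (fun s hs => (hg s (hsub s hs)).neg.continuousAt.continuousWithinAt)
      (fun s hs => (hg s (hsub s ⟨hs.1, hs.2.le⟩)).neg.hasDerivWithinAt)
      (by nlinarith [hat.1])
      (fun s => by simpa using ((hasDerivAt_id s).const_add 1).const_mul η)
      (by
        intro s hs hEq
        have hs' := hsub s ⟨hs.1, hs.2.le⟩
        have h2 := hle s hs'
        have h3 := hM s hs'
        have h4 : 0 < η * (1 + s) := mul_pos hη (by linarith [hs'.1])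
        nlinarith [mul_nonneg h3 h4.le])
      (right_mem_Icc.2 hat.2.le)
    exact this
  have h2 : Tendsto (fun η : ℝ => η * (1 + t)) (𝓝[>] 0) (𝓝 0) := by
    have : Tendsto (fun η : ℝ => η * (1 + t)) (𝓝 0) (𝓝 (0 * (1 + t))) :=
      (continuous_id.mul continuous_const).tendsto 0
    rw [zero_mul] at this
    exact this.mono_left nhdsWithin_le_nhds
  have := ge_of_tendsto h2 (eventually_nhdsWithin_of_forall key)
  linarith

lemma eq_zero_of_deriv_eq {g M : ℝ → ℝ} {T : ℝ}
    (hg : ∀ t ∈ Ioo 0 T, HasDerivAt g (-M t * g t) t) (hM : ∀ t ∈ Ioo 0 T, 0 ≤ M t)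
    (h0 : Tendsto g (𝓝[>] 0) (𝓝 0)) : ∀ t ∈ Ioo 0 T, g t = 0 := by
  intro t ht
  refine le_antisymm ?_ (nonneg_of_deriv_ge hg hM (fun _ _ => le_rfl) h0 t ht)
  have := nonneg_of_deriv_ge (g := fun t => -g t) (g' := fun t => -(-M t * g t)) (M := M) (T := T)
    (fun t ht => (hg t ht).neg) hM (fun t _ => by simp) (by simpa using h0.neg) t ht
  linarith

/-- As `nonneg_of_deriv_ge`, with a strict inequality. -/
lemma pos_of_deriv_gt {g g' M : ℝ → ℝ} {T : ℝ}
    (hg : ∀ t ∈ Ioo 0 T, HasDerivAt g (g' t) t) (hM : ∀ t ∈ Ioo 0 T, 0 ≤ M t)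
    (hlt : ∀ t ∈ Ioo 0 T, -M t * g t < g' t) (h0 : Tendsto g (𝓝[>] 0) (𝓝 0)) :
    ∀ t ∈ Ioo 0 T, 0 < g t := by
  have hnn := nonneg_of_deriv_ge hg hM (fun t ht => (hlt t ht).le) h0
  intro t ht
  refine lt_of_le_of_ne (hnn t ht) fun h => ?_
  have hmin : IsLocalMin g t := by
    filter_upwards [Ioo_mem_nhds ht.1 ht.2] with s hs
    rw [← h]; exact hnn s hs
  have h1 := hmin.hasDerivAt_eq_zero (hg t ht)
  have h2 := hlt t ht
  rw [h1, ← h] at h2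
  simp at h2

lemma monotoneOn_Ioo_of_hasDerivAt {g g' : ℝ → ℝ} {T : ℝ}
    (hg : ∀ t ∈ Ioo 0 T, HasDerivAt g (g' t) t) (h : ∀ t ∈ Ioo 0 T, 0 ≤ g' t) :
    MonotoneOn g (Ioo 0 T) := by
  refine monotoneOn_of_deriv_nonneg (convex_Ioo 0 T)
    (fun t ht => (hg t ht).continuousAt.continuousWithinAt)
    (fun t ht => ?_) (fun t ht => ?_)
  · rw [interior_Ioo] at ht
    exact (hg t ht).differentiableAt.differentiableWithinAt
  · rw [interior_Ioo] at ht
    rw [(hg t ht).deriv]; exact h t ht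

lemma le_of_monotoneOn_of_tendsto {g : ℝ → ℝ} {T l : ℝ} (hg : MonotoneOn g (Ioo 0 T))
    (h0 : Tendsto g (𝓝[>] 0) (𝓝 l)) : ∀ t ∈ Ioo 0 T, l ≤ g t := by
  intro t ht
  refine le_of_tendsto h0 ?_
  filter_upwards [Ioo_mem_nhdsGT ht.1] with s hs
  exact hg ⟨hs.1, hs.2.trans ht.2⟩ ht hs.2.le

lemma le_of_deriv_nonneg {g g' : ℝ → ℝ} {T l : ℝ}
    (hg : ∀ t ∈ Ioo 0 T, HasDerivAt g (g' t) t) (h : ∀ t ∈ Ioo 0 T, 0 ≤ g' t)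
    (h0 : Tendsto g (𝓝[>] 0) (𝓝 l)) : ∀ t ∈ Ioo 0 T, l ≤ g t :=
  le_of_monotoneOn_of_tendsto (monotoneOn_Ioo_of_hasDerivAt hg h) h0

lemma le_of_deriv_nonneg_Icc {g g' : ℝ → ℝ} {a b : ℝ} (hab : a ≤ b)
    (hg : ∀ t ∈ Icc a b, HasDerivAt g (g' t) t) (h : ∀ t ∈ Ioo a b, 0 ≤ g' t) : g a ≤ g b := by
  refine monotoneOn_of_deriv_nonneg (convex_Icc a b)
    (fun t ht => (hg t ht).continuousAt.continuousWithinAt)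
    (fun t ht => ?_) (fun t ht => ?_) (left_mem_Icc.2 hab) (right_mem_Icc.2 hab) hab
  · rw [interior_Icc] at ht
    exact (hg t (Ioo_subset_Icc_self ht)).differentiableAt.differentiableWithinAt
  · rw [interior_Icc] at ht
    rw [(hg t (Ioo_subset_Icc_self ht)).deriv]; exact h t ht

/-- Functions that start positive, and whose first zero can only be crossed upwards, stay
positive. -/
lemma pos_of_first_zero {ι : Type*} [Finite ι] {φ φ' : ι → ℝ → ℝ} {a b : ℝ}
    (hφ : ∀ i, ∀ t ∈ Ico a b, HasDerivAt (φ i) (φ' i t) t) (h0 : ∀ i, 0 < φ i a)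
    (h : ∀ t ∈ Ioo a b, (∀ s ∈ Ico a t, ∀ i, 0 < φ i s) → (∀ i, 0 ≤ φ i t) →
      ∀ i, φ i t = 0 → 0 < φ' i t) :
    ∀ t ∈ Ico a b, ∀ i, 0 < φ i t := by
  by_contra! hcon
  obtain ⟨t1, ht1, i1, hi1⟩ := hcon
  -- A finite union of closed sets, so its infimum is a time at which some function vanishes and
  -- before which all are positive.
  set S : Set ℝ := ⋃ i, {t | t ∈ Icc a t1 ∧ φ i t ≤ 0} with hS
  have hsub : ∀ t ∈ Icc a t1, t ∈ Ico a b := fun t ht => ⟨ht.1, ht.2.trans_lt ht1.2⟩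
  have hclosed : IsClosed S := by
    refine isClosed_iUnion_of_finite fun i => ?_
    have hc : ContinuousOn (φ i) (Icc a t1) := fun t ht =>
      (hφ i t (hsub t ht)).continuousAt.continuousWithinAt
    exact hc.preimage_isClosed_of_isClosed isClosed_Icc isClosed_Iic
  have hne : S.Nonempty := ⟨t1, mem_iUnion.2 ⟨i1, right_mem_Icc.2 ht1.1, hi1⟩⟩
  have hbdd : BddBelow S := ⟨a, fun t ht => by
    obtain ⟨i, hi⟩ := mem_iUnion.1 ht; exact hi.1.1⟩
  have hmem := hclosed.csInf_mem hne hbdd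
  set t0 := sInf S with ht0
  obtain ⟨i, hi, hi0⟩ := mem_iUnion.1 hmem
  have hlt : a < t0 := lt_of_le_of_ne hi.1 fun hE => by
    rw [← hE] at hi0; exact absurd (h0 i) (not_lt.2 hi0)
  have hbefore : ∀ s ∈ Ico a t0, ∀ j, 0 < φ j s := by
    intro s hs j
    by_contra! hj
    have : s ∈ S := mem_iUnion.2 ⟨j, ⟨hs.1, hs.2.le.trans hi.2⟩, hj⟩
    exact absurd (csInf_le hbdd this) (not_le.2 hs.2)
  have hev : ∀ᶠ s in 𝓝[<] t0, s ∈ Ico a t0 := by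
    filter_upwards [Ioo_mem_nhdsLT hlt] with s hs
    exact ⟨hs.1.le, hs.2⟩
  have hnn : ∀ j, 0 ≤ φ j t0 := by
    intro j
    have hc := (hφ j t0 (hsub t0 hi)).continuousAt.tendsto.mono_left
      (nhdsWithin_le_nhds (s := Iio t0))
    exact ge_of_tendsto hc (hev.mono fun s hs => (hbefore s hs j).le)
  have hz : φ i t0 = 0 := le_antisymm hi0 (hnn i)
  have hpos := h t0 ⟨hlt, (hsub t0 hi).2⟩ hbefore hnn i hz
  -- Positive values before a zero give negative left slopes, against the positive derivative there.
  have hslope := (hasDerivAt_iff_tendsto_slope.1 (hφ i t0 (hsub t0 hi))).mono_left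
    (nhdsWithin_mono t0 (show Iio t0 ⊆ {t0}ᶜ from fun s hs => ne_of_lt hs))
  obtain ⟨s, hs1, hs2⟩ := ((hslope.eventually (lt_mem_nhds hpos)).and hev).exists
  rw [slope_def_field, hz] at hs1
  have := hbefore s hs2 i
  have h3 : s - t0 < 0 := by linarith [hs2.2]
  have : (φ i s - 0) / (s - t0) < 0 := div_neg_of_pos_of_neg (by linarith) h3
  linarith

/-! ### The reduced system -/

/-- The generalized mean curvature in the variables `x = (f, f', -u', h, -u)`. -/
noncomputable def redMean (N : ℕ) (D : ℝ) (x : Fin 5 → ℝ) : ℝ :=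
  x 2 + N * (x 1 / x 0) + D * x 3

/-- The soliton equation in the variables `x = (f, f', -u', h, -u)`, where `f` is the warping
function of the sphere and `h` the common logarithmic derivative of the other ones. -/
noncomputable def redField (N : ℕ) (D ε K : ℝ) (x : Fin 5 → ℝ) : Fin 5 → ℝ :=
  ![x 1, -(x 2 + D * x 3) * x 1 + (N - 1) * (1 - x 1 ^ 2) / x 0 + ε / 2 * x 0,
    -redMean N D x * x 2 + (K + ε * x 4), -redMean N D x * x 3 + ε / 2, x 2]

/-- Solutions on `(0, T)` of the reduced system with a smoothly collapsing sphere at `0`. -/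
structure RedSol (N : ℕ) (D ε K T : ℝ) (x : ℝ → Fin 5 → ℝ) : Prop where
  ode : ∀ t ∈ Ioo 0 T, HasDerivAt x (redField N D ε K (x t)) t
  pos_f : ∀ t ∈ Ioo 0 T, 0 < x t 0
  lim : Tendsto x (𝓝[>] 0) (𝓝 ![0, 1, 0, 0, 0])

/-- The standing assumptions on the parameters. -/
structure Params (N : ℕ) (D ε K : ℝ) : Prop where
  hN : 2 ≤ N
  hD : 0 ≤ D
  hε : 0 < ε
  hK : 0 < K

namespace RedSol

variable {N : ℕ} {D ε K T : ℝ} {x : ℝ → Fin 5 → ℝ}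

lemma mono (hx : RedSol N D ε K T x) {T' : ℝ} (h : T' ≤ T) : RedSol N D ε K T' x :=
  ⟨fun t ht => hx.ode t ⟨ht.1, ht.2.trans_le h⟩, fun t ht => hx.pos_f t ⟨ht.1, ht.2.trans_le h⟩,
    hx.lim⟩

lemma deriv_f (hx : RedSol N D ε K T x) {t : ℝ} (ht : t ∈ Ioo 0 T) :
    HasDerivAt (fun t => x t 0) (x t 1) t := by
  simpa [redField] using hasDerivAt_pi.1 (hx.ode t ht) 0

lemma deriv_y (hx : RedSol N D ε K T x) {t : ℝ} (ht : t ∈ Ioo 0 T) :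
    HasDerivAt (fun t => x t 1) (-(x t 2 + D * x t 3) * x t 1 + (N - 1) * (1 - x t 1 ^ 2) / x t 0
      + ε / 2 * x t 0) t := by
  simpa [redField] using hasDerivAt_pi.1 (hx.ode t ht) 1

lemma deriv_p (hx : RedSol N D ε K T x) {t : ℝ} (ht : t ∈ Ioo 0 T) :
    HasDerivAt (fun t => x t 2) (-redMean N D (x t) * x t 2 + (K + ε * x t 4)) t := by
  simpa [redField] using hasDerivAt_pi.1 (hx.ode t ht) 2

lemma deriv_h (hx : RedSol N D ε K T x) {t : ℝ} (ht : t ∈ Ioo 0 T) :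
    HasDerivAt (fun t => x t 3) (-redMean N D (x t) * x t 3 + ε / 2) t := by
  simpa [redField] using hasDerivAt_pi.1 (hx.ode t ht) 3

lemma deriv_v (hx : RedSol N D ε K T x) {t : ℝ} (ht : t ∈ Ioo 0 T) :
    HasDerivAt (fun t => x t 4) (x t 2) t := by
  simpa [redField] using hasDerivAt_pi.1 (hx.ode t ht) 4

lemma lim_f (hx : RedSol N D ε K T x) : Tendsto (fun t => x t 0) (𝓝[>] 0) (𝓝 0) := by
  simpa using tendsto_pi_nhds.1 hx.lim 0

lemma lim_y (hx : RedSol N D ε K T x) : Tendsto (fun t => x t 1) (𝓝[>] 0) (𝓝 1) := by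
  simpa using tendsto_pi_nhds.1 hx.lim 1

lemma lim_p (hx : RedSol N D ε K T x) : Tendsto (fun t => x t 2) (𝓝[>] 0) (𝓝 0) := by
  simpa using tendsto_pi_nhds.1 hx.lim 2

lemma lim_h (hx : RedSol N D ε K T x) : Tendsto (fun t => x t 3) (𝓝[>] 0) (𝓝 0) := by
  simpa using tendsto_pi_nhds.1 hx.lim 3

lemma lim_v (hx : RedSol N D ε K T x) : Tendsto (fun t => x t 4) (𝓝[>] 0) (𝓝 0) := by
  simpa using tendsto_pi_nhds.1 hx.lim 4

end RedSol

end WarpedSoliton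

/-! ### Positivity and the first integral of the reduced system. -/

namespace WarpedSoliton

namespace RedSol

variable {N : ℕ} {D ε K T : ℝ} {x : ℝ → Fin 5 → ℝ}

lemma tendsto_err (hx : RedSol N D ε K T x) :
    Tendsto (fun t => x t 2 + D * x t 3) (𝓝[>] 0) (𝓝 0) := by
  simpa using hx.lim_p.add (hx.lim_h.const_mul D)

/-- Breaks a circle: the signs of `p` and `h` are obtained from `M ≥ 0`, and later `M > 0` from
those signs. Near `0` the limits alone suffice, because `y / f ≥ 1` with weight `N ≥ 2` outweighs `p
+ D h > -1`. -/
lemma exists_mean_pos_near (hx : RedSol N D ε K T x) (P : Params N D ε K) (hT : 0 < T) :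
    ∃ δ, 0 < δ ∧ δ ≤ T ∧ ∀ t ∈ Ioo 0 δ, 0 < redMean N D (x t) ∧ 0 < x t 1 ∧
      0 < K + ε * x t 4 := by
  have h1 : ∀ᶠ t in 𝓝[>] (0 : ℝ), x t 0 < 1 / 2 := hx.lim_f.eventually (gt_mem_nhds (by norm_num))
  have h2 : ∀ᶠ t in 𝓝[>] (0 : ℝ), 1 / 2 < x t 1 := hx.lim_y.eventually (lt_mem_nhds (by norm_num))
  have h3 : ∀ᶠ t in 𝓝[>] (0 : ℝ), -1 < x t 2 + D * x t 3 :=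
    hx.tendsto_err.eventually (lt_mem_nhds (by norm_num))
  have h4 : ∀ᶠ t in 𝓝[>] (0 : ℝ), 0 < K + ε * x t 4 := by
    have : Tendsto (fun t => K + ε * x t 4) (𝓝[>] 0) (𝓝 K) := by
      simpa using (hx.lim_v.const_mul ε).const_add K
    exact this.eventually (lt_mem_nhds P.hK)
  have h5 : ∀ᶠ t in 𝓝[>] (0 : ℝ), t ∈ Ioo 0 T := Ioo_mem_nhdsGT hT
  obtain ⟨δ, hδ, hsub⟩ := mem_nhdsGT_iff_exists_Ioo_subset.1
    (h1.and (h2.and (h3.and (h4.and h5))))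
  have hδ' : (0 : ℝ) < δ := hδ
  refine ⟨min δ T, lt_min hδ' hT, min_le_right _ _, fun t ht => ?_⟩
  obtain ⟨a1, a2, a3, a4, a5⟩ := hsub ⟨ht.1, ht.2.trans_le (min_le_left _ _)⟩
  refine ⟨?_, by linarith, a4⟩
  have hf := hx.pos_f t a5
  have h6 : 1 ≤ x t 1 / x t 0 := by
    rw [le_div_iff₀ hf]; linarith
  have h7 : (2 : ℝ) ≤ N := by exact_mod_cast P.hN
  unfold redMean
  nlinarith

lemma pos_near (hx : RedSol N D ε K T x) (P : Params N D ε K) (hT : 0 < T) :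
    ∃ δ, 0 < δ ∧ δ ≤ T ∧ ∀ t ∈ Ioo 0 δ, 0 < x t 1 ∧ 0 < x t 2 ∧ 0 < x t 3 ∧ 0 < x t 4 := by
  obtain ⟨δ, hδ, hδT, hM⟩ := hx.exists_mean_pos_near P hT
  have hx' := hx.mono hδT
  have hp : ∀ t ∈ Ioo 0 δ, 0 < x t 2 :=
    pos_of_deriv_gt (fun t ht => hx'.deriv_p ht) (fun t ht => (hM t ht).1.le)
      (fun t ht => by linarith [(hM t ht).2.2]) hx.lim_p
  have hh : ∀ t ∈ Ioo 0 δ, 0 < x t 3 :=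
    pos_of_deriv_gt (fun t ht => hx'.deriv_h ht) (fun t ht => (hM t ht).1.le)
      (fun t ht => by linarith [P.hε]) hx.lim_h
  have hv : ∀ t ∈ Ioo 0 δ, 0 < x t 4 :=
    pos_of_deriv_gt (M := fun _ => 0) (fun t ht => hx'.deriv_v ht) (fun t ht => le_rfl)
      (fun t ht => by simpa using hp t ht) hx.lim_v
  exact ⟨δ, hδ, hδT, fun t ht => ⟨(hM t ht).2.1, hp t ht, hh t ht, hv t ht⟩⟩

/-- At a first zero each variable has positive derivative: `(N - 1)/f + (ε/2) f` for `y`, `K + εv`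
for `p`, and `ε/2` for `h`. The variable `v` is not tracked separately, since `v' = p` keeps it
positive as long as `p` is. -/
lemma pos_all (hx : RedSol N D ε K T x) (P : Params N D ε K) :
    ∀ t ∈ Ioo 0 T, 0 < x t 1 ∧ 0 < x t 2 ∧ 0 < x t 3 ∧ 0 < x t 4 := by
  intro t ht
  obtain ⟨δ, hδ, hδT, hpos⟩ := hx.pos_near P (ht.1.trans ht.2)
  rcases lt_or_ge t δ with hlt | hge
  · exact hpos t ⟨ht.1, hlt⟩
  set a := δ / 2 with ha
  have ha0 : 0 < a := by positivity
  have haδ : a < δ := by linarith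
  have hapos := hpos a ⟨ha0, haδ⟩
  have hsub : ∀ s ∈ Ico a T, s ∈ Ioo 0 T := fun s hs => ⟨ha0.trans_le hs.1, hs.2⟩
  have vmono : ∀ s ∈ Ico a T, (∀ r ∈ Ico a s, 0 < x r 2) → 0 < x s 4 := fun s hs hr =>
    hapos.2.2.2.trans_le (le_of_deriv_nonneg_Icc (g := fun t => x t 4) hs.1
      (fun r hr' => hx.deriv_v (hsub r ⟨hr'.1, hr'.2.trans_lt hs.2⟩))
      (fun r hr' => (hr r ⟨hr'.1.le, hr'.2⟩).le))
  have key := pos_of_first_zero (a := a) (b := T)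
    (φ := ![fun t => x t 1, fun t => x t 2, fun t => x t 3])
    (φ' := ![fun t => -(x t 2 + D * x t 3) * x t 1 + (N - 1) * (1 - x t 1 ^ 2) / x t 0
      + ε / 2 * x t 0, fun t => -redMean N D (x t) * x t 2 + (K + ε * x t 4),
      fun t => -redMean N D (x t) * x t 3 + ε / 2])
    (by
      intro i s hs
      fin_cases i
      · exact hx.deriv_y (hsub s hs)
      · exact hx.deriv_p (hsub s hs)
      · exact hx.deriv_h (hsub s hs))
    (by
      intro i
      fin_cases i
      · exact hapos.1
      · exact hapos.2.1
      · exact hapos.2.2.1)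
    (by
      intro s hs hbefore _ i hi
      have hs' : s ∈ Ico a T := ⟨hs.1.le, hs.2⟩
      have hf := hx.pos_f s (hsub s hs')
      have hε := P.hε
      have hN : (2 : ℝ) ≤ N := by exact_mod_cast P.hN
      fin_cases i
      · have hi : x s 1 = 0 := hi
        change 0 < -(x s 2 + D * x s 3) * x s 1 + (N - 1) * (1 - x s 1 ^ 2) / x s 0
          + ε / 2 * x s 0
        rw [hi]
        have : 0 < (N - 1 : ℝ) * (1 - 0 ^ 2) / x s 0 := by
          apply div_pos _ hf; nlinarith
        nlinarith [mul_pos hε hf]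
      · have hi : x s 2 = 0 := hi
        change 0 < -redMean N D (x s) * x s 2 + (K + ε * x s 4)
        rw [hi]
        have := vmono s hs' fun r hr => hbefore r hr 1
        nlinarith [P.hK, mul_pos hε this]
      · have hi : x s 3 = 0 := hi
        change 0 < -redMean N D (x s) * x s 3 + ε / 2
        rw [hi]
        linarith)
  have htm : t ∈ Ico a T := ⟨by linarith, ht.2⟩
  exact ⟨key t htm 0, key t htm 1, key t htm 2,
    vmono t htm fun r hr => key r ⟨hr.1, hr.2.trans ht.2⟩ 1⟩

lemma pos_y (hx : RedSol N D ε K T x) (P : Params N D ε K) {t : ℝ} (ht : t ∈ Ioo 0 T) :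
    0 < x t 1 := (hx.pos_all P t ht).1

lemma pos_p (hx : RedSol N D ε K T x) (P : Params N D ε K) {t : ℝ} (ht : t ∈ Ioo 0 T) :
    0 < x t 2 := (hx.pos_all P t ht).2.1

lemma pos_h (hx : RedSol N D ε K T x) (P : Params N D ε K) {t : ℝ} (ht : t ∈ Ioo 0 T) :
    0 < x t 3 := (hx.pos_all P t ht).2.2.1

lemma pos_v (hx : RedSol N D ε K T x) (P : Params N D ε K) {t : ℝ} (ht : t ∈ Ioo 0 T) :
    0 < x t 4 := (hx.pos_all P t ht).2.2.2

lemma pos_Z (hx : RedSol N D ε K T x) (P : Params N D ε K) {t : ℝ} (ht : t ∈ Ioo 0 T) :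
    0 < K + ε * x t 4 := by
  have := mul_pos P.hε (hx.pos_v P ht); linarith [P.hK]

lemma two_le (P : Params N D ε K) : (2 : ℝ) ≤ N := by exact_mod_cast P.hN

lemma pos_mean (hx : RedSol N D ε K T x) (P : Params N D ε K) {t : ℝ} (ht : t ∈ Ioo 0 T) :
    0 < redMean N D (x t) := by
  have h1 := hx.pos_p P ht
  have h2 : 0 < x t 1 / x t 0 := div_pos (hx.pos_y P ht) (hx.pos_f t ht)
  have h3 := mul_nonneg P.hD (hx.pos_h P ht).le
  have := two_le P
  unfold redMean
  nlinarith

/-- The first integral of the reduced system. -/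
lemma conservation (hx : RedSol N D ε K T x) (P : Params N D ε K) {t : ℝ} (ht : t ∈ Ioo 0 T) :
    redMean N D (x t) ^ 2 = N * (x t 1 / x t 0) ^ 2 + D * x t 3 ^ 2 + N * (N - 1) / x t 0 ^ 2
      + (N + D - 1) * (ε / 2) + (K + ε * x t 4) := by
  set e : ℝ → ℝ := fun t => x t 2 + D * x t 3 with he
  have hN := two_le P
  -- the defect, multiplied by `f ^ 2`
  set g : ℝ → ℝ := fun t => (N * x t 1 + e t * x t 0) ^ 2 - N * x t 1 ^ 2
    - D * (x t 3 ^ 2 * x t 0 ^ 2) - N * (N - 1)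
    - ((N + D - 1) * (ε / 2) + (K + ε * x t 4)) * x t 0 ^ 2 with hg
  have hlim : Tendsto g (𝓝[>] 0) (𝓝 0) := by
    have h1 := (((hx.lim_y.const_mul (N : ℝ)).add (hx.tendsto_err.mul hx.lim_f)).pow 2).sub
      ((hx.lim_y.pow 2).const_mul (N : ℝ))
    have h2 := (h1.sub (((hx.lim_h.pow 2).mul (hx.lim_f.pow 2)).const_mul D)).sub_const
      ((N : ℝ) * (N - 1))
    have h3 := h2.sub ((((hx.lim_v.const_mul ε).const_add K).const_add
      ((N + D - 1) * (ε / 2))).mul (hx.lim_f.pow 2))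
    convert h3 using 2
    ring
  -- The defect solves a homogeneous linear equation with damping `2 (M - y/f) ≥ 0`, so its
  -- vanishing limit at `0` forces it to vanish. The factor `f²` is what makes that limit exist; it
  -- equals `N² - N - N (N - 1) = 0`.
  have hder : ∀ t ∈ Ioo 0 T, HasDerivAt g
      (-(2 * (redMean N D (x t) - x t 1 / x t 0)) * g t) t := by
    intro t ht
    have hf := (hx.pos_f t ht).ne'
    have d0 := hx.deriv_f ht
    have d1 := hx.deriv_y ht
    have d2 := hx.deriv_p ht
    have d3 := hx.deriv_h ht
    have d4 := hx.deriv_v ht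
    have de : HasDerivAt e _ t := d2.add (d3.const_mul D)
    have := ((((((d1.const_mul (N : ℝ)).add (de.mul d0)).pow 2).sub
      ((d1.pow 2).const_mul (N : ℝ))).sub (((d3.pow 2).mul (d0.pow 2)).const_mul D)).sub_const
      ((N : ℝ) * (N - 1))).sub ((((d4.const_mul ε).const_add K).const_add
      ((N + D - 1) * (ε / 2))).mul (d0.pow 2))
    refine this.congr_deriv ?_
    simp only [hg, he, redMean, Pi.pow_apply, Pi.mul_apply, Pi.add_apply]
    field_simp
    ring
  have hz := eq_zero_of_deriv_eq hder (fun t ht => ?_) hlim t ht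
  · have hf := hx.pos_f t ht
    have hz' : g t = 0 := hz
    have h1 : redMean N D (x t) * x t 0 = N * x t 1 + e t * x t 0 := by
      simp only [redMean, he]; field_simp; ring
    have h2 : g t = (redMean N D (x t) ^ 2 - (N * (x t 1 / x t 0) ^ 2 + D * x t 3 ^ 2
      + N * (N - 1) / x t 0 ^ 2 + (N + D - 1) * (ε / 2) + (K + ε * x t 4))) * x t 0 ^ 2 := by
      have h3 : g t = (redMean N D (x t) * x t 0) ^ 2 - N * x t 1 ^ 2
        - D * (x t 3 ^ 2 * x t 0 ^ 2) - N * (N - 1)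
        - ((N + D - 1) * (ε / 2) + (K + ε * x t 4)) * x t 0 ^ 2 := by rw [h1]
      rw [h3]; field_simp; ring
    rw [h2] at hz'
    rcases mul_eq_zero.1 hz' with h | h
    · linarith
    · exact absurd h (pow_pos hf 2).ne'
  · have h1 : 0 < x t 1 / x t 0 := div_pos (hx.pos_y P ht) (hx.pos_f t ht)
    have h2 := hx.pos_p P ht
    have h3 := mul_nonneg P.hD (hx.pos_h P ht).le
    unfold redMean
    nlinarith

/-- This is the mean curvature equation of the soliton. The reduced system contains the first
integral in its place, so `conservation` is needed to recover it. -/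
lemma deriv_mean (hx : RedSol N D ε K T x) (P : Params N D ε K) {t : ℝ} (ht : t ∈ Ioo 0 T) :
    HasDerivAt (fun t => redMean N D (x t))
      (ε / 2 - (N * (x t 1 / x t 0) ^ 2 + D * x t 3 ^ 2)) t := by
  have hf := (hx.pos_f t ht).ne'
  have hc := hx.conservation P ht
  have := ((hx.deriv_p ht).add ((((hx.deriv_y ht).div (hx.deriv_f ht) hf)).const_mul
    (N : ℝ))).add ((hx.deriv_h ht).const_mul D)
  refine this.congr_deriv ?_
  have h2 : (N : ℝ) * (((-(x t 2 + D * x t 3) * x t 1 + (N - 1) * (1 - x t 1 ^ 2) / x t 0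
      + ε / 2 * x t 0) * x t 0 - x t 1 * x t 1) / x t 0 ^ 2)
      = N * (-redMean N D (x t) * (x t 1 / x t 0) + (N - 1) / x t 0 ^ 2 + ε / 2) := by
    simp only [redMean]; field_simp; ring
  rw [h2]
  have h3 : redMean N D (x t) * redMean N D (x t)
    = redMean N D (x t) * (x t 2 + N * (x t 1 / x t 0) + D * x t 3) := rfl
  have h4 : N * (N - 1) / x t 0 ^ 2 = N * ((N - 1) / x t 0 ^ 2) := by ring
  rw [h4] at hc
  nlinarith

end RedSol

end WarpedSoliton

/-! ### A priori bounds and a forward invariant region. -/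

namespace WarpedSoliton

/-- The set of states from which the derivative of the warping function stays below `B`. -/
def Trapped (N : ℕ) (D ε K B : ℝ) (z : Fin 5 → ℝ) : Prop :=
  z 1 < B ∧ ε / (2 * B) * z 0 < z 2 ∧ z 3 * z 0 < B ∧
    (N + D + 1) * (ε / 2) < K + ε * z 4 - (ε / (2 * B)) ^ 2 * z 0 ^ 2

namespace RedSol

variable {N : ℕ} {D ε K T : ℝ} {x : ℝ → Fin 5 → ℝ}

/-- If `y` touches `2 exp((1 + ε) t)`, then `y > 1`, so every term of `y'` except `(ε/2) f` is
nonpositive. Integrating the bound on `y` up to that moment makes this term too small for a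
crossing. -/
lemma y_f_le (hx : RedSol N D ε K T x) (P : Params N D ε K) :
    ∀ t ∈ Ioo 0 T, x t 1 < 2 * Real.exp ((1 + ε) * t) ∧
      x t 0 ≤ 2 / (1 + ε) * Real.exp ((1 + ε) * t) := by
  intro t ht
  have hε := P.hε
  have hc : 0 < 1 + ε := by linarith
  obtain ⟨a, ⟨ha1, ha2⟩, ha⟩ := ((hx.lim_y.eventually (gt_mem_nhds (show (1 : ℝ) < 2 by norm_num))).and
    (hx.lim_f.eventually (gt_mem_nhds (show 0 < 2 / (1 + ε) by positivity)))).and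
    (Ioo_mem_nhdsGT ht.1) |>.exists
  have hsub : ∀ s ∈ Ico a T, s ∈ Ioo 0 T := fun s hs => ⟨ha.1.trans_le hs.1, hs.2⟩
  have hexp : ∀ s, 0 < s → 1 < Real.exp ((1 + ε) * s) := fun s hs =>
    Real.one_lt_exp_iff.2 (by positivity)
  have dE : ∀ s, HasDerivAt (fun s => Real.exp ((1 + ε) * s))
      (Real.exp ((1 + ε) * s) * (1 + ε)) s := fun s => by
    simpa using ((hasDerivAt_id s).const_mul (1 + ε)).exp
  have fle : ∀ s ∈ Ico a T, (∀ r ∈ Ico a s, 0 < 2 * Real.exp ((1 + ε) * r) - x r 1) →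
      x s 0 ≤ 2 / (1 + ε) * Real.exp ((1 + ε) * s) := by
    intro s hs hr
    have := le_of_deriv_nonneg_Icc (g := fun r => 2 / (1 + ε) * Real.exp ((1 + ε) * r) - x r 0)
      hs.1 (fun r hr' => ((dE r).const_mul _).sub (hx.deriv_f (hsub r ⟨hr'.1, hr'.2.trans_lt hs.2⟩)))
      (fun r hr' => by
        have := hr r ⟨hr'.1.le, hr'.2⟩
        have h2 : 2 / (1 + ε) * (Real.exp ((1 + ε) * r) * (1 + ε))
          = 2 * Real.exp ((1 + ε) * r) := by field_simp
        rw [h2]; exact this.le)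
    have h1 := hexp a ha.1
    have h2 : 0 < 2 / (1 + ε) := by positivity
    nlinarith
  have key := pos_of_first_zero (a := a) (b := T) (ι := Unit)
    (φ := fun _ s => 2 * Real.exp ((1 + ε) * s) - x s 1) (φ' := fun _ s => _)
    (fun _ s hs => ((dE s).const_mul 2).sub (hx.deriv_y (hsub s hs)))
    (fun _ => by have := hexp a ha.1; linarith)
    (by
      intro s hs hb _ _ hz
      have hs' : s ∈ Ico a T := ⟨hs.1.le, hs.2⟩
      have h1 := fle s hs' fun r hr => hb r hr ()
      have hy : x s 1 = 2 * Real.exp ((1 + ε) * s) := by linarith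
      have h2 := hexp s (hsub s hs').1
      have hf := hx.pos_f s (hsub s hs')
      have h3 : 0 ≤ (x s 2 + D * x s 3) * x s 1 := mul_nonneg (add_nonneg
        (hx.pos_p P (hsub s hs')).le (mul_nonneg P.hD (hx.pos_h P (hsub s hs')).le))
        (hx.pos_y P (hsub s hs')).le
      have h4 : (N - 1 : ℝ) * (1 - x s 1 ^ 2) / x s 0 ≤ 0 := by
        refine div_nonpos_of_nonpos_of_nonneg ?_ hf.le
        have := two_le P
        refine mul_nonpos_of_nonneg_of_nonpos (by linarith) ?_
        rw [hy]; nlinarith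
      have h5 : ε / 2 * x s 0 ≤ ε / (1 + ε) * Real.exp ((1 + ε) * s) := by
        calc ε / 2 * x s 0 ≤ ε / 2 * (2 / (1 + ε) * Real.exp ((1 + ε) * s)) := by gcongr
          _ = _ := by field_simp
      have h6 : ε / (1 + ε) ≤ 1 := by rw [div_le_one hc]; linarith
      nlinarith)
  have htm : t ∈ Ico a T := ⟨ha.2.le, ht.2⟩
  exact ⟨by linarith [key t htm ()],
    fle t htm fun r hr => key r ⟨hr.1, hr.2.trans ht.2⟩ ()⟩

lemma h_le (hx : RedSol N D ε K T x) (P : Params N D ε K) {t : ℝ} (ht : t ∈ Ioo 0 T) :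
    x t 3 ≤ ε / 2 * t := by
  have hlim : Tendsto (fun t => ε / 2 * t - x t 3) (𝓝[>] 0) (𝓝 0) := by
    have : Tendsto (fun t : ℝ => ε / 2 * t) (𝓝[>] 0) (𝓝 (ε / 2 * 0)) :=
      ((continuous_const.mul continuous_id).tendsto 0).mono_left nhdsWithin_le_nhds
    simpa using this.sub hx.lim_h
  have := le_of_deriv_nonneg (g := fun t => ε / 2 * t - x t 3)
    (fun s hs => (((hasDerivAt_id s).const_mul (ε / 2)).sub (hx.deriv_h hs)))
    (fun s hs => by
      have := mul_pos (hx.pos_mean P hs) (hx.pos_h P hs)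
      linarith) hlim t ht
  linarith

/-- Dropping the damping `-Mp ≤ 0`, the quantity `K + p + v` grows at rate at most `1 + ε`. -/
lemma p_add_v_le (hx : RedSol N D ε K T x) (P : Params N D ε K) {t : ℝ} (ht : t ∈ Ioo 0 T) :
    x t 2 + x t 4 ≤ K * Real.exp ((1 + ε) * t) := by
  have hε := P.hε
  have hK := P.hK
  have dE : ∀ s, HasDerivAt (fun s => Real.exp (-(1 + ε) * s))
      (Real.exp (-(1 + ε) * s) * (-(1 + ε))) s := fun s => by
    simpa using ((hasDerivAt_id s).const_mul (-(1 + ε))).exp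
  have hlim : Tendsto (fun t => -(Real.exp (-(1 + ε) * t) * (K + (x t 2 + x t 4)))) (𝓝[>] 0)
      (𝓝 (-K)) := by
    have h1 : Tendsto (fun t => Real.exp (-(1 + ε) * t)) (𝓝[>] 0)
        (𝓝 (Real.exp (-(1 + ε) * 0))) := (dE 0).continuousAt.tendsto.mono_left nhdsWithin_le_nhds
    simpa using (h1.mul ((hx.lim_p.add hx.lim_v).const_add K)).neg
  have := le_of_deriv_nonneg (g := fun t => -(Real.exp (-(1 + ε) * t) * (K + (x t 2 + x t 4))))
    (fun s hs => ((dE s).mul (((hx.deriv_p hs).add (hx.deriv_v hs)).const_add K)).neg)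
    (fun s hs => by
      have h1 := Real.exp_pos (-(1 + ε) * s)
      have h2 := mul_pos (hx.pos_mean P hs) (hx.pos_p P hs)
      have h3 := hx.pos_v P hs
      have h4 := hx.pos_p P hs
      have h5 : 0 ≤ (1 + ε) * (K + (x s 2 + x s 4))
          - (-redMean N D (x s) * x s 2 + (K + ε * x s 4) + x s 2) := by nlinarith
      have := mul_nonneg h1.le h5
      simp only [Pi.add_apply]
      nlinarith) hlim t ht
  have h1 : Real.exp (-(1 + ε) * t) * (K + (x t 2 + x t 4)) ≤ K := by linarith
  have h2 : K + (x t 2 + x t 4) ≤ K * Real.exp ((1 + ε) * t) := by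
    rw [neg_mul, Real.exp_neg, inv_mul_le_iff₀ (Real.exp_pos _)] at h1
    linarith
  linarith

/-- Let `λ = ε/(2B)`, so `λB = ε/2` and `p ≥ λf` means `pB ≥ (ε/2) f`. On the wall `y = B` the
damping `pB` beats `(ε/2) f`, and `(N - 1)(1 - B²)/f < 0`. On `hf = B` the same comparison works,
and `N ≥ 2` absorbs the term `hy`. On `p = λf` one has `λMf + λy ≤ λ²f² + (N + D + 1) ε/2`, which
the fourth condition keeps below `K + εv`. -/
lemma trapped_forward (hx : RedSol N D ε K T x) (P : Params N D ε K) {B t₀ : ℝ} (hB : 1 < B)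
    (ht₀ : 0 < t₀) (h : Trapped N D ε K B (x t₀)) :
    ∀ t ∈ Ico t₀ T, Trapped N D ε K B (x t) := by
  have hε := P.hε
  have hB0 : 0 < B := by linarith
  set lam := ε / (2 * B) with hlam
  have hl : 0 < lam := by positivity
  have hlB : lam * B = ε / 2 := by rw [hlam]; field_simp
  have hN := two_le P
  have hD := P.hD
  have hsub : ∀ s ∈ Ico t₀ T, s ∈ Ioo 0 T := fun s hs => ⟨ht₀.trans_le hs.1, hs.2⟩
  have dQ : ∀ s ∈ Ico t₀ T, HasDerivAt (fun s => K + ε * x s 4 - lam ^ 2 * x s 0 ^ 2)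
      (ε * x s 2 - lam ^ 2 * (2 * x s 0 * x s 1)) s := fun s hs => by
    have := (((hx.deriv_v (hsub s hs)).const_mul ε).const_add K).sub
      (((hx.deriv_f (hsub s hs)).pow 2).const_mul (lam ^ 2))
    refine this.congr_deriv ?_
    simp
  -- The fourth condition needs no wall of its own: while `y < B` and `p > λf`, the derivative `εp -
  -- 2λ²fy` is at least `λf (ε - 2λB) = 0`.
  have hQ : ∀ s ∈ Ico t₀ T, (∀ r ∈ Ico t₀ s, 0 < B - x r 1 ∧ 0 < x r 2 - lam * x r 0) →
      (N + D + 1) * (ε / 2) < K + ε * x s 4 - lam ^ 2 * x s 0 ^ 2 := by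
    intro s hs hr
    refine h.2.2.2.trans_le (le_of_deriv_nonneg_Icc
      (g := fun s => K + ε * x s 4 - lam ^ 2 * x s 0 ^ 2) hs.1
      (fun r hr' => dQ r ⟨hr'.1, hr'.2.trans_lt hs.2⟩) fun r hr' => ?_)
    obtain ⟨h1, h2⟩ := hr r ⟨hr'.1.le, hr'.2⟩
    have hf := hx.pos_f r (hsub r ⟨hr'.1.le, hr'.2.trans hs.2⟩)
    have h3 : ε * x r 2 ≥ ε * (lam * x r 0) := by nlinarith
    have h4 : ε = 2 * (lam * B) := by linarith
    have h5 : ε * (lam * x r 0) = 2 * lam ^ 2 * x r 0 * B := by rw [h4]; ring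
    have h6 : 0 < 2 * lam ^ 2 * x r 0 := by positivity
    nlinarith
  have key := pos_of_first_zero (a := t₀) (b := T)
    (φ := ![fun s => B - x s 1, fun s => x s 2 - lam * x s 0, fun s => B - x s 3 * x s 0])
    (φ' := ![fun t => -(-(x t 2 + D * x t 3) * x t 1 + (N - 1) * (1 - x t 1 ^ 2) / x t 0
        + ε / 2 * x t 0),
      fun t => -redMean N D (x t) * x t 2 + (K + ε * x t 4) - lam * x t 1,
      fun t => -((-redMean N D (x t) * x t 3 + ε / 2) * x t 0 + x t 3 * x t 1)])
    (by
      intro i s hs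
      fin_cases i
      · exact (hx.deriv_y (hsub s hs)).const_sub B
      · exact (hx.deriv_p (hsub s hs)).sub ((hx.deriv_f (hsub s hs)).const_mul lam)
      · exact ((hx.deriv_h (hsub s hs)).mul (hx.deriv_f (hsub s hs))).const_sub B)
    (by
      intro i
      fin_cases i
      · exact sub_pos.2 h.1
      · exact sub_pos.2 h.2.1
      · exact sub_pos.2 h.2.2.1)
    (by
      intro s hs hb hnn i hi
      have hs' : s ∈ Ico t₀ T := ⟨hs.1.le, hs.2⟩
      have hQs := hQ s hs' fun r hr => ⟨hb r hr 0, hb r hr 1⟩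
      have n0 : 0 ≤ B - x s 1 := hnn 0
      have n1 : 0 ≤ x s 2 - lam * x s 0 := hnn 1
      have n2 : 0 ≤ B - x s 3 * x s 0 := hnn 2
      have hf := hx.pos_f s (hsub s hs')
      have hy := hx.pos_y P (hsub s hs')
      have hh := hx.pos_h P (hsub s hs')
      have hp := hx.pos_p P (hsub s hs')
      have hMf : redMean N D (x s) * x s 0 = x s 2 * x s 0 + N * x s 1 + D * (x s 3 * x s 0) := by
        unfold redMean; field_simp
      have hpB : ε / 2 * x s 0 ≤ x s 2 * B := by
        rw [← hlB]; nlinarith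
      fin_cases i
      · have hi : B - x s 1 = 0 := hi
        have hi' : x s 1 = B := by linarith
        change 0 < -(-(x s 2 + D * x s 3) * x s 1 + (N - 1) * (1 - x s 1 ^ 2) / x s 0
          + ε / 2 * x s 0)
        rw [hi']
        have h4 : (N - 1 : ℝ) * (1 - B ^ 2) / x s 0 < 0 :=
          div_neg_of_neg_of_pos (mul_neg_of_pos_of_neg (by linarith) (by nlinarith)) hf
        have h5 := mul_nonneg (mul_nonneg hD hh.le) hB0.le
        nlinarith
      · have hi : x s 2 - lam * x s 0 = 0 := hi
        have hi' : x s 2 = lam * x s 0 := by linarith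
        change 0 < -redMean N D (x s) * x s 2 + (K + ε * x s 4) - lam * x s 1
        have h1 : redMean N D (x s) * x s 2
            = lam * (lam * x s 0 * x s 0 + N * x s 1 + D * (x s 3 * x s 0)) := by
          rw [← hi', ← hMf, hi']; ring
        have h2 : lam * (N * x s 1) ≤ N * (ε / 2) := by
          rw [← hlB]
          have : 0 ≤ lam * (N * (B - x s 1)) := by positivity
          nlinarith
        have h3 : lam * x s 1 ≤ ε / 2 := by
          rw [← hlB]; nlinarith
        have h4 : lam * (D * (x s 3 * x s 0)) ≤ D * (ε / 2) := by
          rw [← hlB]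
          have : 0 ≤ lam * (D * (B - x s 3 * x s 0)) := by positivity
          nlinarith
        nlinarith
      · have hi : B - x s 3 * x s 0 = 0 := hi
        have hi' : x s 3 * x s 0 = B := by linarith
        change 0 < -((-redMean N D (x s) * x s 3 + ε / 2) * x s 0 + x s 3 * x s 1)
        have h1 : redMean N D (x s) * x s 3 * x s 0
            = x s 2 * B + N * x s 1 * x s 3 + D * B * x s 3 := by
          have : redMean N D (x s) * x s 3 * x s 0 = x s 3 * (redMean N D (x s) * x s 0) := by ring
          rw [this, hMf, ← hi']; ring
        have h2 := mul_pos hy hh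
        have h3 := mul_nonneg (mul_nonneg hD hB0.le) hh.le
        nlinarith)
  intro t ht
  exact ⟨sub_pos.1 (key t ht 0), sub_pos.1 (key t ht 1), sub_pos.1 (key t ht 2),
    hQ t ht fun r hr => ⟨key r ⟨hr.1, hr.2.trans ht.2⟩ 0, key r ⟨hr.1, hr.2.trans ht.2⟩ 1⟩⟩

/-- For large `K` the derivative of the warping function is bounded by `2`. -/
lemma y_lt_two (hx : RedSol N D ε K T x) (P : Params N D ε K) (hK : (N + D + 1) * (ε / 2) < K) :
    ∀ t ∈ Ioo 0 T, x t 1 < 2 := by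
  intro t ht
  have hε := P.hε
  have hN := two_le P
  have hD := P.hD
  have hpf : ∃ δ, 0 < δ ∧ δ ≤ T ∧ ∀ t ∈ Ioo 0 δ, 0 < x t 2 - ε / 4 * x t 0 := by
    -- Here `B = 2`, so `λ = ε/4`. The expression is `Z - λy - λMf`, which equals `(p - λf)' + M (p
    -- - λf)`. Its limit is positive by the lower bound on `K`, so `p > λf` holds from the start.
    have hlim : Tendsto (fun t => K + ε * x t 4 - ε / 4 * x t 1 - ε / 4 * (x t 2 * x t 0 +
        N * x t 1 + D * (x t 3 * x t 0))) (𝓝[>] 0) (𝓝 (K - ε / 4 * (N + 1))) := by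
      have := ((((hx.lim_v.const_mul ε).const_add K).sub (hx.lim_y.const_mul (ε / 4)))).sub
        ((((hx.lim_p.mul hx.lim_f).add (hx.lim_y.const_mul (N : ℝ))).add
        ((hx.lim_h.mul hx.lim_f).const_mul D)).const_mul (ε / 4))
      convert this using 2
      ring
    have hpos : 0 < K - ε / 4 * (N + 1) := by nlinarith [mul_nonneg hD hε.le]
    obtain ⟨δ, hδ, hs⟩ := mem_nhdsGT_iff_exists_Ioo_subset.1 (hlim.eventually (lt_mem_nhds hpos))
    have hδ : (0 : ℝ) < δ := hδ
    have hTpos := ht.1.trans ht.2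
    refine ⟨min δ T, lt_min hδ hTpos, min_le_right _ _, ?_⟩
    have hsub : ∀ s ∈ Ioo 0 (min δ T), s ∈ Ioo 0 T := fun s hs =>
      ⟨hs.1, hs.2.trans_le (min_le_right _ _)⟩
    refine pos_of_deriv_gt (M := fun t => redMean N D (x t))
      (fun s hs => (hx.deriv_p (hsub s hs)).sub ((hx.deriv_f (hsub s hs)).const_mul (ε / 4)))
      (fun s hs => (hx.pos_mean P (hsub s hs)).le) (fun s hs' => ?_) ?_
    · have h1 : 0 < K + ε * x s 4 - ε / 4 * x s 1 - ε / 4 * (x s 2 * x s 0 +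
        N * x s 1 + D * (x s 3 * x s 0)) := hs ⟨hs'.1, hs'.2.trans_le (min_le_left _ _)⟩
      have hf := hx.pos_f s (hsub s hs')
      have hMf : redMean N D (x s) * x s 0 = x s 2 * x s 0 + N * x s 1 + D * (x s 3 * x s 0) := by
        unfold redMean; field_simp
      rw [← hMf] at h1
      linarith
    · simpa using hx.lim_p.sub (hx.lim_f.const_mul (ε / 4))
  obtain ⟨δ, hδ, hδT, hδp⟩ := hpf
  have hQ : Tendsto (fun t => K + ε * x t 4 - (ε / (2 * 2)) ^ 2 * x t 0 ^ 2) (𝓝[>] 0) (𝓝 K) := by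
    simpa using ((hx.lim_v.const_mul ε).const_add K).sub
      ((hx.lim_f.pow 2).const_mul ((ε / (2 * 2)) ^ 2))
  have hhf : Tendsto (fun t => x t 3 * x t 0) (𝓝[>] 0) (𝓝 0) := by
    simpa using hx.lim_h.mul hx.lim_f
  obtain ⟨a, ⟨⟨⟨ha1, ha2⟩, ha3⟩, ha4⟩, ha5⟩ :=
    ((((hx.lim_y.eventually (gt_mem_nhds (show (1 : ℝ) < 2 by norm_num))).and
    (hhf.eventually (gt_mem_nhds (show (0 : ℝ) < 2 by norm_num)))).and
    (hQ.eventually (lt_mem_nhds hK))).and (Ioo_mem_nhdsGT hδ)).and (Ioo_mem_nhdsGT ht.1) |>.exists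
  have htr : Trapped N D ε K 2 (x a) := by
    refine ⟨ha1, ?_, ha2, ha3⟩
    have h := hδp a ha4
    have : ε / (2 * 2) = ε / 4 := by norm_num
    rw [this]; linarith
  exact (hx.trapped_forward P (by norm_num) ha5.1 htr t ⟨ha5.2.le, ht.2⟩).1

end RedSol

end WarpedSoliton

/-! ### Monotonicity of the growth ratio and the slope at infinity. -/

namespace WarpedSoliton

/-- The quantity `((N - 1) + (ε/2) f ^ 2) / (K - ε u)`, which is monotone along solutions. -/
noncomputable def growthRatio (N : ℕ) (ε K : ℝ) (z : Fin 5 → ℝ) : ℝ :=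
  ((N - 1) + ε / 2 * z 0 ^ 2) / (K + ε * z 4)

namespace RedSol

variable {N : ℕ} {D ε K T : ℝ} {x : ℝ → Fin 5 → ℝ}

/-- A Wronskian. With `W = (N - 1) + (ε/2) f²` and `Z = K + εv`, one has `W' = ε(fy)`, `(fy)' =
-M(fy) + W + 2y²`, `Z' = εp`, `p' = -Mp + Z`. For `c = 0` only the damping and `2y²Z` survive; the
shift of `W` by `c` contributes `-cZ`. The sign of `2y² - c` therefore decides the sign of the
Wronskian. -/
lemma deriv_defect (hx : RedSol N D ε K T x) (c : ℝ) {t : ℝ} (ht : t ∈ Ioo 0 T) :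
    HasDerivAt (fun t => x t 0 * x t 1 * (K + ε * x t 4)
        - x t 2 * ((N - 1) + ε / 2 * x t 0 ^ 2 + c))
      (-redMean N D (x t) * (x t 0 * x t 1 * (K + ε * x t 4)
        - x t 2 * ((N - 1) + ε / 2 * x t 0 ^ 2 + c)) + (2 * x t 1 ^ 2 - c) * (K + ε * x t 4)) t := by
  have hf := (hx.pos_f t ht).ne'
  have := (((hx.deriv_f ht).mul (hx.deriv_y ht)).mul (((hx.deriv_v ht).const_mul ε).const_add K)).sub
    ((hx.deriv_p ht).mul (((((hx.deriv_f ht).pow 2).const_mul (ε / 2)).const_add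
      ((N : ℝ) - 1)).add_const c))
  refine this.congr_deriv ?_
  simp only [redMean, Pi.mul_apply, Pi.pow_apply]
  field_simp
  ring

lemma lim_defect (hx : RedSol N D ε K T x) (c : ℝ) :
    Tendsto (fun t => x t 0 * x t 1 * (K + ε * x t 4)
        - x t 2 * ((N - 1) + ε / 2 * x t 0 ^ 2 + c)) (𝓝[>] 0) (𝓝 0) := by
  have := ((hx.lim_f.mul hx.lim_y).mul ((hx.lim_v.const_mul ε).const_add K)).sub
    (hx.lim_p.mul ((((hx.lim_f.pow 2).const_mul (ε / 2)).const_add ((N : ℝ) - 1)).add_const c))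
  simpa using this

lemma defect_nonneg (hx : RedSol N D ε K T x) (P : Params N D ε K) {t : ℝ} (ht : t ∈ Ioo 0 T) :
    x t 2 * ((N - 1) + ε / 2 * x t 0 ^ 2) ≤ x t 0 * x t 1 * (K + ε * x t 4) := by
  have := nonneg_of_deriv_ge (fun s hs => hx.deriv_defect 0 hs)
    (fun s hs => (hx.pos_mean P hs).le)
    (fun s hs => by
      have := mul_nonneg (sq_nonneg (x s 1)) (hx.pos_Z P hs).le
      linarith) (hx.lim_defect 0) t ht
  linarith

lemma defect_nonpos (hx : RedSol N D ε K T x) (P : Params N D ε K) {c : ℝ}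
    (hc : ∀ t ∈ Ioo 0 T, 2 * x t 1 ^ 2 ≤ c) {t : ℝ} (ht : t ∈ Ioo 0 T) :
    x t 0 * x t 1 * (K + ε * x t 4) ≤ x t 2 * ((N - 1) + ε / 2 * x t 0 ^ 2 + c) := by
  have := nonneg_of_deriv_ge (fun s hs => (hx.deriv_defect c hs).neg)
    (fun s hs => (hx.pos_mean P hs).le)
    (fun s hs => by
      have := mul_nonneg (sub_nonneg.2 (hc s hs)) (hx.pos_Z P hs).le
      simp only [Pi.neg_apply]
      linarith) (by have := (hx.lim_defect c).neg; rwa [neg_zero] at this) t ht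
  simp only [Pi.neg_apply] at this
  linarith

lemma deriv_ratio (hx : RedSol N D ε K T x) (P : Params N D ε K) (c : ℝ) {t : ℝ}
    (ht : t ∈ Ioo 0 T) :
    HasDerivAt (fun t => ((N - 1) + ε / 2 * x t 0 ^ 2 + c) / (K + ε * x t 4))
      (ε * (x t 0 * x t 1 * (K + ε * x t 4) - x t 2 * ((N - 1) + ε / 2 * x t 0 ^ 2 + c))
        / (K + ε * x t 4) ^ 2) t := by
  have := ((((((hx.deriv_f ht).pow 2).const_mul (ε / 2)).const_add ((N : ℝ) - 1)).add_const c)).div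
    (((hx.deriv_v ht).const_mul ε).const_add K) (hx.pos_Z P ht).ne'
  refine this.congr_deriv ?_
  simp
  ring

lemma lim_ratio (hx : RedSol N D ε K T x) (P : Params N D ε K) (c : ℝ) :
    Tendsto (fun t => ((N - 1) + ε / 2 * x t 0 ^ 2 + c) / (K + ε * x t 4)) (𝓝[>] 0)
      (𝓝 ((N - 1 + c) / K)) := by
  have := ((((hx.lim_f.pow 2).const_mul (ε / 2)).const_add ((N : ℝ) - 1)).add_const c).div
    ((hx.lim_v.const_mul ε).const_add K) (by simpa using P.hK.ne')
  rw [show ((N : ℝ) - 1 + c) / K = (N - 1 + ε / 2 * 0 ^ 2 + c) / (K + ε * 0) by simp]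
  exact this

lemma monotoneOn_growthRatio (hx : RedSol N D ε K T x) (P : Params N D ε K) :
    MonotoneOn (fun t => growthRatio N ε K (x t)) (Ioo 0 T) := by
  have := monotoneOn_Ioo_of_hasDerivAt (fun t ht => hx.deriv_ratio P 0 ht) (fun t ht => by
    have := hx.defect_nonneg P ht
    refine div_nonneg (mul_nonneg P.hε.le ?_) (sq_nonneg _)
    linarith)
  simpa [growthRatio] using this

lemma le_growthRatio (hx : RedSol N D ε K T x) (P : Params N D ε K) {t : ℝ} (ht : t ∈ Ioo 0 T) :
    (N - 1) / K ≤ growthRatio N ε K (x t) := by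
  have := hx.lim_ratio P 0
  simp only [add_zero] at this
  exact le_of_monotoneOn_of_tendsto (hx.monotoneOn_growthRatio P) this t ht

/-- Phrased through the negative so that `le_of_monotoneOn_of_tendsto` applies at the left end. -/
lemma antitoneOn_growthRatio_add (hx : RedSol N D ε K T x) (P : Params N D ε K) {c : ℝ}
    (hc : ∀ t ∈ Ioo 0 T, 2 * x t 1 ^ 2 ≤ c) :
    MonotoneOn (fun t => -(growthRatio N ε K (x t) + c / (K + ε * x t 4))) (Ioo 0 T) := by
  have := monotoneOn_Ioo_of_hasDerivAt (fun t ht => (hx.deriv_ratio P c ht).neg) (fun t ht => by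
    have := hx.defect_nonpos P hc ht
    rw [← neg_div]
    refine div_nonneg ?_ (sq_nonneg _)
    nlinarith [mul_nonneg P.hε.le (sub_nonneg.2 this)])
  refine this.congr fun t ht => ?_
  simp only [growthRatio, Pi.neg_apply, add_div]

lemma growthRatio_add_le (hx : RedSol N D ε K T x) (P : Params N D ε K) {c : ℝ}
    (hc : ∀ t ∈ Ioo 0 T, 2 * x t 1 ^ 2 ≤ c) {t : ℝ} (ht : t ∈ Ioo 0 T) :
    growthRatio N ε K (x t) + c / (K + ε * x t 4) ≤ (N - 1 + c) / K := by
  have h := (hx.lim_ratio P c).neg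
  have h2 := le_of_monotoneOn_of_tendsto (hx.antitoneOn_growthRatio_add P hc)
    (h.congr fun t => by simp only [growthRatio, add_div]) t ht
  linarith

/-! ### Global solutions -/

/-- Since `M' ≤ ε/2`, `M` grows at most linearly. The damping of `p` is therefore weak enough that
the source `K` maintains `p ≥ c/t`, and `v` grows at least like `c log t`. -/
lemma tendsto_v (hx : ∀ T, RedSol N D ε K T x) (P : Params N D ε K) :
    Tendsto (fun t => x t 4) atTop atTop := by
  have hε := P.hε
  have mem : ∀ t : ℝ, 0 < t → t ∈ Ioo 0 (t + 1) := fun t ht => ⟨ht, by linarith⟩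
  have h1 := mem 1 one_pos
  set a := redMean N D (x 1) + ε with ha
  have ha0 : 0 < a := by have := (hx _).pos_mean P h1; linarith
  have hM : ∀ t, 1 ≤ t → redMean N D (x t) ≤ a * t := by
    intro t ht
    have := le_of_deriv_nonneg_Icc (g := fun t => ε / 2 * t - redMean N D (x t)) ht
      (fun s hs => ((hasDerivAt_id s).const_mul (ε / 2)).sub
        ((hx _).deriv_mean P (mem s (by linarith [hs.1]))))
      (fun s hs => by
        have := mul_nonneg P.hD (sq_nonneg (x s 3))
        have : 0 ≤ (N : ℝ) * (x s 1 / x s 0) ^ 2 := by positivity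
        linarith)
    have h2 := (hx _).pos_mean P h1
    nlinarith
  have hp1 := (hx _).pos_p P h1
  -- Small enough that `p t > c` at `t = 1` and that `ac < K`; the latter makes `(p t)'` positive
  -- whenever `p t = c`.
  set c := min (x 1 2) (K / a) / 2 with hc
  have hmin : 0 < min (x 1 2) (K / a) := lt_min hp1 (div_pos P.hK ha0)
  have hc0 : 0 < c := by positivity
  have hc1 : c < x 1 2 := by linarith [min_le_left (x 1 2) (K / a)]
  have hc2 : a * c < K := by
    have : c < K / a := by linarith [min_le_right (x 1 2) (K / a)]
    rw [lt_div_iff₀ ha0] at this; linarith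
  have hpt : ∀ t, 1 ≤ t → c ≤ x t 2 * t := by
    intro t ht
    have key := pos_of_first_zero (a := 1) (b := t + 1) (ι := Unit)
      (φ := fun _ s => x s 2 * s - c)
      (φ' := fun _ s => (-redMean N D (x s) * x s 2 + (K + ε * x s 4)) * s + x s 2 * 1)
      (fun _ s hs => (((hx _).deriv_p (mem s (by linarith [hs.1]))).mul
        (hasDerivAt_id s)).sub_const c)
      (fun _ => by linarith)
      (by
        intro s hs _ _ _ hz
        have hs0 : 0 < s := by linarith [hs.1]
        have hz' : x s 2 * s = c := by linarith
        have h3 := hM s hs.1.le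
        have h4 := (hx _).pos_p P (mem s hs0)
        have h5 := mul_pos hε ((hx _).pos_v P (mem s hs0))
        have h6 : redMean N D (x s) * x s 2 * s ≤ a * s * c := by
          rw [mul_assoc, hz']; gcongr
        nlinarith)
    have := key t ⟨ht, by linarith⟩ ()
    linarith
  have hlog : ∀ t, 1 ≤ t → c * Real.log t ≤ x t 4 := by
    intro t ht
    have := le_of_deriv_nonneg_Icc (g := fun t => x t 4 - c * Real.log t) ht
      (fun s hs => ((hx _).deriv_v (mem s (by linarith [hs.1]))).sub
        ((Real.hasDerivAt_log (by linarith [hs.1])).const_mul c))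
      (fun s hs => by
        have hs0 : 0 < s := by linarith [hs.1]
        have := hpt s hs.1.le
        rw [sub_nonneg, ← div_eq_mul_inv, div_le_iff₀ hs0]
        exact this)
    have h2 := (hx _).pos_v P h1
    simp only [Real.log_one] at this
    linarith
  refine tendsto_atTop_mono' atTop ?_ (Real.tendsto_log_atTop.const_mul_atTop hc0)
  filter_upwards [eventually_ge_atTop 1] with t ht using hlog t ht

lemma tendsto_Z (hx : ∀ T, RedSol N D ε K T x) (P : Params N D ε K) :
    Tendsto (fun t => K + ε * x t 4) atTop atTop :=
  tendsto_atTop_add_const_left _ _ ((tendsto_v hx P).const_mul_atTop P.hε)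

/-- Choose first a time at which `Z` exceeds the threshold, then `B` large. As `B → ∞`, `ε/(2B) →
0`, so all four conditions hold eventually. -/
lemma exists_trapped (hx : ∀ T, RedSol N D ε K T x) (P : Params N D ε K) :
    ∃ B t₀, 1 < B ∧ 0 < t₀ ∧ Trapped N D ε K B (x t₀) := by
  obtain ⟨t, ht, ht0⟩ := (((tendsto_Z hx P).eventually_gt_atTop
    ((N + D + 1) * (ε / 2))).and (eventually_gt_atTop 0)).exists
  have hp := (hx (t + 1)).pos_p P ⟨ht0, by linarith⟩
  have hlam : Tendsto (fun B : ℝ => ε / (2 * B)) atTop (𝓝 0) :=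
    Tendsto.div_atTop tendsto_const_nhds (tendsto_id.const_mul_atTop two_pos)
  have h1 : Tendsto (fun B : ℝ => ε / (2 * B) * x t 0) atTop (𝓝 0) := by
    simpa using hlam.mul_const (x t 0)
  have h2 : Tendsto (fun B : ℝ => K + ε * x t 4 - (ε / (2 * B)) ^ 2 * x t 0 ^ 2) atTop
      (𝓝 (K + ε * x t 4)) := by
    simpa using ((hlam.pow 2).mul_const (x t 0 ^ 2)).const_sub (K + ε * x t 4)
  obtain ⟨B, h⟩ := ((((eventually_gt_atTop 1).and (eventually_gt_atTop (x t 1))).and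
    (h1.eventually (gt_mem_nhds hp))).and ((eventually_gt_atTop (x t 3 * x t 0)).and
    (h2.eventually (lt_mem_nhds ht)))).exists
  exact ⟨B, t, h.1.1.1, ht0, h.1.1.2, h.1.2, h.2.1, h.2.2⟩

/-- The bound on the derivative of the warping function provided by a trapped state. -/
noncomputable def ceiling (ε B t₀ : ℝ) : ℝ := 2 * (B + 2 * Real.exp ((1 + ε) * t₀)) ^ 2

/-- After `t₀` trapping bounds `y`; before `t₀` the exponential bound does. The result depends on
the solution only through `B` and `t₀`, hence is the same for all `K` sharing this trapping data. -/
lemma le_ceiling (hx : ∀ T, RedSol N D ε K T x) (P : Params N D ε K) {B t₀ : ℝ} (hB : 1 < B)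
    (ht₀ : 0 < t₀) (h : Trapped N D ε K B (x t₀)) {t : ℝ} (ht : 0 < t) :
    2 * x t 1 ^ 2 ≤ ceiling ε B t₀ := by
  have hmem : t ∈ Ioo 0 (t + 1) := ⟨ht, by linarith⟩
  have hy := (hx _).pos_y P hmem
  have hle : x t 1 ≤ B + 2 * Real.exp ((1 + ε) * t₀) := by
    rcases le_or_gt t₀ t with h1 | h1
    · have := ((hx (t + 1)).trapped_forward P hB ht₀ h t ⟨h1, by linarith⟩).1
      have := Real.exp_pos ((1 + ε) * t₀)
      linarith
    · have h2 := ((hx _).y_f_le P t hmem).1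
      have h3 : Real.exp ((1 + ε) * t) ≤ Real.exp ((1 + ε) * t₀) := by
        have := P.hε
        gcongr
      linarith
  unfold ceiling
  gcongr

/-- The increasing and the decreasing quantity enclose the limit. The explicit error `c/Z(t)` is
what later gives continuity of the limit in `K`. -/
lemma exists_tendsto_growthRatio (hx : ∀ T, RedSol N D ε K T x) (P : Params N D ε K) {c : ℝ}
    (hc : ∀ t, 0 < t → 2 * x t 1 ^ 2 ≤ c) :
    ∃ S, Tendsto (fun t => growthRatio N ε K (x t)) atTop (𝓝 S) ∧
      ∀ t, 0 < t → growthRatio N ε K (x t) ≤ S ∧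
        S ≤ growthRatio N ε K (x t) + c / (K + ε * x t 4) := by
  have hmono : ∀ s t, 0 < s → s ≤ t → growthRatio N ε K (x s) ≤ growthRatio N ε K (x t) :=
    fun s t hs hst => (hx (t + 1)).monotoneOn_growthRatio P ⟨hs, by linarith⟩
      ⟨by linarith, by linarith⟩ hst
  have hanti : ∀ s t, 0 < s → s ≤ t → growthRatio N ε K (x t) + c / (K + ε * x t 4) ≤
      growthRatio N ε K (x s) + c / (K + ε * x s 4) := fun s t hs hst => by
    have := (hx (t + 1)).antitoneOn_growthRatio_add P (fun r hr => hc r hr.1)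
      (a := s) (b := t) ⟨hs, by linarith⟩ ⟨by linarith, by linarith⟩ hst
    exact neg_le_neg_iff.1 this
  have hc0 : 0 ≤ c := le_trans (by positivity) (hc 1 one_pos)
  have hnn : ∀ t, 0 < t → 0 ≤ c / (K + ε * x t 4) := fun t ht =>
    div_nonneg hc0 ((hx (t + 1)).pos_Z P ⟨ht, by linarith⟩).le
  -- Freezing the time below `1` gives a function that is monotone on the whole line.
  set g : ℝ → ℝ := fun t => growthRatio N ε K (x (max t 1)) with hg
  have gm : Monotone g := fun s t hst => hmono _ _ (by positivity) (max_le_max_right 1 hst)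
  have gb : BddAbove (range g) := by
    refine ⟨growthRatio N ε K (x 1) + c / (K + ε * x 1 4), ?_⟩
    rintro _ ⟨t, rfl⟩
    have := hanti 1 (max t 1) one_pos (le_max_right _ _)
    have := hnn (max t 1) (by positivity)
    simp only [hg]; linarith
  have glim := tendsto_atTop_ciSup gm gb
  have hlim : Tendsto (fun t => growthRatio N ε K (x t)) atTop (𝓝 (⨆ i, g i)) := by
    refine glim.congr' ?_
    filter_upwards [eventually_ge_atTop 1] with t ht
    simp [hg, max_eq_left ht]
  refine ⟨_, hlim, fun t ht => ⟨?_, ?_⟩⟩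
  · refine ge_of_tendsto hlim ?_
    filter_upwards [eventually_ge_atTop t] with s hs using hmono t s ht hs
  · refine le_of_tendsto hlim ?_
    filter_upwards [eventually_ge_atTop t] with s hs
    have := hanti t s ht hs
    have := hnn s (by linarith)
    linarith

/-- The potential dominates: `-u' / √(K - ε u) → 1`. -/
lemma tendsto_p_div_sqrt (hx : ∀ T, RedSol N D ε K T x) (P : Params N D ε K) :
    Tendsto (fun t => x t 2 / √(K + ε * x t 4)) atTop (𝓝 1) := by
  obtain ⟨B, t₀, hB, ht₀, htr⟩ := exists_trapped hx P
  have hN := two_le P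
  have hD := P.hD
  have hε := P.hε
  have mem : ∀ t : ℝ, 0 < t → t ∈ Ioo 0 (t + 1) := fun t ht => ⟨ht, by linarith⟩
  set b := x t₀ 0 with hb
  have hb0 : 0 < b := (hx _).pos_f t₀ (mem t₀ ht₀)
  have hB0 : 0 < B := by linarith
  set q := B / b with hq
  have hq0 : 0 < q := div_pos hB0 hb0
  have hbound : ∀ t, t₀ ≤ t → x t 1 / x t 0 ≤ q ∧ x t 3 ≤ q ∧ b ≤ x t 0 := by
    intro t ht
    have ht' : 0 < t := ht₀.trans_le ht
    have hbf : b ≤ x t 0 := le_of_deriv_nonneg_Icc (g := fun t => x t 0) ht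
      (fun s hs => (hx _).deriv_f (mem s (ht₀.trans_le hs.1)))
      (fun s hs => ((hx _).pos_y P (mem s (ht₀.trans hs.1))).le)
    have tr := (hx (t + 1)).trapped_forward P hB ht₀ htr t ⟨ht, by linarith⟩
    refine ⟨?_, ?_, hbf⟩
    · exact div_le_div₀ hB0.le tr.1.le hb0 hbf
    · rw [hq, le_div_iff₀ hb0]
      have := (hx _).pos_h P (mem t ht')
      nlinarith [tr.2.2.1]
  -- Once trapped, `y/f` and `h` are at most `q`, and `f ≥ b`. The first integral then gives `Z ≤ M²
  -- ≤ Z + c₁`, and the definition of `M` gives `p ≤ M ≤ p + c₂`.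
  set c₁ := N * q ^ 2 + D * q ^ 2 + N * (N - 1) / b ^ 2 + (N + D - 1) * (ε / 2) with hc₁
  set c₂ := N * q + D * q with hc₂
  have hZ := tendsto_Z hx P
  have hlow : Tendsto (fun t => 1 - c₂ / √(K + ε * x t 4)) atTop (𝓝 1) := by
    simpa using (Tendsto.div_atTop (tendsto_const_nhds (x := c₂))
      (Real.tendsto_sqrt_atTop.comp hZ)).const_sub 1
  have hup : Tendsto (fun t => 1 + c₁ / (K + ε * x t 4)) atTop (𝓝 1) := by
    simpa using (Tendsto.div_atTop (tendsto_const_nhds (x := c₁)) hZ).const_add 1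
  have hev : ∀ᶠ t in atTop, t₀ ≤ t := eventually_ge_atTop t₀
  refine tendsto_of_tendsto_of_tendsto_of_le_of_le' hlow hup ?_ ?_
  · filter_upwards [hev] with t ht
    obtain ⟨h1, h2, h3⟩ := hbound t ht
    have hm := mem t (ht₀.trans_le ht)
    have hZt := (hx _).pos_Z P hm
    have hs := Real.sqrt_pos.2 hZt
    have hcons := (hx _).conservation P hm
    have hM : √(K + ε * x t 4) ≤ redMean N D (x t) := by
      apply Real.sqrt_le_iff.2 ⟨((hx _).pos_mean P hm).le, ?_⟩
      have e1 : 0 ≤ (N : ℝ) * (x t 1 / x t 0) ^ 2 := by positivity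
      have e2 : 0 ≤ D * x t 3 ^ 2 := by positivity
      have e3 : 0 ≤ (N : ℝ) * (N - 1) / x t 0 ^ 2 :=
        div_nonneg (mul_nonneg (by linarith) (by linarith)) (sq_nonneg _)
      have e4 : 0 ≤ (N + D - 1) * (ε / 2) := mul_nonneg (by linarith) (by linarith)
      linarith
    rw [le_div_iff₀ hs, sub_mul, div_mul_cancel₀ _ hs.ne', one_mul]
    have : redMean N D (x t) ≤ x t 2 + c₂ := by
      unfold redMean
      have : N * (x t 1 / x t 0) ≤ N * q := by gcongr
      have : D * x t 3 ≤ D * q := by gcongr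
      linarith
    linarith
  · filter_upwards [hev] with t ht
    obtain ⟨h1, h2, h3⟩ := hbound t ht
    have hm := mem t (ht₀.trans_le ht)
    have hZt := (hx _).pos_Z P hm
    have hs := Real.sqrt_pos.2 hZt
    have hcons := (hx _).conservation P hm
    have hp := (hx _).pos_p P hm
    have hh := (hx _).pos_h P hm
    have hl : 0 < x t 1 / x t 0 := div_pos ((hx _).pos_y P hm) ((hx _).pos_f t hm)
    have hpM : x t 2 ≤ redMean N D (x t) := by
      unfold redMean
      have : 0 ≤ N * (x t 1 / x t 0) := by positivity
      have : 0 ≤ D * x t 3 := by positivity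
      linarith
    have hp2 : x t 2 ^ 2 ≤ K + ε * x t 4 + c₁ := by
      have e0 : x t 2 ^ 2 ≤ redMean N D (x t) ^ 2 := by gcongr
      have e1 : (N : ℝ) * (x t 1 / x t 0) ^ 2 ≤ N * q ^ 2 := by gcongr
      have e2 : D * x t 3 ^ 2 ≤ D * q ^ 2 := by gcongr
      have e3 : (N : ℝ) * (N - 1) / x t 0 ^ 2 ≤ N * (N - 1) / b ^ 2 := by
        have : (0 : ℝ) ≤ N * (N - 1) := mul_nonneg (by linarith) (by linarith)
        gcongr
      linarith
    set r := x t 2 / √(K + ε * x t 4) with hr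
    have hr2 : r ^ 2 ≤ 1 + c₁ / (K + ε * x t 4) := by
      rw [hr, div_pow, Real.sq_sqrt hZt.le, div_le_iff₀ hZt, add_mul, div_mul_cancel₀ _ hZt.ne']
      linarith
    have hc₁0 : 0 ≤ c₁ / (K + ε * x t 4) := by
      refine div_nonneg ?_ hZt.le
      have e3 : 0 ≤ (N : ℝ) * (N - 1) / b ^ 2 :=
        div_nonneg (mul_nonneg (by linarith) (by linarith)) (sq_nonneg _)
      have e4 : 0 ≤ (N + D - 1) * (ε / 2) := mul_nonneg (by linarith) (by linarith)
      positivity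
    -- If `r > 1 + e` with `e = c₁/Z ≥ 0`, then `r² > (1 + e)² ≥ 1 + e`.
    by_contra! hcon
    nlinarith

/-- Use `y = (fy/p) · (p/√Z) / (f/√Z)`. The two Wronskian inequalities enclose `fy/p` between the
growth ratio and the ratio plus `c/Z`, so it tends to `S`. The other factors tend to `1` and
`√(2S/ε)`. -/
lemma tendsto_y (hx : ∀ T, RedSol N D ε K T x) (P : Params N D ε K) {S : ℝ}
    (hS : Tendsto (fun t => growthRatio N ε K (x t)) atTop (𝓝 S)) :
    Tendsto (fun t => x t 1) atTop (𝓝 √(ε * S / 2)) := by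
  obtain ⟨B, t₀, hB, ht₀, htr⟩ := exists_trapped hx P
  have mem : ∀ t : ℝ, 0 < t → t ∈ Ioo 0 (t + 1) := fun t ht => ⟨ht, by linarith⟩
  have hc : ∀ t, 0 < t → 2 * x t 1 ^ 2 ≤ ceiling ε B t₀ := fun t ht =>
    le_ceiling hx P hB ht₀ htr ht
  set c := ceiling ε B t₀
  have hε := P.hε
  have hN := two_le P
  have hZ := tendsto_Z hx P
  have hS0 : 0 < S := by
    have h1 : 0 < ((N : ℝ) - 1) / K := div_pos (by linarith) P.hK
    refine h1.trans_le (ge_of_tendsto hS ?_)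
    filter_upwards [eventually_gt_atTop 0] with t ht using (hx _).le_growthRatio P (mem t ht)
  have hcZ : ∀ a : ℝ, Tendsto (fun t => a / (K + ε * x t 4)) atTop (𝓝 0) := fun a =>
    Tendsto.div_atTop tendsto_const_nhds hZ
  have hr : Tendsto (fun t => x t 0 * x t 1 / x t 2) atTop (𝓝 S) := by
    have hup : Tendsto (fun t => growthRatio N ε K (x t) + c / (K + ε * x t 4)) atTop (𝓝 S) := by
      simpa using hS.add (hcZ c)
    refine tendsto_of_tendsto_of_tendsto_of_le_of_le' hS hup ?_ ?_
    · filter_upwards [eventually_gt_atTop 0] with t ht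
      have hm := mem t ht
      have := (hx _).defect_nonneg P hm
      rw [growthRatio, div_le_div_iff₀ ((hx _).pos_Z P hm) ((hx _).pos_p P hm)]
      linarith
    · filter_upwards [eventually_gt_atTop 0] with t ht
      have hm := mem t ht
      have := (hx (t + 1)).defect_nonpos P (fun s hs => hc s hs.1) hm
      rw [growthRatio, ← add_div, div_le_div_iff₀ ((hx _).pos_p P hm) ((hx _).pos_Z P hm)]
      linarith
  have hf2 : Tendsto (fun t => x t 0 ^ 2 / (K + ε * x t 4)) atTop (𝓝 (2 / ε * S)) := by
    have := (hS.sub (hcZ ((N : ℝ) - 1))).const_mul (2 / ε)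
    rw [sub_zero] at this
    refine this.congr fun t => ?_
    rw [growthRatio, add_div, add_sub_cancel_left]
    field_simp
  have hf : Tendsto (fun t => x t 0 / √(K + ε * x t 4)) atTop (𝓝 √(2 / ε * S)) := by
    refine ((Real.continuous_sqrt.tendsto _).comp hf2).congr' ?_
    filter_upwards [eventually_gt_atTop 0] with t ht
    have hm := mem t ht
    simp only [Function.comp]
    rw [Real.sqrt_div' _ ((hx _).pos_Z P hm).le, Real.sqrt_sq ((hx _).pos_f t hm).le]
  have hne : √(2 / ε * S) ≠ 0 := (Real.sqrt_pos.2 (by positivity)).ne'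
  have hlim := hr.mul ((tendsto_p_div_sqrt hx P).div hf hne)
  have hval : S * (1 / √(2 / ε * S)) = √(ε * S / 2) := by
    rw [eq_comm, Real.sqrt_eq_iff_mul_self_eq (by positivity) (by positivity)]
    have h1 : √(2 / ε * S) * √(2 / ε * S) = 2 / ε * S := Real.mul_self_sqrt (by positivity)
    have h2 : S * (1 / √(2 / ε * S)) * (S * (1 / √(2 / ε * S)))
      = S ^ 2 / (√(2 / ε * S) * √(2 / ε * S)) := by field_simp
    rw [h2, h1]; field_simp
  rw [hval] at hlim
  refine hlim.congr' ?_
  filter_upwards [eventually_gt_atTop 0] with t ht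
  have hm := mem t ht
  have h1 := (Real.sqrt_pos.2 ((hx _).pos_Z P hm)).ne'
  have h2 := ((hx _).pos_f t hm).ne'
  have h3 := ((hx _).pos_p P hm).ne'
  simp only [Pi.div_apply]
  field_simp

end RedSol

end WarpedSoliton

namespace WarpedSoliton

/-! ### Singular initial value problems `t w' + (k + 1) w = Q(t, K, w)` -/

section Singular

open scoped BoundedContinuousFunction
open MeasureTheory

variable {ι : Type*}

/-- The integral operator whose fixed points solve `t w' + (k + 1) w = Q(t, K, w)`. -/
noncomputable def singularOp (k : ι → ℕ) (Q : ℝ × ℝ × (ι → ℝ) → ι → ℝ)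
    (w : ℝ × ℝ → ι → ℝ) (z : ℝ × ℝ) : ι → ℝ :=
  fun i => ∫ r in (0 : ℝ)..1, r ^ k i * Q (r * z.1, z.2, w (r * z.1, z.2)) i

lemma continuous_singularOp {k : ι → ℕ} {Q : ℝ × ℝ × (ι → ℝ) → ι → ℝ} (hQ : Continuous Q)
    {w : ℝ × ℝ → ι → ℝ} (hw : Continuous w) : Continuous (singularOp k Q w) := by
  refine continuous_pi fun i => ?_
  refine intervalIntegral.continuous_parametric_intervalIntegral_of_continuous'
    (f := fun (z : ℝ × ℝ) r => r ^ k i * Q (r * z.1, z.2, w (r * z.1, z.2)) i) ?_ 0 1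
  have : Continuous fun p : (ℝ × ℝ) × ℝ => Q (p.2 * p.1.1, p.1.2, w (p.2 * p.1.1, p.1.2)) i := by
    fun_prop
  exact (continuous_snd.pow (k i)).mul this

/-- Substituting `r ↦ r/t` turns the fixed point equation into `t^(k+1) w(t) = ∫₀ᵗ r^k Q dr`, to
which the fundamental theorem of calculus applies for `t > 0`. -/
lemma hasDerivAt_of_singularOp_eq {k : ι → ℕ} {Q : ℝ × ℝ × (ι → ℝ) → ι → ℝ}
    (hQ : Continuous Q) {w : ℝ × ℝ → ι → ℝ} (hw : Continuous w) (hfix : singularOp k Q w = w)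
    {t : ℝ} (ht : 0 < t) (K : ℝ) (i : ι) :
    HasDerivAt (fun t => w (t, K) i)
      ((Q (t, K, w (t, K)) i - (k i + 1) * w (t, K) i) / t) t := by
  set q : ℝ → ℝ := fun r => r ^ k i * Q (r, K, w (r, K)) i with hq
  have hqc : Continuous q := by
    have : Continuous fun r : ℝ => Q (r, K, w (r, K)) i := by fun_prop
    exact (continuous_id.pow _).mul this
  have hform : ∀ s, 0 < s → w (s, K) i = (∫ r in (0 : ℝ)..s, q r) / s ^ (k i + 1) := by
    intro s hs
    have h1 : w (s, K) i = singularOp k Q w (s, K) i := by rw [hfix]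
    have h2 := intervalIntegral.integral_comp_mul_right (a := 0) (b := 1) q hs.ne'
    rw [zero_mul, one_mul] at h2
    have h3 : ∫ r in (0 : ℝ)..1, q (r * s)
        = s ^ k i * ∫ r in (0 : ℝ)..1, r ^ k i * Q (r * s, K, w (r * s, K)) i := by
      rw [← intervalIntegral.integral_const_mul]
      congr 1; ext r; simp only [hq]; ring
    rw [h1, singularOp]
    rw [h3] at h2
    have hsk : s ^ k i ≠ 0 := pow_ne_zero _ hs.ne'
    simp only at h2 ⊢
    rw [eq_div_iff (pow_ne_zero _ hs.ne'), pow_succ, ← mul_assoc, mul_comm _ (s ^ k i), h2,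
      smul_eq_mul]
    field_simp
  have hd : HasDerivAt (fun s => ∫ r in (0 : ℝ)..s, q r) (q t) t :=
    intervalIntegral.integral_hasDerivAt_right (hqc.intervalIntegrable _ _)
      (hqc.stronglyMeasurableAtFilter _ _) hqc.continuousAt
  have hd2 := hd.div ((hasDerivAt_id t).pow (k i + 1)) (pow_ne_zero _ ht.ne')
  have hev : (fun t => w (t, K) i) =ᶠ[𝓝 t] fun s => (∫ r in (0 : ℝ)..s, q r) / s ^ (k i + 1) := by
    filter_upwards [lt_mem_nhds ht] with s hs using hform s hs
  refine (hd2.congr_of_eventuallyEq hev).congr_deriv ?_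
  have h4 := hform t ht
  rw [eq_div_iff (pow_ne_zero _ ht.ne')] at h4
  simp only [Pi.pow_apply, id]
  rw [← h4]
  simp only [hq]
  have : t ^ k i ≠ 0 := pow_ne_zero _ ht.ne'
  push_cast
  field_simp
  simp only [pow_succ]
  ring

lemma abs_integral_pow_mul_le (k : ℕ) {g : ℝ → ℝ} {C : ℝ} (hC : ∀ r, |g r| ≤ C) :
    |∫ r in (0 : ℝ)..1, r ^ k * g r| ≤ C := by
  have hC0 : 0 ≤ C := (abs_nonneg _).trans (hC 0)
  have := intervalIntegral.norm_integral_le_of_norm_le_const (a := 0) (b := 1) (C := C)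
    (f := fun r : ℝ => r ^ k * g r) (fun r hr => by
      rw [uIoc_of_le zero_le_one] at hr
      rw [Real.norm_eq_abs, abs_mul, abs_pow, abs_of_pos hr.1]
      have h1 : r ^ k ≤ 1 := pow_le_one₀ hr.1.le hr.2
      have h2 : 0 ≤ r ^ k := pow_nonneg hr.1.le k
      nlinarith [hC r, abs_nonneg (g r)])
  simpa using this

variable [Fintype ι]

/-- The weights `r^k` are at most `1` on `[0, 1]`, so the Lipschitz constant `3/4` passes to the
operator. Working with bounded continuous functions of `(t, K)` jointly yields continuity in `K` at
no extra cost. -/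
theorem exists_singularOp_fixedPoint (k : ι → ℕ) {Q : ℝ × ℝ × (ι → ℝ) → ι → ℝ}
    (hQ : Continuous Q) {C : ℝ} (hC : ∀ z, ‖Q z‖ ≤ C)
    (hL : ∀ t K w w', ‖Q (t, K, w) - Q (t, K, w')‖ ≤ 3 / 4 * ‖w - w'‖) :
    ∃ w : ℝ × ℝ → ι → ℝ, Continuous w ∧ singularOp k Q w = w := by
  have hC0 : 0 ≤ C := (norm_nonneg _).trans (hC 0)
  let Φ : ((ℝ × ℝ) →ᵇ (ι → ℝ)) → ((ℝ × ℝ) →ᵇ (ι → ℝ)) := fun w =>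
    BoundedContinuousFunction.ofNormedAddCommGroup (singularOp k Q w)
      (continuous_singularOp hQ w.continuous) C (fun z => by
        refine (pi_norm_le_iff_of_nonneg hC0).2 fun i => ?_
        exact abs_integral_pow_mul_le (k i) fun r => (norm_le_pi_norm _ i).trans (hC _))
  have hΦ : ContractingWith (3 / 4) Φ := by
    refine ⟨by rw [← NNReal.coe_lt_coe]; norm_num, LipschitzWith.of_dist_le_mul fun w w' => ?_⟩
    refine (BoundedContinuousFunction.dist_le (by positivity)).2 fun z => ?_
    rw [dist_eq_norm]
    refine (pi_norm_le_iff_of_nonneg (by positivity)).2 fun i => ?_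
    change |singularOp k Q w z i - singularOp k Q w' z i| ≤ _
    have hcont : ∀ w : (ℝ × ℝ) →ᵇ (ι → ℝ), Continuous fun r : ℝ =>
        r ^ k i * Q (r * z.1, z.2, w (r * z.1, z.2)) i := fun w => by
      have := w.continuous
      have : Continuous fun r : ℝ => Q (r * z.1, z.2, w (r * z.1, z.2)) i := by fun_prop
      exact (continuous_id.pow _).mul this
    rw [singularOp, singularOp, ← intervalIntegral.integral_sub
      ((hcont w).intervalIntegrable _ _) ((hcont w').intervalIntegrable _ _)]
    simp_rw [← mul_sub]
    refine abs_integral_pow_mul_le (k i) fun r => ?_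
    have h1 := (norm_le_pi_norm (Q (r * z.1, z.2, w (r * z.1, z.2))
      - Q (r * z.1, z.2, w' (r * z.1, z.2))) i).trans (hL _ _ _ _)
    refine h1.trans ?_
    rw [← dist_eq_norm]
    have : ((3 / 4 : NNReal) : ℝ) = 3 / 4 := by norm_num
    rw [this]
    gcongr
    exact BoundedContinuousFunction.dist_coe_le_dist _
  obtain ⟨w, hw⟩ : ∃ w, Φ w = w := ⟨_, hΦ.fixedPoint_isFixedPt⟩
  exact ⟨w, w.continuous,
    congrArg (fun w : (ℝ × ℝ) →ᵇ (ι → ℝ) => (w : ℝ × ℝ → ι → ℝ)) hw⟩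

/-- Local solvability of a singular initial value problem, continuously in the parameter. -/
theorem exists_singular_solution (k : ι → ℕ) {Q : ℝ × ℝ × (ι → ℝ) → ι → ℝ} {K₀ : ℝ}
    (hQ : ContDiffAt ℝ 1 Q (0, K₀, 0))
    (hD : ∀ w, ‖fderiv ℝ Q (0, K₀, 0) (0, 0, w)‖ ≤ 1 / 2 * ‖w‖) (h0 : ∀ K, Q (0, K, 0) = 0) :
    ∃ ρ > 0, (∀ t K w w', |t| ≤ ρ → |K - K₀| ≤ ρ → ‖w‖ ≤ ρ → ‖w'‖ ≤ ρ →
        ‖Q (t, K, w) - Q (t, K, w')‖ ≤ 3 / 4 * ‖w - w'‖) ∧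
      ∃ δ > 0, δ ≤ ρ ∧ ∃ w : ℝ × ℝ → ι → ℝ, Continuous w ∧
        (∀ K, |K - K₀| ≤ δ → w (0, K) = 0) ∧
        ∀ t K, 0 < t → t ≤ δ → |K - K₀| ≤ δ → ‖w (t, K)‖ ≤ ρ ∧ ∀ i,
          HasDerivAt (fun t => w (t, K) i)
            ((Q (t, K, w (t, K)) i - (k i + 1) * w (t, K) i) / t) t := by
  -- Strict differentiability with error `1/4`, added to the linear bound `1/2`, gives the
  -- contraction constant `3/4`.
  obtain ⟨s, hs, happ⟩ := (hQ.hasStrictFDerivAt one_ne_zero).approximates_deriv_on_nhds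
    (c := 1 / 4) (Or.inr (by norm_num))
  have hcont : ∀ᶠ z in 𝓝 ((0 : ℝ), K₀, (0 : ι → ℝ)), ContinuousAt Q z :=
    (hQ.eventually (by simp)).mono fun z hz => hz.continuousAt
  obtain ⟨R, hR, hball⟩ := Metric.mem_nhds_iff.1 (inter_mem hs hcont)
  set ρ := R / 2 with hρ
  have hρ0 : 0 < ρ := by positivity
  have hbox : ∀ t K (w : ι → ℝ), |t| ≤ ρ → |K - K₀| ≤ ρ → ‖w‖ ≤ ρ → (t, K, w) ∈ s ∧
      ContinuousAt Q (t, K, w) := by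
    intro t K w ht hK hw
    apply hball
    rw [Metric.mem_ball, dist_eq_norm]
    have : ((t, K, w) : ℝ × ℝ × (ι → ℝ)) - (0, K₀, 0) = (t, K - K₀, w) := by simp
    rw [this, Prod.norm_def, Prod.norm_def]
    simp only [Real.norm_eq_abs]
    have h : ρ < R := by linarith
    exact max_lt (ht.trans_lt h) (max_lt (hK.trans_lt h) (hw.trans_lt h))
  have hlip : ∀ t K w w', |t| ≤ ρ → |K - K₀| ≤ ρ → ‖w‖ ≤ ρ → ‖w'‖ ≤ ρ →
        ‖Q (t, K, w) - Q (t, K, w')‖ ≤ 3 / 4 * ‖w - w'‖ := by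
    intro t K w w' ht hK hw hw'
    have h1 := happ _ (hbox t K w ht hK hw).1 _ (hbox t K w' ht hK hw').1
    have h2 : ((t, K, w) : ℝ × ℝ × (ι → ℝ)) - (t, K, w') = (0, 0, w - w') := by simp
    rw [h2] at h1
    have h3 : ‖((0 : ℝ), (0 : ℝ), w - w')‖ = ‖w - w'‖ := by
      rw [Prod.norm_def, Prod.norm_def]; simp
    rw [h3] at h1
    have h4 := hD (w - w')
    have h5 := norm_le_insert' (Q (t, K, w) - Q (t, K, w'))
      (fderiv ℝ Q (0, K₀, 0) (0, 0, w - w'))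
    have h6 : ((1 / 4 : NNReal) : ℝ) = 1 / 4 := by norm_num
    rw [h6] at h1
    linarith
  have hle : -ρ ≤ ρ := by linarith
  -- Clamping all coordinates to the box makes `Q` globally bounded and Lipschitz. On a small enough
  -- domain the solution stays in the box and the clamp is inert.
  let cl : ℝ → ℝ := fun a => projIcc (-ρ) ρ hle a
  have cl_cont : Continuous cl := continuous_subtype_val.comp continuous_projIcc
  have cl_abs : ∀ a, |cl a| ≤ ρ := fun a => abs_le.2 (projIcc (-ρ) ρ hle a).2
  have cl_eq : ∀ a, |a| ≤ ρ → cl a = a := fun a ha => by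
    simp only [cl, projIcc_of_mem hle (abs_le.1 ha)]
  have cl_lip : ∀ a b, |cl a - cl b| ≤ |a - b| := fun a b => abs_projIcc_sub_projIcc hle
  let P : ℝ × ℝ × (ι → ℝ) → ℝ × ℝ × (ι → ℝ) := fun z =>
    (cl z.1, K₀ + cl (z.2.1 - K₀), fun i => cl (z.2.2 i))
  have P_cont : Continuous P := by
    refine (cl_cont.comp continuous_fst).prodMk (Continuous.prodMk ?_ ?_)
    · exact continuous_const.add (cl_cont.comp (by fun_prop))
    · exact continuous_pi fun i => cl_cont.comp (by fun_prop)
  have P_norm : ∀ w : ι → ℝ, ‖fun i => cl (w i)‖ ≤ ρ := fun w =>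
    (pi_norm_le_iff_of_nonneg hρ0.le).2 fun i => cl_abs _
  have P_mem : ∀ z, (P z) ∈ s ∧ ContinuousAt Q (P z) := fun z =>
    hbox _ _ _ (cl_abs _) (by rw [add_sub_cancel_left]; exact cl_abs _) (P_norm _)
  have P_eq : ∀ t K (w : ι → ℝ), |t| ≤ ρ → |K - K₀| ≤ ρ → ‖w‖ ≤ ρ →
      P (t, K, w) = (t, K, w) := by
    intro t K w ht hK hw
    have : (fun i => cl (w i)) = w := funext fun i => cl_eq _ ((norm_le_pi_norm w i).trans hw)
    simp only [P, cl_eq t ht, cl_eq _ hK, this, add_sub_cancel]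
  have Q_cont : Continuous (Q ∘ P) := continuous_iff_continuousAt.2 fun z =>
    (P_mem z).2.comp P_cont.continuousAt
  obtain ⟨C, hC⟩ : ∃ C, ∀ z, ‖(Q ∘ P) z‖ ≤ C := by
    have hK : IsCompact (Metric.closedBall ((0 : ℝ), K₀, (0 : ι → ℝ)) ρ) :=
      isCompact_closedBall _ _
    have hsub : ∀ z ∈ Metric.closedBall ((0 : ℝ), K₀, (0 : ι → ℝ)) ρ, ContinuousAt Q z :=
      fun z hz => (hball (Metric.closedBall_subset_ball (by linarith) hz)).2
    obtain ⟨C, hC⟩ := hK.exists_bound_of_continuousOn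
      (fun z hz => (hsub z hz).continuousWithinAt)
    refine ⟨C, fun z => hC _ ?_⟩
    rw [Metric.mem_closedBall, dist_eq_norm]
    have : P z - (0, K₀, 0) = (cl z.1, cl (z.2.1 - K₀), fun i => cl (z.2.2 i)) := by simp [P]
    rw [this, Prod.norm_def, Prod.norm_def]
    exact max_le (cl_abs _) (max_le (cl_abs _) (P_norm _))
  have hL : ∀ t K w w', ‖(Q ∘ P) (t, K, w) - (Q ∘ P) (t, K, w')‖ ≤ 3 / 4 * ‖w - w'‖ := by
    intro t K w w'
    refine (hlip _ _ _ _ (cl_abs _) (by rw [add_sub_cancel_left]; exact cl_abs _)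
      (P_norm _) (P_norm _)).trans ?_
    gcongr
    refine (pi_norm_le_iff_of_nonneg (norm_nonneg _)).2 fun i => ?_
    exact (cl_lip _ _).trans (norm_le_pi_norm (w - w') i)
  obtain ⟨w, hw, hfix⟩ := exists_singularOp_fixedPoint k Q_cont hC hL
  have hw0 : ∀ K, |K - K₀| ≤ ρ → w (0, K) = 0 := by
    intro K hK
    have h1 : (Q ∘ P) (0, K, 0) = 0 := by
      rw [Function.comp, P_eq 0 K 0 (by simpa using hρ0.le) hK (by simpa using hρ0.le), h0]
    -- At `t = 0` the integrand is a fixed vector with weights `r^k`, and `Q` vanishes at `w = 0`,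
    -- so the Lipschitz bound forces the value `0`.
    have h2 : ‖w (0, K)‖ ≤ 3 / 4 * ‖w (0, K)‖ := by
      refine (pi_norm_le_iff_of_nonneg (by positivity)).2 fun i => ?_
      have h3 : w (0, K) i = singularOp k (Q ∘ P) w (0, K) i := by rw [hfix]
      rw [h3, singularOp]
      refine abs_integral_pow_mul_le _ fun r => ?_
      simp only [mul_zero]
      have h4 := hL 0 K (w (0, K)) 0
      rw [h1, sub_zero, sub_zero] at h4
      exact (norm_le_pi_norm _ i).trans h4
    have : ‖w (0, K)‖ = 0 := by linarith [norm_nonneg (w (0, K))]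
    exact norm_eq_zero.1 this
  refine ⟨ρ, hρ0, hlip, ?_⟩
  have hn : ∀ᶠ z in 𝓝 ((0 : ℝ), K₀), ‖w z‖ < ρ := by
    have : Tendsto (fun z => ‖w z‖) (𝓝 ((0 : ℝ), K₀)) (𝓝 ‖w (0, K₀)‖) :=
      (continuous_norm.comp hw).tendsto _
    rw [hw0 K₀ (by simpa using hρ0.le), norm_zero] at this
    exact this.eventually (gt_mem_nhds hρ0)
  obtain ⟨δ, hδ, hδball⟩ := Metric.eventually_nhds_iff_ball.1 hn
  refine ⟨min (δ / 2) ρ, lt_min (by positivity) hρ0, min_le_right _ _, w, hw,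
    fun K hK => hw0 K (hK.trans (min_le_right _ _)), fun t K ht htδ hK => ?_⟩
  have hwt : ‖w (t, K)‖ ≤ ρ := by
    refine (hδball (t, K) ?_).le
    rw [Metric.mem_ball, dist_eq_norm]
    have : ((t, K) : ℝ × ℝ) - (0, K₀) = (t, K - K₀) := by simp
    rw [this, Prod.norm_def]
    have h1 := htδ.trans (min_le_left _ _)
    have h2 := hK.trans (min_le_left _ _)
    simp only [Real.norm_eq_abs, abs_of_pos ht]
    exact max_lt (by linarith) (by linarith)
  refine ⟨hwt, fun i => ?_⟩
  have := hasDerivAt_of_singularOp_eq Q_cont hw hfix ht K i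
  rwa [Function.comp, P_eq t K _ (by rw [abs_of_pos ht]; exact htδ.trans (min_le_right _ _))
    (hK.trans (min_le_right _ _)) hwt] at this

/-- Uniqueness for singular initial value problems. -/
theorem singular_solution_unique {k : ι → ℕ} {q q' : ℝ → ι → ℝ} {δ : ℝ} {w w' : ℝ → ι → ℝ}
    (hL : ∀ t ∈ Ioo 0 δ, ‖q t - q' t‖ ≤ 3 / 4 * ‖w t - w' t‖)
    (hw : ∀ t ∈ Ioo 0 δ, ∀ i, HasDerivAt (fun t => w t i) ((q t i - (k i + 1) * w t i) / t) t)
    (hw' : ∀ t ∈ Ioo 0 δ, ∀ i,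
      HasDerivAt (fun t => w' t i) ((q' t i - (k i + 1) * w' t i) / t) t)
    (h0 : Tendsto w (𝓝[>] 0) (𝓝 0)) (h0' : Tendsto w' (𝓝[>] 0) (𝓝 0)) :
    ∀ t ∈ Ioo 0 δ, w t = w' t := by
  -- a bound `m` for the difference improves to `3 / 4 * m`
  have improve : ∀ a ≤ δ, ∀ m, (∀ t ∈ Ioo 0 a, ‖w t - w' t‖ ≤ m) →
      ∀ t ∈ Ioo 0 a, ‖w t - w' t‖ ≤ 3 / 4 * m := by
    intro a ha m hm t ht
    have hm0 : 0 ≤ m := (norm_nonneg _).trans (hm t ht)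
    -- A one-sided bound for an arbitrary pair, to be applied to the two solutions in both orders.
    have side : ∀ (u u' : ℝ → ι → ℝ) (p p' : ℝ → ι → ℝ),
        (∀ t ∈ Ioo 0 a, ∀ i, p t i - p' t i ≤ 3 / 4 * m) →
        (∀ t ∈ Ioo 0 a, ∀ i, HasDerivAt (fun t => u t i) ((p t i - (k i + 1) * u t i) / t) t) →
        (∀ t ∈ Ioo 0 a, ∀ i,
          HasDerivAt (fun t => u' t i) ((p' t i - (k i + 1) * u' t i) / t) t) →
        Tendsto u (𝓝[>] 0) (𝓝 0) → Tendsto u' (𝓝[>] 0) (𝓝 0) →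
        ∀ i, u t i - u' t i ≤ 3 / 4 * m := by
      intro u u' p p' hp hu hu' l l' i
      -- The weight `s^(k+1)` removes the singular term. The weighted difference is then
      -- nondecreasing and starts at `0`.
      have hd : ∀ s ∈ Ioo 0 a, HasDerivAt
          (fun s => s ^ (k i + 1) * (3 / 4 * m - (u s i - u' s i)))
          (s ^ k i * ((k i + 1) * (3 / 4 * m) - (p s i - p' s i))) s := by
        intro s hs
        have := ((hasDerivAt_id s).pow (k i + 1)).mul
          (((hu s hs i).sub (hu' s hs i)).const_sub (3 / 4 * m))
        refine this.congr_deriv ?_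
        have hs0 : s ≠ 0 := hs.1.ne'
        simp only [Pi.pow_apply, Pi.sub_apply, id, add_tsub_cancel_right]
        push_cast
        field_simp
        ring
      have hlim : Tendsto (fun s => s ^ (k i + 1) * (3 / 4 * m - (u s i - u' s i))) (𝓝[>] 0)
          (𝓝 0) := by
        have h1 : Tendsto (fun s : ℝ => s ^ (k i + 1)) (𝓝[>] 0) (𝓝 (0 ^ (k i + 1))) :=
          ((continuous_pow (k i + 1)).tendsto 0).mono_left nhdsWithin_le_nhds
        have h2 := ((tendsto_pi_nhds.1 l i).sub (tendsto_pi_nhds.1 l' i)).const_sub (3 / 4 * m)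
        simpa using h1.mul h2
      have := le_of_deriv_nonneg hd (fun s hs => by
        have h1 := hp s hs i
        have h2 : 0 ≤ (k i : ℝ) * (3 / 4 * m) := by positivity
        have h3 : 0 ≤ s ^ k i := pow_nonneg hs.1.le _
        exact mul_nonneg h3 (by linarith)) hlim t ht
      have h4 : 0 < t ^ (k i + 1) := pow_pos ht.1 _
      have := nonneg_of_mul_nonneg_right this h4
      linarith
    have hq : ∀ t ∈ Ioo 0 a, ∀ i, |q t i - q' t i| ≤ 3 / 4 * m := fun t ht i =>
      (norm_le_pi_norm (q t - q' t) i).trans ((hL t ⟨ht.1, ht.2.trans_le ha⟩).trans (by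
        gcongr; exact hm t ht))
    have sub : ∀ t ∈ Ioo 0 a, t ∈ Ioo 0 δ := fun t ht => ⟨ht.1, ht.2.trans_le ha⟩
    refine (pi_norm_le_iff_of_nonneg (by positivity)).2 fun i => abs_le.2 ⟨?_, ?_⟩
    · have := side w' w q' q (fun t ht i => by linarith [(abs_le.1 (hq t ht i)).1])
        (fun t ht => hw' t (sub t ht)) (fun t ht => hw t (sub t ht)) h0' h0 i
      simp only [Pi.sub_apply]
      linarith
    · exact side w w' q q' (fun t ht i => (abs_le.1 (hq t ht i)).2)
        (fun t ht => hw t (sub t ht)) (fun t ht => hw' t (sub t ht)) h0 h0' i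
  intro t ht
  -- the difference is bounded on `(0, t]`
  have hbd : ∃ m, ∀ s ∈ Ioo 0 ((t + δ) / 2), ‖w s - w' s‖ ≤ m := by
    have hlim : Tendsto (fun s => ‖w s - w' s‖) (𝓝[>] 0) (𝓝 0) := by
      simpa using (h0.sub h0').norm
    obtain ⟨a, ha, hsa⟩ := mem_nhdsGT_iff_exists_Ioo_subset.1
      (hlim.eventually (gt_mem_nhds one_pos))
    have ha : (0 : ℝ) < a := ha
    have hc : ContinuousOn (fun s => w s - w' s) (Icc (a / 2) ((t + δ) / 2)) := by
      intro s hs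
      have hs' : s ∈ Ioo 0 δ := ⟨by linarith [hs.1], by linarith [hs.2, ht.2]⟩
      refine ContinuousAt.continuousWithinAt (ContinuousAt.sub ?_ ?_)
      · exact continuousAt_pi.2 fun i => (hw s hs' i).continuousAt
      · exact continuousAt_pi.2 fun i => (hw' s hs' i).continuousAt
    obtain ⟨C, hC⟩ := isCompact_Icc.exists_bound_of_continuousOn hc
    refine ⟨max C 1, fun s hs => ?_⟩
    rcases lt_or_ge s a with h | h
    · exact (le_of_lt (hsa ⟨hs.1, h⟩)).trans (le_max_right _ _)
    · exact (hC s ⟨by linarith, hs.2.le⟩).trans (le_max_left _ _)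
  obtain ⟨m, hm⟩ := hbd
  have hiter : ∀ n : ℕ, ∀ s ∈ Ioo 0 ((t + δ) / 2), ‖w s - w' s‖ ≤ (3 / 4) ^ n * m := by
    intro n
    induction n with
    | zero => simpa using hm
    | succ n ih =>
      intro s hs
      have := improve _ (by linarith [ht.2]) _ ih s hs
      rw [pow_succ]; linarith
  have hlim : Tendsto (fun n : ℕ => (3 / 4 : ℝ) ^ n * m) atTop (𝓝 0) := by
    simpa using (tendsto_pow_atTop_nhds_zero_of_lt_one (by norm_num) (by norm_num)).mul_const m
  have := ge_of_tendsto' hlim fun n => hiter n t ⟨ht.1, by linarith [ht.2]⟩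
  exact sub_eq_zero.1 (norm_le_zero_iff.1 this)

end Singular

end WarpedSoliton

namespace WarpedSoliton

/-! ### The reduced system near the collapsing sphere -/

/-- The nonlinearity of the reduced system in the variables `w = (η, p, h, b, θ)` with
`f = t (1 + 2 b)`, `f' = 1 + η`, `-u = 2 t θ`. -/
noncomputable def singField (N : ℕ) (D ε : ℝ) (z : ℝ × ℝ × (Fin 5 → ℝ)) : Fin 5 → ℝ :=
  ![2 * (N - 1) * z.2.2 0 + z.1 * (-(z.2.2 1 + D * z.2.2 2) * (1 + z.2.2 0)
      + ε / 2 * z.1 * (1 + 2 * z.2.2 3)) + (N - 1) * (1 - (1 + z.2.2 0) ^ 2) / (1 + 2 * z.2.2 3),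
    N * z.2.2 1 - N * z.2.2 1 * (1 + z.2.2 0) / (1 + 2 * z.2.2 3)
      + z.1 * (-z.2.2 1 * (z.2.2 1 + D * z.2.2 2) + z.2.1 + 2 * ε * z.1 * z.2.2 4),
    N * z.2.2 2 - N * z.2.2 2 * (1 + z.2.2 0) / (1 + 2 * z.2.2 3)
      + z.1 * (-z.2.2 2 * (z.2.2 1 + D * z.2.2 2) + ε / 2),
    z.2.2 0 / 2, z.2.2 1 / 2]

/-- The exponents of the singular system, diminished by one. -/
def singExp (N : ℕ) : Fin 5 → ℕ := ![2 * N - 3, N - 1, N - 1, 0, 0]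

/-- From singular variables to states. -/
noncomputable def toState (t : ℝ) (w : Fin 5 → ℝ) : Fin 5 → ℝ :=
  ![t * (1 + 2 * w 3), 1 + w 0, w 1, w 2, 2 * t * w 4]

/-- From states to singular variables. -/
noncomputable def ofState (t : ℝ) (x : Fin 5 → ℝ) : Fin 5 → ℝ :=
  ![x 1 - 1, x 2, x 3, (x 0 / t - 1) / 2, x 4 / (2 * t)]

lemma toState_ofState {t : ℝ} (ht : t ≠ 0) (x : Fin 5 → ℝ) : toState t (ofState t x) = x := by
  ext i
  fin_cases i <;> simp [toState, ofState] <;> (field_simp; try ring)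

lemma contDiffAt_singField (N : ℕ) (D ε K : ℝ) :
    ContDiffAt ℝ 1 (singField N D ε) (0, K, 0) := by
  have h3 : (fun z : ℝ × ℝ × (Fin 5 → ℝ) => 1 + 2 * z.2.2 3) (0, K, 0) ≠ 0 := by simp
  refine contDiffAt_pi.2 fun i => ?_
  fin_cases i
  · change ContDiffAt ℝ 1 (fun z : ℝ × ℝ × (Fin 5 → ℝ) => 2 * ((N : ℝ) - 1) * z.2.2 0 +
      z.1 * (-(z.2.2 1 + D * z.2.2 2) * (1 + z.2.2 0) + ε / 2 * z.1 * (1 + 2 * z.2.2 3))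
      + (N - 1) * (1 - (1 + z.2.2 0) ^ 2) / (1 + 2 * z.2.2 3)) _
    exact ContDiffAt.add (by fun_prop) (ContDiffAt.div (by fun_prop) (by fun_prop) h3)
  · change ContDiffAt ℝ 1 (fun z : ℝ × ℝ × (Fin 5 → ℝ) =>
      N * z.2.2 1 - N * z.2.2 1 * (1 + z.2.2 0) / (1 + 2 * z.2.2 3)
      + z.1 * (-z.2.2 1 * (z.2.2 1 + D * z.2.2 2) + z.2.1 + 2 * ε * z.1 * z.2.2 4)) _
    exact ContDiffAt.add (ContDiffAt.sub (by fun_prop)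
      (ContDiffAt.div (by fun_prop) (by fun_prop) h3)) (by fun_prop)
  · change ContDiffAt ℝ 1 (fun z : ℝ × ℝ × (Fin 5 → ℝ) =>
      N * z.2.2 2 - N * z.2.2 2 * (1 + z.2.2 0) / (1 + 2 * z.2.2 3)
      + z.1 * (-z.2.2 2 * (z.2.2 1 + D * z.2.2 2) + ε / 2)) _
    exact ContDiffAt.add (ContDiffAt.sub (by fun_prop)
      (ContDiffAt.div (by fun_prop) (by fun_prop) h3)) (by fun_prop)
  · change ContDiffAt ℝ 1 (fun z : ℝ × ℝ × (Fin 5 → ℝ) => z.2.2 0 / 2) _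
    fun_prop
  · change ContDiffAt ℝ 1 (fun z : ℝ × ℝ × (Fin 5 → ℝ) => z.2.2 1 / 2) _
    fun_prop

/-- The terms `2(N - 1)η`, `Np`, `Nh` moved to the left side as exponents cancel the linear part of
the first three components. Only `η` and `p` driving `b` and `θ` remain, and the factors `2` in `f =
t(1 + 2b)` and `-u = 2tθ` reduce this coupling to `1/2`. -/
lemma fderiv_singField (N : ℕ) (D ε K : ℝ) (w : Fin 5 → ℝ) :
    fderiv ℝ (singField N D ε) (0, K, 0) (0, 0, w) = ![0, 0, 0, w 0 / 2, w 1 / 2] := by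
  have hd := ((contDiffAt_singField N D ε K).differentiableAt one_ne_zero).hasFDerivAt
  have hline : HasDerivAt (fun s : ℝ => ((0 : ℝ), K, s • w)) ((0 : ℝ), (0 : ℝ), w) 0 := by
    refine (hasDerivAt_const _ _).prodMk ((hasDerivAt_const _ _).prodMk ?_)
    simpa using (hasDerivAt_id (0 : ℝ)).smul_const w
  have h1 : HasDerivAt (fun s : ℝ => singField N D ε (0, K, s • w))
      (fderiv ℝ (singField N D ε) (0, K, 0) (0, 0, w)) 0 := by
    have h0 : ((0 : ℝ), K, (0 : ℝ) • w) = (0, K, 0) := by simp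
    rw [← h0] at hd
    have := hd.comp_hasDerivAt (0 : ℝ) hline
    rwa [h0] at this
  refine h1.unique (hasDerivAt_pi.2 fun i => ?_)
  have did : HasDerivAt (fun s : ℝ => s) 1 0 := hasDerivAt_id 0
  have dlin : ∀ a : ℝ, HasDerivAt (fun s : ℝ => s * a) a 0 := fun a => by
    simpa using did.mul_const a
  have dden : HasDerivAt (fun s : ℝ => 1 + 2 * (s * w 3)) (2 * w 3) 0 :=
    ((dlin (w 3)).const_mul 2).const_add 1
  have hne : 1 + 2 * ((0 : ℝ) * w 3) ≠ 0 := by simp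
  fin_cases i
  · have := ((dlin (w 0)).const_mul (2 * ((N : ℝ) - 1))).add
      (((((dlin (w 0)).const_add 1).pow 2).const_sub 1 |>.const_mul ((N : ℝ) - 1)).div dden hne)
    simp [singField]
    convert! this using 1
    simp
    ring
  · have := ((dlin (w 1)).const_mul (N : ℝ)).sub
      ((((dlin (w 1)).const_mul (N : ℝ)).mul ((dlin (w 0)).const_add 1)).div dden hne)
    simp [singField]
    convert! this using 1
    simp
  · have := ((dlin (w 2)).const_mul (N : ℝ)).sub
      ((((dlin (w 2)).const_mul (N : ℝ)).mul ((dlin (w 0)).const_add 1)).div dden hne)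
    simp [singField]
    convert! this using 1
    simp
  · simpa [singField] using (dlin (w 0)).div_const 2
  · simpa [singField] using (dlin (w 1)).div_const 2

lemma norm_fderiv_singField_le (N : ℕ) (D ε K : ℝ) (w : Fin 5 → ℝ) :
    ‖fderiv ℝ (singField N D ε) (0, K, 0) (0, 0, w)‖ ≤ 1 / 2 * ‖w‖ := by
  rw [fderiv_singField]
  refine (pi_norm_le_iff_of_nonneg (by positivity)).2 fun i => ?_
  have h0 := norm_le_pi_norm w 0
  have h1 := norm_le_pi_norm w 1
  have hn := norm_nonneg w
  rw [Real.norm_eq_abs] at h0 h1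
  fin_cases i <;> simp <;> linarith

lemma singField_zero (N : ℕ) (D ε K : ℝ) : singField N D ε (0, K, 0) = 0 := by
  ext i
  fin_cases i <;> simp [singField]

/-- The exponents use truncated subtraction; `2 ≤ N` makes it exact. -/
lemma singExp_cast {N : ℕ} (hN : 2 ≤ N) :
    (singExp N 0 : ℝ) + 1 = 2 * (N - 1) ∧ (singExp N 1 : ℝ) + 1 = N ∧
      (singExp N 2 : ℝ) + 1 = N ∧ (singExp N 3 : ℝ) + 1 = 1 ∧ (singExp N 4 : ℝ) + 1 = 1 := by
  have h1 : singExp N 0 + 3 = 2 * N := by simp [singExp]; omega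
  have h2 : singExp N 1 + 1 = N := by simp [singExp]; omega
  have h3 : singExp N 2 + 1 = N := by simp [singExp]; omega
  have h1' : (singExp N 0 : ℝ) + 3 = 2 * N := by exact_mod_cast h1
  refine ⟨by linarith, by exact_mod_cast h2, by exact_mod_cast h3, ?_, ?_⟩ <;> simp [singExp]

lemma hasDerivAt_toState {N : ℕ} (hN : 2 ≤ N) {D ε K : ℝ} {w : ℝ → Fin 5 → ℝ} {t : ℝ}
    (ht : 0 < t) (hb : 0 < 1 + 2 * w t 3)
    (hw : ∀ i, HasDerivAt (fun t => w t i)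
      ((singField N D ε (t, K, w t) i - (singExp N i + 1) * w t i) / t) t) :
    HasDerivAt (fun t => toState t (w t)) (redField N D ε K (toState t (w t))) t := by
  obtain ⟨e0, e1, e2, e3, e4⟩ := singExp_cast hN
  have d0 := hw 0
  have d1 := hw 1
  have d2 := hw 2
  have d3 := hw 3
  have d4 := hw 4
  rw [e0] at d0
  rw [e1] at d1
  rw [e2] at d2
  rw [e3] at d3
  rw [e4] at d4
  have ht0 := ht.ne'
  have hb0 := hb.ne'
  refine hasDerivAt_pi.2 fun i => ?_
  fin_cases i
  · refine ((hasDerivAt_id t).mul ((d3.const_mul 2).const_add 1)).congr_deriv ?_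
    simp [redField, toState, singField]
    field_simp
    ring
  · refine (d0.const_add 1).congr_deriv ?_
    simp [redField, toState, singField]
    field_simp
    ring
  · refine d1.congr_deriv ?_
    simp [redField, redMean, toState, singField]
    field_simp
    ring
  · refine d2.congr_deriv ?_
    simp [redField, redMean, toState, singField]
    field_simp
    ring
  · refine (((hasDerivAt_id t).const_mul 2).mul d4).congr_deriv ?_
    simp [redField, toState, singField]
    field_simp
    ring

namespace RedSol

variable {N : ℕ} {D ε K T : ℝ} {x : ℝ → Fin 5 → ℝ}

lemma hasDerivAt_ofState (hx : RedSol N D ε K T x) (hN : 2 ≤ N) {t : ℝ} (ht : t ∈ Ioo 0 T)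
    (i : Fin 5) :
    HasDerivAt (fun t => ofState t (x t) i)
      ((singField N D ε (t, K, ofState t (x t)) i - (singExp N i + 1) * ofState t (x t) i) / t)
      t := by
  obtain ⟨e0, e1, e2, e3, e4⟩ := singExp_cast hN
  have ht0 := ht.1.ne'
  have hf := (hx.pos_f t ht).ne'
  have hN2 : ((2 : ℝ) * t) ≠ 0 := by positivity
  have hb : 1 + 2 * ((x t 0 / t - 1) / 2) = x t 0 / t := by ring
  fin_cases i
  · refine ((hx.deriv_y ht).sub_const 1).congr_deriv ?_
    simp only [Fin.zero_eta, e0]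
    simp [ofState, singField]
    rw [hb]
    field_simp
    ring
  · refine (hx.deriv_p ht).congr_deriv ?_
    simp only [Fin.mk_one, e1]
    simp [ofState, singField, redMean]
    rw [hb]
    field_simp
    ring
  · refine (hx.deriv_h ht).congr_deriv ?_
    simp only [Fin.reduceFinMk, e2]
    simp [ofState, singField, redMean]
    rw [hb]
    field_simp
    ring
  · refine ((((hx.deriv_f ht).div (hasDerivAt_id t) ht0).sub_const 1).div_const 2).congr_deriv ?_
    simp only [Fin.reduceFinMk, e3]
    simp [ofState, singField]
    field_simp
    ring
  · refine ((hx.deriv_v ht).div ((hasDerivAt_id t).const_mul 2) hN2).congr_deriv ?_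
    simp only [Fin.reduceFinMk, e4]
    simp [ofState, singField]
    field_simp

lemma eventually_mem (hT : 0 < T) : ∀ᶠ t in 𝓝[>] (0 : ℝ), t ∈ Ioo 0 T := Ioo_mem_nhdsGT hT

lemma lim_f_div (hx : RedSol N D ε K T x) (hT : 0 < T) :
    Tendsto (fun t => x t 0 / t) (𝓝[>] 0) (𝓝 1) := by
  have h := HasDerivAt.lhopital_zero_nhdsGT (f := fun t => x t 0) (f' := fun t => x t 1)
    (g := fun t => t) (g' := fun _ => 1) (l := 𝓝 1) (a := 0)
    ((eventually_mem hT).mono fun t ht => hx.deriv_f ht)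
    (Eventually.of_forall fun t => hasDerivAt_id t) (Eventually.of_forall fun _ => one_ne_zero)
    hx.lim_f (tendsto_id.mono_left nhdsWithin_le_nhds) (by simpa using hx.lim_y)
  exact h

lemma lim_v_div (hx : RedSol N D ε K T x) (hT : 0 < T) :
    Tendsto (fun t => x t 4 / t) (𝓝[>] 0) (𝓝 0) := by
  have h := HasDerivAt.lhopital_zero_nhdsGT (f := fun t => x t 4) (f' := fun t => x t 2)
    (g := fun t => t) (g' := fun _ => 1) (l := 𝓝 0) (a := 0)
    ((eventually_mem hT).mono fun t ht => hx.deriv_v ht)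
    (Eventually.of_forall fun t => hasDerivAt_id t) (Eventually.of_forall fun _ => one_ne_zero)
    hx.lim_v (tendsto_id.mono_left nhdsWithin_le_nhds) (by simpa using hx.lim_p)
  exact h

/-- By l'Hôpital, `f/t → 1` and `v/t → 0` follow from the bare limits in `RedSol`, so uniqueness
holds in that whole class. -/
lemma tendsto_ofState (hx : RedSol N D ε K T x) (hT : 0 < T) :
    Tendsto (fun t => ofState t (x t)) (𝓝[>] 0) (𝓝 0) := by
  refine tendsto_pi_nhds.2 fun i => ?_
  fin_cases i
  · simpa [ofState] using hx.lim_y.sub_const 1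
  · simpa [ofState] using hx.lim_p
  · simpa [ofState] using hx.lim_h
  · simpa [ofState] using ((hx.lim_f_div hT).sub_const 1).div_const 2
  · have := (hx.lim_v_div hT).div_const 2
    rw [zero_div] at this
    refine this.congr fun t => ?_
    simp [ofState]
    field_simp

end RedSol

/-- Local existence and local uniqueness at the collapsing sphere, with continuity in `K`. -/
theorem exists_local_family {N : ℕ} (hN : 2 ≤ N) (D ε K₀ : ℝ) :
    ∃ δ > 0, ∃ x : ℝ → ℝ → Fin 5 → ℝ,
      (∀ K, |K - K₀| ≤ δ → RedSol N D ε K δ (x K)) ∧ (∀ t, Continuous fun K => x K t) := by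
  obtain ⟨ρ, hρ, hlip, δ, hδ, hδρ, w, hw, hw0, hsol⟩ := exists_singular_solution (singExp N)
    (contDiffAt_singField N D ε K₀) (norm_fderiv_singField_le N D ε K₀) (singField_zero N D ε)
  -- shrink, so that the denominators stay positive
  have hsmall : ∀ᶠ z in 𝓝 ((0 : ℝ), K₀), 0 < 1 + 2 * w z 3 := by
    have h1 : Tendsto (fun z => 1 + 2 * w z 3) (𝓝 ((0 : ℝ), K₀)) (𝓝 (1 + 2 * w (0, K₀) 3)) := by
      have : Continuous fun z => 1 + 2 * w z 3 := by fun_prop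
      exact this.tendsto _
    rw [hw0 K₀ (by simpa using hδ.le)] at h1
    exact h1.eventually (lt_mem_nhds (by simp))
  obtain ⟨r, hr, hball⟩ := Metric.eventually_nhds_iff_ball.1 hsmall
  set δ' := min δ (r / 2) with hδ'
  have hδ'0 : 0 < δ' := lt_min hδ (by positivity)
  have hpos : ∀ t K, 0 < t → t < δ' → |K - K₀| ≤ δ' → 0 < 1 + 2 * w (t, K) 3 := by
    intro t K ht htδ hK
    refine hball (t, K) ?_
    rw [Metric.mem_ball, dist_eq_norm]
    have : ((t, K) : ℝ × ℝ) - (0, K₀) = (t, K - K₀) := by simp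
    rw [this, Prod.norm_def]
    have h1 := htδ.le.trans (min_le_right _ _)
    have h2 := hK.trans (min_le_right _ _)
    simp only [Real.norm_eq_abs, abs_of_pos ht]
    exact max_lt (by linarith) (by linarith)
  refine ⟨δ', hδ'0, fun K t => toState t (w (t, K)), fun K hK => ?_, fun t => ?_⟩
  · have hKδ : |K - K₀| ≤ δ := hK.trans (min_le_left _ _)
    refine ⟨fun t ht => ?_, fun t ht => ?_, ?_⟩
    · exact hasDerivAt_toState hN (w := fun t => w (t, K)) ht.1 (hpos t K ht.1 ht.2 hK)
        (hsol t K ht.1 (ht.2.le.trans (min_le_left _ _)) hKδ).2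
    · exact mul_pos ht.1 (hpos t K ht.1 ht.2 hK)
    · have hc : Tendsto (fun t => toState t (w (t, K))) (𝓝 0) (𝓝 (toState 0 (w (0, K)))) := by
        have : Continuous fun t => toState t (w (t, K)) := by
          refine continuous_pi fun i => ?_
          fin_cases i <;> simp [toState] <;> fun_prop
        exact this.tendsto 0
      rw [hw0 K hKδ] at hc
      have he : toState 0 0 = ![0, 1, 0, 0, 0] := by
        ext i; fin_cases i <;> simp [toState]
      rw [he] at hc
      exact hc.mono_left nhdsWithin_le_nhds
  · refine continuous_pi fun i => ?_
    fin_cases i <;> simp [toState] <;> fun_prop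

/-- Two solutions with the same parameters agree near the collapsing sphere. -/
theorem RedSol.eq_near {N : ℕ} (hN : 2 ≤ N) {D ε K T : ℝ} (hT : 0 < T) {x x' : ℝ → Fin 5 → ℝ}
    (hx : RedSol N D ε K T x) (hx' : RedSol N D ε K T x') :
    ∃ δ > 0, δ ≤ T ∧ ∀ t ∈ Ioo 0 δ, x t = x' t := by
  -- Only the Lipschitz estimate on the box is used here, not the constructed solution.
  obtain ⟨ρ, hρ, hlip, -⟩ := exists_singular_solution (singExp N)
    (contDiffAt_singField N D ε K) (norm_fderiv_singField_le N D ε K) (singField_zero N D ε)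
  have hev : ∀ x, RedSol N D ε K T x → ∀ᶠ t in 𝓝[>] (0 : ℝ), ‖ofState t (x t)‖ < ρ := by
    intro x hx
    have := (hx.tendsto_ofState hT).norm
    rw [norm_zero] at this
    exact this.eventually (gt_mem_nhds hρ)
  obtain ⟨δ, hδ, hsub⟩ := mem_nhdsGT_iff_exists_Ioo_subset.1
    (((hev x hx).and (hev x' hx')).and (Ioo_mem_nhdsGT hρ))
  have hδ : (0 : ℝ) < δ := hδ
  refine ⟨min δ T, lt_min hδ hT, min_le_right _ _, ?_⟩
  have hT' : ∀ t ∈ Ioo 0 (min δ T), t ∈ Ioo 0 T := fun t ht => ⟨ht.1, ht.2.trans_le (min_le_right _ _)⟩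
  have key := singular_solution_unique (k := singExp N) (δ := min δ T)
    (q := fun t => singField N D ε (t, K, ofState t (x t)))
    (q' := fun t => singField N D ε (t, K, ofState t (x' t)))
    (w := fun t => ofState t (x t)) (w' := fun t => ofState t (x' t))
    (fun t ht => by
      obtain ⟨⟨h1, h2⟩, h3⟩ := hsub ⟨ht.1, ht.2.trans_le (min_le_left _ _)⟩
      exact hlip t K _ _ (by rw [abs_of_pos ht.1]; exact h3.2.le) (by simpa using hρ.le) h1.le
        h2.le)
    (fun t ht i => hx.hasDerivAt_ofState hN (hT' t ht) i)
    (fun t ht i => hx'.hasDerivAt_ofState hN (hT' t ht) i)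
    (hx.tendsto_ofState hT) (hx'.tendsto_ofState hT)
  intro t ht
  have := congrArg (toState t) (key t ht)
  simpa only [toState_ofState ht.1.ne'] using this

end WarpedSoliton

namespace WarpedSoliton

/-! ### Global existence, uniqueness, and dependence on the parameter -/

/-- A convex compact set of states on which the reduced system is regular. -/
def stateBox (c R : ℝ) : Set (Fin 5 → ℝ) := {z | c ≤ z 0} ∩ Metric.closedBall 0 R

lemma convex_stateBox (c R : ℝ) : Convex ℝ (stateBox c R) := by
  refine Convex.inter ?_ (convex_closedBall _ _)
  intro z hz z' hz' a b ha hb hab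
  change c ≤ a * z 0 + b * z' 0
  calc c = a * c + b * c := by rw [← add_mul, hab, one_mul]
    _ ≤ a * z 0 + b * z' 0 := add_le_add (mul_le_mul_of_nonneg_left hz ha)
      (mul_le_mul_of_nonneg_left hz' hb)

lemma isCompact_stateBox (c R : ℝ) : IsCompact (stateBox c R) :=
  (isCompact_closedBall _ _).inter_left (isClosed_le continuous_const (continuous_apply 0))

lemma contDiffAt_redField (N : ℕ) (D ε K : ℝ) {z : Fin 5 → ℝ} (hz : z 0 ≠ 0) {n : ℕ∞ω} :
    ContDiffAt ℝ n (redField N D ε K) z := by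
  refine contDiffAt_pi.2 fun i => ?_
  have hM : ContDiffAt ℝ n (fun z : Fin 5 → ℝ => redMean N D z) z := by
    unfold redMean
    exact ((by fun_prop : ContDiffAt ℝ n (fun z : Fin 5 → ℝ => z 2) z).add
      (contDiffAt_const.mul (ContDiffAt.div (by fun_prop) (by fun_prop) hz))).add (by fun_prop)
  fin_cases i
  · change ContDiffAt ℝ n (fun z : Fin 5 → ℝ => z 1) z
    fun_prop
  · change ContDiffAt ℝ n (fun z : Fin 5 → ℝ => -(z 2 + D * z 3) * z 1
      + (N - 1) * (1 - z 1 ^ 2) / z 0 + ε / 2 * z 0) z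
    exact ((by fun_prop : ContDiffAt ℝ n (fun z : Fin 5 → ℝ => -(z 2 + D * z 3) * z 1) z).add
      (ContDiffAt.div (by fun_prop) (by fun_prop) hz)).add (by fun_prop)
  · change ContDiffAt ℝ n (fun z : Fin 5 → ℝ => -redMean N D z * z 2 + (K + ε * z 4)) z
    exact (hM.neg.mul (by fun_prop)).add (by fun_prop)
  · change ContDiffAt ℝ n (fun z : Fin 5 → ℝ => -redMean N D z * z 3 + ε / 2) z
    exact (hM.neg.mul (by fun_prop)).add (by fun_prop)
  · change ContDiffAt ℝ n (fun z : Fin 5 → ℝ => z 2) z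
    fun_prop

lemma exists_lipschitzOnWith_redField (N : ℕ) (D ε K : ℝ) {c : ℝ} (hc : 0 < c) (R : ℝ) :
    ∃ L, LipschitzOnWith L (redField N D ε K) (stateBox c R) :=
  ContDiffOn.exists_lipschitzOnWith (n := 1)
    (fun _ hz => (contDiffAt_redField N D ε K (hc.trans_le hz.1).ne').contDiffWithinAt)
    one_ne_zero (convex_stateBox c R) (isCompact_stateBox c R)

lemma dist_redField_le (N : ℕ) (D ε K K' : ℝ) (z : Fin 5 → ℝ) :
    dist (redField N D ε K z) (redField N D ε K' z) ≤ |K - K'| := by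
  refine (dist_pi_le_iff (abs_nonneg _)).2 fun i => ?_
  fin_cases i <;> simp [redField, dist_eq_norm]

namespace RedSol

variable {N : ℕ} {D ε K T : ℝ} {x x' : ℝ → Fin 5 → ℝ}

lemma f_le_f (hx : RedSol N D ε K T x) (P : Params N D ε K) {s t : ℝ} (hs : 0 < s) (hst : s ≤ t)
    (ht : t < T) : x s 0 ≤ x t 0 :=
  le_of_deriv_nonneg_Icc (g := fun t => x t 0) hst
    (fun _ hr => hx.deriv_f ⟨hs.trans_le hr.1, hr.2.trans_lt ht⟩)
    (fun _ hr => (hx.pos_y P ⟨hs.trans hr.1, hr.2.trans ht⟩).le)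

lemma norm_le (hx : RedSol N D ε K T x) (P : Params N D ε K) {t : ℝ} (ht : t ∈ Ioo 0 T) :
    ‖x t‖ ≤ (2 + K) * Real.exp ((1 + ε) * T) + ε / 2 * T := by
  have hε := P.hε
  have hK := P.hK
  obtain ⟨h1, h2⟩ := hx.y_f_le P t ht
  have h3 := hx.h_le P ht
  have h4 := hx.p_add_v_le P ht
  have hf := hx.pos_f t ht
  obtain ⟨hy, hp, hh, hv⟩ := hx.pos_all P t ht
  have hT : 0 < T := ht.1.trans ht.2
  have hE : Real.exp ((1 + ε) * t) ≤ Real.exp ((1 + ε) * T) := by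
    have := ht.2.le
    gcongr
  have hE0 := Real.exp_pos ((1 + ε) * t)
  have h5 : 2 / (1 + ε) * Real.exp ((1 + ε) * t) ≤ 2 * Real.exp ((1 + ε) * t) := by
    gcongr
    exact div_le_self two_pos.le (by linarith)
  have h6 : ε / 2 * t ≤ ε / 2 * T := by have := ht.2.le; gcongr
  have h7 : 0 < ε / 2 * T := by positivity
  have h8 : K * Real.exp ((1 + ε) * t) ≤ K * Real.exp ((1 + ε) * T) := by gcongr
  have h9 : 0 < K * Real.exp ((1 + ε) * t) := by positivity
  refine (pi_norm_le_iff_of_nonneg (by positivity)).2 fun i => ?_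
  fin_cases i
  · simp [abs_of_pos hf]; nlinarith
  · simp [abs_of_pos hy]; nlinarith
  · simp [abs_of_pos hp]; nlinarith
  · simp [abs_of_pos hh]; nlinarith
  · simp [abs_of_pos hv]; nlinarith

/-- Since `f` is nondecreasing, the solution stays away from the singularity `f = 0` after time `a`,
so on this convex compact set the field is bounded and Lipschitz. -/
lemma mem_stateBox (hx : RedSol N D ε K T x) (P : Params N D ε K) {a : ℝ} (ha : 0 < a) {t : ℝ}
    (ht : t ∈ Ico a T) :
    x t ∈ stateBox (x a 0) ((2 + K) * Real.exp ((1 + ε) * T) + ε / 2 * T) :=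
  ⟨hx.f_le_f P ha ht.1 ht.2, mem_closedBall_zero_iff.2 (hx.norm_le P ⟨ha.trans_le ht.1, ht.2⟩)⟩

/-- Solutions are unique. -/
theorem eqOn (hx : RedSol N D ε K T x) (hx' : RedSol N D ε K T x') (P : Params N D ε K) :
    ∀ t ∈ Ioo 0 T, x t = x' t := by
  intro t ht
  obtain ⟨δ, hδ, hδT, hnear⟩ := RedSol.eq_near P.hN (ht.1.trans ht.2) hx hx'
  rcases lt_or_ge t δ with h | h
  · exact hnear t ⟨ht.1, h⟩
  set a := δ / 2
  have ha : 0 < a := by positivity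
  have haδ : a < δ := by simp only [a]; linarith
  have haa := hnear a ⟨ha, haδ⟩
  have hc := hx.pos_f a ⟨ha, haδ.trans_le hδT⟩
  obtain ⟨L, hL⟩ := exists_lipschitzOnWith_redField N D ε K hc
    ((2 + K) * Real.exp ((1 + ε) * T) + ε / 2 * T)
  have hsub : ∀ s ∈ Icc a t, s ∈ Ioo 0 T := fun s hs => ⟨ha.trans_le hs.1, hs.2.trans_lt ht.2⟩
  have := ODE_solution_unique_of_mem_Icc_right (a := a) (b := t) (f := x) (g := x')
    (v := fun _ => redField N D ε K) (K := L) (s := fun _ => stateBox (x a 0) _)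
    (fun _ _ => hL)
    (fun s hs => (hx.ode s (hsub s hs)).continuousAt.continuousWithinAt)
    (fun s hs => (hx.ode s (hsub s ⟨hs.1, hs.2.le⟩)).hasDerivWithinAt)
    (fun s hs => hx.mem_stateBox P ha ⟨hs.1, hs.2.trans ht.2⟩)
    (fun s hs => (hx'.ode s (hsub s hs)).continuousAt.continuousWithinAt)
    (fun s hs => (hx'.ode s (hsub s ⟨hs.1, hs.2.le⟩)).hasDerivWithinAt)
    (fun s hs => by
      have := hx'.mem_stateBox P ha (t := s) ⟨hs.1, hs.2.trans ht.2⟩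
      rwa [← haa] at this)
    haa
  exact this ⟨haδ.le.trans h, le_rfl⟩

/-- Solutions on a bounded interval extend. -/
theorem exists_extension (hx : RedSol N D ε K T x) (P : Params N D ε K) (hT : 0 < T) :
    ∃ T' > T, ∃ x', RedSol N D ε K T' x' := by
  set a := T / 2 with ha
  have ha0 : 0 < a := by positivity
  have haT : a < T := by linarith
  have hc := hx.pos_f a ⟨ha0, haT⟩
  set R := (2 + K) * Real.exp ((1 + ε) * T) + ε / 2 * T
  have hmem : ∀ t ∈ Ico a T, x t ∈ stateBox (x a 0) R := fun t ht => hx.mem_stateBox P ha0 ht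
  have hF : ContinuousOn (redField N D ε K) (stateBox (x a 0) R) := fun z hz =>
    (contDiffAt_redField N D ε K (n := 1) (hc.trans_le hz.1).ne').continuousAt.continuousWithinAt
  obtain ⟨C, hC⟩ := (isCompact_stateBox (x a 0) R).exists_bound_of_continuousOn hF
  have hlip : LipschitzOnWith C.toNNReal x (Ico a T) := by
    refine (convex_Ico a T).lipschitzOnWith_of_nnnorm_hasDerivWithin_le
      (f' := fun t => redField N D ε K (x t))
      (fun t ht => (hx.ode t ⟨ha0.trans_le ht.1, ht.2⟩).hasDerivWithinAt) fun t ht => ?_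
    rw [← NNReal.coe_le_coe, coe_nnnorm]
    exact (hC _ (hmem t ht)).trans (Real.le_coe_toNNReal C)
  -- The Lipschitz extension supplies the limit at `T`, from which Picard–Lindelöf restarts the
  -- solution.
  obtain ⟨g, hg, hgx⟩ := hlip.extend_pi
  have hgT : Tendsto x (𝓝[<] T) (𝓝 (g T)) := by
    refine ((hg.continuous.tendsto T).mono_left nhdsWithin_le_nhds).congr' ?_
    filter_upwards [Ioo_mem_nhdsLT haT] with t ht using (hgx ⟨ht.1.le, ht.2⟩).symm
  have hbox : g T ∈ stateBox (x a 0) R := by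
    refine (isCompact_stateBox _ _).isClosed.mem_of_tendsto hgT ?_
    filter_upwards [Ioo_mem_nhdsLT haT] with t ht using hmem t ⟨ht.1.le, ht.2⟩
  have hg0 : 0 < g T 0 := hc.trans_le hbox.1
  have hFT := contDiffAt_redField N D ε K (n := 1) hg0.ne'
  obtain ⟨β, hβT, e, he, hβ⟩ :=
    hFT.exists_forall_mem_closedBall_exists_eq_forall_mem_Ioo_hasDerivAt₀ T
  have hβc : ContinuousAt β T := (hβ T ⟨by linarith, by linarith⟩).continuousAt
  have hβpos : ∀ᶠ t in 𝓝 T, 0 < β t 0 := by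
    have : Tendsto (fun t => β t 0) (𝓝 T) (𝓝 (β T 0)) :=
      ((continuous_apply 0).tendsto _).comp hβc
    rw [hβT] at this
    exact this.eventually (lt_mem_nhds hg0)
  obtain ⟨r, hr, hβr⟩ := Metric.eventually_nhds_iff_ball.1 hβpos
  rw [Real.ball_eq_Ioo] at hβr
  set T' := T + min e r with hT'
  have hmin : 0 < min e r := lt_min he hr
  set x' : ℝ → Fin 5 → ℝ := fun t => if t < T then x t else β t with hx'
  have hlt : ∀ t < T, x' =ᶠ[𝓝 t] x := fun t ht => by
    filter_upwards [Iio_mem_nhds ht] with s hs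
    exact if_pos hs
  have hgt : ∀ t, T < t → x' =ᶠ[𝓝 t] β := fun t ht => by
    filter_upwards [Ioi_mem_nhds ht] with s hs
    exact if_neg (not_lt.2 (le_of_lt hs))
  have hxT : x' T = g T := by simp [hx', hβT]
  refine ⟨T', by linarith, x', fun t ht => ?_, fun t ht => ?_, ?_⟩
  · rcases lt_trichotomy t T with h | h | h
    · rw [(hlt t h).self_of_nhds]
      exact (hx.ode t ⟨ht.1, h⟩).congr_of_eventuallyEq (hlt t h)
    · subst h
      have hr' : HasDerivWithinAt x' (redField N D ε K (g t)) (Ici t) t := by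
        have h1 := (hβ t ⟨by linarith, by linarith⟩).hasDerivWithinAt (s := Ici t)
        rw [hβT] at h1
        refine h1.congr (fun s hs => ?_) ?_
        · exact if_neg (not_lt.2 hs)
        · simp [hx']
      -- At the junction the left derivative is the limit of the derivatives, by continuity of the
      -- field.
      have hl : HasDerivWithinAt x' (redField N D ε K (g t)) (Iic t) t := by
        refine hasDerivWithinAt_Iic_of_tendsto_deriv (s := Ioo 0 t) (fun s hs => ?_) ?_
          (Ioo_mem_nhdsLT hT) ?_
        · exact ((hx.ode s hs).congr_of_eventuallyEq
            (hlt s hs.2)).differentiableAt.differentiableWithinAt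
        · rw [ContinuousWithinAt, hxT]
          refine (hgT.mono_left (nhdsWithin_mono _ fun s hs => hs.2)).congr' ?_
          filter_upwards [self_mem_nhdsWithin] with s hs
          exact (hlt s hs.2).self_of_nhds.symm
        · have h1 : Tendsto (fun s => redField N D ε K (x s)) (𝓝[<] t)
              (𝓝 (redField N D ε K (g t))) := hFT.continuousAt.tendsto.comp hgT
          refine h1.congr' ?_
          filter_upwards [Ioo_mem_nhdsLT hT] with s hs
          exact ((hx.ode s hs).congr_of_eventuallyEq (hlt s hs.2)).deriv.symm
      rw [hxT]
      have := hl.union hr'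
      rwa [Iic_union_Ici, hasDerivWithinAt_univ] at this
    · rw [(hgt t h).self_of_nhds]
      have := min_le_left e r
      exact (hβ t ⟨by linarith, by linarith [ht.2]⟩).congr_of_eventuallyEq (hgt t h)
  · rcases lt_or_ge t T with h | h
    · rw [(hlt t h).self_of_nhds]; exact hx.pos_f t ⟨ht.1, h⟩
    · have h1 : x' t = β t := if_neg (not_lt.2 h)
      rw [h1]
      have := min_le_right e r
      exact hβr t ⟨by linarith, by linarith [ht.2]⟩
  · refine hx.lim.congr' ?_
    filter_upwards [Ioo_mem_nhdsGT hT] with t ht using (hlt t ht.2).self_of_nhds.symm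

/-- Gluing of solutions on growing intervals. -/
theorem glue (P : Params N D ε K) (hT : 0 < T) (X : ℝ → ℝ → Fin 5 → ℝ) (τ : ℝ → ℝ)
    (hτ : ∀ t ∈ Ioo 0 T, t < τ t ∧ RedSol N D ε K (τ t) (X (τ t))) :
    RedSol N D ε K T fun t => X (τ t) t := by
  have hev : ∀ t ∈ Ioo 0 T, ∀ s ∈ Ioo 0 (τ t), s < T → X (τ s) s = X (τ t) s := by
    intro t ht s hs hsT
    obtain ⟨h1, h2⟩ := hτ t ht
    obtain ⟨h3, h4⟩ := hτ s ⟨hs.1, hsT⟩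
    exact (h4.mono (min_le_right (τ t) _)).eqOn (h2.mono (min_le_left _ (τ s))) P s
      ⟨hs.1, lt_min hs.2 h3⟩
  have hloc : ∀ t ∈ Ioo 0 T, (fun s => X (τ s) s) =ᶠ[𝓝 t] X (τ t) := fun t ht => by
    filter_upwards [Ioo_mem_nhds ht.1 (hτ t ht).1, Iio_mem_nhds ht.2] with s hs hs'
    exact hev t ht s hs hs'
  refine ⟨fun t ht => ?_, fun t ht => ?_, ?_⟩
  · obtain ⟨h1, h2⟩ := hτ t ht
    exact (h2.ode t ⟨ht.1, h1⟩).congr_of_eventuallyEq (hloc t ht)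
  · obtain ⟨h1, h2⟩ := hτ t ht
    exact h2.pos_f t ⟨ht.1, h1⟩
  · have hm : T / 2 ∈ Ioo 0 T := ⟨by positivity, by linarith⟩
    obtain ⟨h1, h2⟩ := hτ _ hm
    refine h2.lim.congr' ?_
    filter_upwards [Ioo_mem_nhdsGT (hm.1.trans h1), Ioo_mem_nhdsGT hT] with s hs hs'
    exact (hev _ hm s hs hs'.2).symm

/-- If the existence times were bounded, solutions on shorter intervals would glue to one on `(0,
M)`, with `M` the supremum, and that one extends beyond `M`. -/
theorem exists_on (P : Params N D ε K) (T : ℝ) : ∃ x, RedSol N D ε K T x := by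
  set S : Set ℝ := {T | 0 < T ∧ ∃ x, RedSol N D ε K T x} with hS
  obtain ⟨δ, hδ, x₀, hx₀, -⟩ := exists_local_family P.hN D ε K
  have hδS : δ ∈ S := ⟨hδ, x₀ K, hx₀ K (by simpa using hδ.le)⟩
  by_contra hcon
  have hle : ∀ T' ∈ S, T' ≤ T := by
    rintro T' ⟨-, y, hy⟩
    by_contra! h
    exact hcon ⟨y, hy.mono h.le⟩
  have hbdd : BddAbove S := ⟨T, hle⟩
  set M := sSup S with hM
  have hM0 : 0 < M := hδ.trans_le (le_csSup hbdd hδS)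
  have hex : ∀ t < M, ∃ x, RedSol N D ε K t x := by
    intro t ht
    obtain ⟨T', ⟨-, y, hy⟩, h⟩ := exists_lt_of_lt_csSup ⟨δ, hδS⟩ ht
    exact ⟨y, hy.mono h.le⟩
  have : ∀ t, ∃ x, t < M → RedSol N D ε K t x := fun t => by
    by_cases h : t < M
    · obtain ⟨x, hx⟩ := hex t h; exact ⟨x, fun _ => hx⟩
    · exact ⟨fun _ => 0, fun h' => absurd h' h⟩
  choose X hX using this
  have hg := glue P hM0 X (fun t => (t + M) / 2) (fun t ht =>
    ⟨by linarith [ht.2], hX _ (by linarith [ht.2])⟩)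
  obtain ⟨T', hT', y, hy⟩ := hg.exists_extension P hM0
  exact absurd (le_csSup hbdd (show T' ∈ S from ⟨hM0.trans hT', y, hy⟩)) (not_le.2 hT')

/-- Global existence. -/
theorem exists_global (P : Params N D ε K) : ∃ x, ∀ T, RedSol N D ε K T x := by
  choose X hX using fun T => exists_on P T
  refine ⟨fun t => X (t + 1) t, fun T => ?_⟩
  exact (glue P (T := max T 1) (by positivity) X (fun t => t + 1)
    fun t _ => ⟨by linarith, hX _⟩).mono (le_max_left _ _)

/-- Solutions depend continuously on the parameter. -/
theorem continuousAt_param {N : ℕ} {D ε : ℝ} (P : ∀ K, 0 < K → Params N D ε K)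
    {x : ℝ → ℝ → Fin 5 → ℝ} (hx : ∀ K, 0 < K → ∀ T, RedSol N D ε K T (x K)) {K₀ t : ℝ}
    (hK₀ : 0 < K₀) (ht : 0 < t) : ContinuousAt (fun K => x K t) K₀ := by
  obtain ⟨δ, hδ, z, hz, hzc⟩ := exists_local_family (P K₀ hK₀).hN D ε K₀
  have hnear : ∀ᶠ K in 𝓝 K₀, 0 < K ∧ |K - K₀| ≤ δ ∧ K ≤ K₀ + 1 := by
    refine (lt_mem_nhds hK₀).and (Eventually.and ?_ (Iic_mem_nhds (by linarith)))
    filter_upwards [Metric.closedBall_mem_nhds K₀ hδ] with K hK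
    simpa [Real.dist_eq] using hK
  have hsmall : ∀ s ∈ Ioo 0 δ, ContinuousAt (fun K => x K s) K₀ := by
    intro s hs
    refine (hzc s).continuousAt.congr ?_
    filter_upwards [hnear] with K hK
    exact (hz K hK.2.1).eqOn (hx K hK.1 δ) (P K hK.1) s hs
  rcases lt_or_ge t δ with h | h
  · exact hsmall t ⟨ht, h⟩
  set a := δ / 2 with ha
  have ha0 : 0 < a := by positivity
  have haδ : a < δ := by linarith
  have hca := hsmall a ⟨ha0, haδ⟩
  set T := t + 1 with hT
  have hε := (P K₀ hK₀).hε
  have hf0 : 0 < x K₀ a 0 := (hx K₀ hK₀ T).pos_f a ⟨ha0, by linarith⟩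
  set c := x K₀ a 0 / 2 with hc
  have hc0 : 0 < c := by positivity
  set R := (2 + (K₀ + 1)) * Real.exp ((1 + ε) * T) + ε / 2 * T with hR
  have hfc : ∀ᶠ K in 𝓝 K₀, c ≤ x K a 0 := by
    have : Tendsto (fun K => x K a 0) (𝓝 K₀) (𝓝 (x K₀ a 0)) :=
      ((continuous_apply 0).tendsto _).comp hca
    exact (this.eventually (lt_mem_nhds (show c < x K₀ a 0 by linarith))).mono fun _ h => h.le
  have hbox : ∀ K, 0 < K → K ≤ K₀ + 1 → c ≤ x K a 0 → ∀ s ∈ Ico a t, x K s ∈ stateBox c R := by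
    intro K hK hK1 hKc s hs
    obtain ⟨h1, h2⟩ := (hx K hK T).mem_stateBox (P K hK) ha0 (t := s)
      ⟨hs.1, by linarith [hs.2]⟩
    refine ⟨hKc.trans h1, Metric.closedBall_subset_closedBall ?_ h2⟩
    have := Real.exp_pos ((1 + ε) * T)
    rw [hR]; gcongr
  obtain ⟨L, hL⟩ := exists_lipschitzOnWith_redField N D ε K₀ hc0 R
  -- Passing to `L + 1` makes the constant nonzero, so the exponential form of the Gronwall bound is
  -- available.
  have hL' : LipschitzOnWith (L + 1) (redField N D ε K₀) (stateBox c R) :=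
    hL.weaken (le_add_of_nonneg_right zero_le_one)
  -- The fields for `K` and `K₀` differ by at most `|K - K₀|`, so `x K` is an approximate solution
  -- for `K₀`. The comparison starts at `a > 0`, where continuity in `K` is known from the local
  -- family.
  have hbound : ∀ᶠ K in 𝓝 K₀, dist (x K t) (x K₀ t) ≤
      gronwallBound (dist (x K a) (x K₀ a)) (L + 1 : NNReal) (|K - K₀| + 0) (t - a) := by
    filter_upwards [hnear, hfc] with K hK hKc
    have sub : ∀ s ∈ Icc a t, s ∈ Ioo 0 T := fun s hs =>
      ⟨ha0.trans_le hs.1, by linarith [hs.2]⟩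
    exact dist_le_of_approx_trajectories_ODE_of_mem (a := a) (b := t) (f := x K) (g := x K₀)
      (v := fun _ => redField N D ε K₀) (s := fun _ => stateBox c R) (K := L + 1)
      (fun _ _ => hL')
      (fun s hs => ((hx K hK.1 T).ode s (sub s hs)).continuousAt.continuousWithinAt)
      (fun s hs => ((hx K hK.1 T).ode s (sub s ⟨hs.1, hs.2.le⟩)).hasDerivWithinAt)
      (fun s _ => dist_redField_le N D ε K K₀ (x K s))
      (hbox K hK.1 hK.2.2 hKc)
      (fun s hs => ((hx K₀ hK₀ T).ode s (sub s hs)).continuousAt.continuousWithinAt)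
      (fun s hs => ((hx K₀ hK₀ T).ode s (sub s ⟨hs.1, hs.2.le⟩)).hasDerivWithinAt)
      (fun s _ => (dist_self _).le)
      (hbox K₀ hK₀ (by linarith) (by linarith)) le_rfl t ⟨haδ.le.trans h, le_rfl⟩
  have hlim : Tendsto (fun K => gronwallBound (dist (x K a) (x K₀ a)) (L + 1 : NNReal)
      (|K - K₀| + 0) (t - a)) (𝓝 K₀) (𝓝 0) := by
    have hne : ((L + 1 : NNReal) : ℝ) ≠ 0 := by positivity
    simp only [gronwallBound_of_K_ne_0 hne]
    have h1 : Tendsto (fun K => dist (x K a) (x K₀ a)) (𝓝 K₀) (𝓝 0) :=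
      tendsto_iff_dist_tendsto_zero.1 hca
    have h2 : Tendsto (fun K => |K - K₀| + 0) (𝓝 K₀) (𝓝 0) := by
      have : Continuous fun K => |K - K₀| + 0 := by fun_prop
      simpa using this.tendsto K₀
    simpa using (h1.mul_const _).add ((h2.div_const _).mul_const _)
  exact tendsto_iff_dist_tendsto_zero.2
    (squeeze_zero' (Eventually.of_forall fun _ => dist_nonneg) hbound hlim)

/-- Solutions are smooth. -/
theorem contDiffOn (hx : ∀ T, RedSol N D ε K T x) : ContDiffOn ℝ ∞ x (Ioi 0) := by
  have hode : ∀ t ∈ Ioi (0 : ℝ), HasDerivAt x (redField N D ε K (x t)) t := fun t ht =>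
    (hx (t + 1)).ode t ⟨ht, by linarith⟩
  have hpos : ∀ t ∈ Ioi (0 : ℝ), x t 0 ≠ 0 := fun t ht =>
    ((hx (t + 1)).pos_f t ⟨ht, by linarith⟩).ne'
  refine contDiffOn_infty.2 fun n => ?_
  induction n with
  | zero => exact contDiffOn_zero.2 fun t ht => (hode t ht).continuousAt.continuousWithinAt
  | succ n ih =>
    rw [Nat.cast_succ, contDiffOn_succ_iff_deriv_of_isOpen isOpen_Ioi]
    refine ⟨fun t ht => (hode t ht).differentiableAt.differentiableWithinAt, by simp, ?_⟩
    have : ContDiffOn ℝ n (fun t => redField N D ε K (x t)) (Ioi 0) := fun t ht =>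
      (contDiffAt_redField N D ε K (hpos t ht)).comp_contDiffWithinAt t (ih t ht)
    exact this.congr fun t ht => (hode t ht).deriv

end RedSol

end WarpedSoliton

/-! ### The limiting growth ratio as a function of the parameter. -/

namespace WarpedSoliton

namespace RedSol

section Family

variable {N : ℕ} {D ε : ℝ} {x : ℝ → ℝ → Fin 5 → ℝ}

/-- Trapping consists of strict inequalities at one time, so it persists under small changes of `K`
with the same `B` and `t`. -/
lemma eventually_trapped (P : ∀ K, 0 < K → Params N D ε K)
    (hx : ∀ K, 0 < K → ∀ T, RedSol N D ε K T (x K)) {K₀ B t : ℝ} (hK₀ : 0 < K₀) (ht : 0 < t)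
    (h : Trapped N D ε K₀ B (x K₀ t)) : ∀ᶠ K in 𝓝 K₀, Trapped N D ε K B (x K t) := by
  have hc := RedSol.continuousAt_param P hx hK₀ ht
  have c : ∀ i, Tendsto (fun K => x K t i) (𝓝 K₀) (𝓝 (x K₀ t i)) := fun i =>
    ((continuous_apply i).tendsto _).comp hc
  obtain ⟨h1, h2, h3, h4⟩ := h
  filter_upwards [(c 1).eventually (gt_mem_nhds h1),
    ((c 2).sub ((c 0).const_mul (ε / (2 * B)))).eventually (lt_mem_nhds (sub_pos.2 h2)),
    ((c 3).mul (c 0)).eventually (gt_mem_nhds h3),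
    ((tendsto_id.add ((c 4).const_mul ε)).sub
      (((c 0).pow 2).const_mul ((ε / (2 * B)) ^ 2))).eventually (lt_mem_nhds h4)]
    with K k1 k2 k3 k4
  exact ⟨k1, sub_pos.1 k2, k3, k4⟩

/-- With a common `c` near `K₀`, the value at one large time `t` approximates the limit within
`c/Z(t)`, and for fixed `t` both are continuous in `K`. -/
lemma continuousAt_limit (P : ∀ K, 0 < K → Params N D ε K)
    (hx : ∀ K, 0 < K → ∀ T, RedSol N D ε K T (x K)) {S : ℝ → ℝ}
    (hS : ∀ K, 0 < K → Tendsto (fun t => growthRatio N ε K (x K t)) atTop (𝓝 (S K)))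
    {K₀ : ℝ} (hK₀ : 0 < K₀) : ContinuousAt S K₀ := by
  obtain ⟨B, t₀, hB, ht₀, htr⟩ := exists_trapped (hx K₀ hK₀) (P K₀ hK₀)
  set c := ceiling ε B t₀
  have key : ∀ᶠ K in 𝓝 K₀, ∀ t, 0 < t → growthRatio N ε K (x K t) ≤ S K ∧
        S K ≤ growthRatio N ε K (x K t) + c / (K + ε * x K t 4) := by
    filter_upwards [eventually_trapped P hx hK₀ ht₀ htr, lt_mem_nhds hK₀] with K hK hK0
    obtain ⟨S', hS', hb⟩ := exists_tendsto_growthRatio (hx K hK0) (P K hK0)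
      (fun t ht => le_ceiling (hx K hK0) (P K hK0) hB ht₀ hK ht)
    rwa [tendsto_nhds_unique hS' (hS K hK0)] at hb
  refine Metric.continuousAt_iff'.2 fun η hη => ?_
  have hcZ : Tendsto (fun t => c / (K₀ + ε * x K₀ t 4)) atTop (𝓝 0) :=
    Tendsto.div_atTop tendsto_const_nhds (tendsto_Z (hx K₀ hK₀) (P K₀ hK₀))
  obtain ⟨t, ht1, ht⟩ := ((hcZ.eventually (gt_mem_nhds (show 0 < η / 4 by positivity))).and
    (eventually_gt_atTop 0)).exists
  have hc := RedSol.continuousAt_param P hx hK₀ ht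
  have cc : ∀ i, ContinuousAt (fun K => x K t i) K₀ := fun i =>
    ((continuous_apply i).tendsto _).comp hc
  have hZ0 : K₀ + ε * x K₀ t 4 ≠ 0 :=
    ((hx K₀ hK₀ (t + 1)).pos_Z (P K₀ hK₀) ⟨ht, by linarith⟩).ne'
  have hZ : ContinuousAt (fun K => K + ε * x K t 4) K₀ :=
    continuousAt_id.add (continuousAt_const.mul (cc 4))
  have hg : ContinuousAt (fun K => growthRatio N ε K (x K t)) K₀ :=
    (continuousAt_const.add (continuousAt_const.mul ((cc 0).pow 2))).div hZ hZ0
  have hq : ContinuousAt (fun K => c / (K + ε * x K t 4)) K₀ := continuousAt_const.div hZ hZ0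
  filter_upwards [key, hq.eventually (gt_mem_nhds ht1),
    Metric.continuousAt_iff'.1 hg (η / 4) (by positivity)] with K h1 h2 h3
  obtain ⟨a1, a2⟩ := h1 t ht
  obtain ⟨b1, b2⟩ := key.self_of_nhds t ht
  rw [Real.dist_eq, abs_lt] at h3 ⊢
  constructor <;> linarith [h3.1, h3.2]

end Family

/-- Every slope `σ⁻¹` at infinity is realized by some value of the parameter. -/
theorem exists_param {N : ℕ} {D ε : ℝ} (hN : 2 ≤ N) (hD : 0 ≤ D) (hε : 0 < ε) {σ : ℝ}
    (hσ : 0 < σ) : ∃ K, 0 < K ∧ ∀ x, (∀ T, RedSol N D ε K T x) →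
      Tendsto (fun t => x t 1) atTop (𝓝 σ⁻¹) := by
  have P : ∀ K, 0 < K → Params N D ε K := fun K hK => ⟨hN, hD, hε, hK⟩
  have hN' : (2 : ℝ) ≤ N := by exact_mod_cast hN
  have hex : ∀ K, ∃ x, 0 < K → ∀ T, RedSol N D ε K T x := fun K => by
    by_cases h : 0 < K
    · obtain ⟨x, hx⟩ := exists_global (P K h); exact ⟨x, fun _ => hx⟩
    · exact ⟨fun _ => 0, fun h' => absurd h' h⟩
  choose x hx using hex
  have hlim : ∀ K, ∃ S, 0 < K → Tendsto (fun t => growthRatio N ε K (x K t)) atTop (𝓝 S) :=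
    fun K => by
    by_cases h : 0 < K
    · obtain ⟨B, t₀, hB, ht₀, htr⟩ := exists_trapped (hx K h) (P K h)
      obtain ⟨S, hS, -⟩ := exists_tendsto_growthRatio (hx K h) (P K h)
        (fun t ht => le_ceiling (hx K h) (P K h) hB ht₀ htr ht)
      exact ⟨S, fun _ => hS⟩
    · exact ⟨0, fun h' => absurd h' h⟩
  choose S hS using hlim
  have hcont : ContinuousOn S (Ioi 0) := fun K hK =>
    (continuousAt_limit P hx hS hK).continuousWithinAt
  have hlow : ∀ K, 0 < K → (N - 1) / K ≤ S K := fun K hK => by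
    refine ge_of_tendsto (hS K hK) ?_
    filter_upwards [eventually_gt_atTop 0] with t ht
    exact (hx K hK (t + 1)).le_growthRatio (P K hK) ⟨ht, by linarith⟩
  -- Here `y < 2`, so `c = 8` bounds `2y²`, and the decreasing quantity starts at `(N - 1 + 8)/K`.
  have hup : ∀ K, (N + D + 1) * (ε / 2) < K → S K ≤ (N + 7) / K := fun K hKl => by
    have hK : 0 < K := lt_of_le_of_lt (by positivity) hKl
    refine le_of_tendsto (hS K hK) ?_
    filter_upwards [eventually_gt_atTop 0] with t ht
    have hm : t ∈ Ioo 0 (t + 1) := ⟨ht, by linarith⟩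
    have hZ := (hx K hK _).pos_Z (P K hK) hm
    have h := (hx K hK (t + 1)).growthRatio_add_le (P K hK) (c := 8) (fun s hs => by
      have h1 := (hx K hK _).y_lt_two (P K hK) hKl s hs
      have h2 := (hx K hK _).pos_y (P K hK) hs
      nlinarith) hm
    have : 0 ≤ 8 / (K + ε * x K t 4) := by positivity
    have e : (N : ℝ) - 1 + 8 = N + 7 := by ring
    rw [e] at h
    linarith
  -- The solution of `√(εS₀/2) = σ⁻¹`. Below, `K₁` makes the lower bound for `S` equal to `S₀`, and
  -- `K₂` makes the upper bound at most `S₀`.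
  set S₀ := 2 / (ε * σ ^ 2) with hS₀
  have hS₀0 : 0 < S₀ := by positivity
  obtain ⟨K, hK, hKS⟩ : S₀ ∈ S '' Ioi 0 := by
    set K₁ := ((N : ℝ) - 1) / S₀ with hK₁
    have hK₁0 : 0 < K₁ := div_pos (by linarith) hS₀0
    set K₂ := max ((N + D + 1) * (ε / 2) + 1) ((N + 7) / S₀) with hK₂
    have hK₂l : (N + D + 1) * (ε / 2) < K₂ := lt_of_lt_of_le (by linarith) (le_max_left _ _)
    have hK₂0 : 0 < K₂ := lt_of_le_of_lt (by positivity) hK₂l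
    refine isPreconnected_Ioi.intermediate_value (a := K₂) (b := K₁) hK₂0 hK₁0 hcont ⟨?_, ?_⟩
    · refine (hup K₂ hK₂l).trans ?_
      rw [div_le_iff₀ hK₂0, ← div_le_iff₀' hS₀0]
      exact le_max_right _ _
    · refine le_trans (le_of_eq ?_) (hlow K₁ hK₁0)
      have : (N : ℝ) - 1 ≠ 0 := by linarith
      rw [hK₁]; field_simp
  have hK : 0 < K := hK
  refine ⟨K, hK, fun y hy => ?_⟩
  have h := tendsto_y (hx K hK) (P K hK) (hS K hK)
  have hval : √(ε * S K / 2) = σ⁻¹ := by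
    rw [hKS, hS₀, show ε * (2 / (ε * σ ^ 2)) / 2 = (σ⁻¹) ^ 2 by field_simp]
    exact Real.sqrt_sq (by positivity)
  rw [hval] at h
  refine h.congr' ?_
  filter_upwards [eventually_gt_atTop 0] with t ht
  rw [(hx K hK (t + 1)).eqOn (hy (t + 1)) (P K hK) t ⟨ht, by linarith⟩]

end RedSol

end WarpedSoliton

/-! ### Asymptotics at the collapsing sphere and the change of time. -/

namespace WarpedSoliton

lemma tendsto_id_nhdsGT_zero : Tendsto (fun t : ℝ => t) (𝓝[>] 0) (𝓝 0) :=
  tendsto_id.mono_left nhdsWithin_le_nhds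

namespace RedSol

variable {N : ℕ} {D ε K T : ℝ} {x : ℝ → Fin 5 → ℝ}

lemma lim_mul_mean (hx : RedSol N D ε K T x) (hT : 0 < T) :
    Tendsto (fun t => t * redMean N D (x t)) (𝓝[>] 0) (𝓝 N) := by
  have h1 := (hx.lim_f_div hT).inv₀ one_ne_zero
  have h2 := ((tendsto_id_nhdsGT_zero.mul hx.tendsto_err).add
    ((hx.lim_y.mul h1).const_mul (N : ℝ)))
  simp only [inv_one, mul_one, mul_zero, zero_add] at h2
  refine h2.congr fun t => ?_
  simp only [redMean, inv_div]
  ring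

lemma lim_Z (hx : RedSol N D ε K T x) : Tendsto (fun t => K + ε * x t 4) (𝓝[>] 0) (𝓝 K) := by
  simpa using (hx.lim_v.const_mul ε).const_add K

/-- Comparison of `p` with lines `a t`: the sum `(at - p)' + M (at - p)` equals `a + a tM - Z` and
tends to `a(N + 1) - K`, whose sign decides on which side of the line `p` stays. -/
lemma lim_p_div (hx : RedSol N D ε K T x) (P : Params N D ε K) (hT : 0 < T) :
    Tendsto (fun t => x t 2 / t) (𝓝[>] 0) (𝓝 (K / (N + 1))) := by
  have hN1 : (0 : ℝ) < N + 1 := by positivity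
  have hM := hx.lim_mul_mean hT
  have hlim : ∀ a, Tendsto (fun t => a + a * (t * redMean N D (x t)) - (K + ε * x t 4)) (𝓝[>] 0)
      (𝓝 (a + a * N - K)) := fun a => ((hM.const_mul a).const_add a).sub hx.lim_Z
  have hat : ∀ a, Tendsto (fun t => a * t - x t 2) (𝓝[>] 0) (𝓝 0) := fun a => by
    simpa using (tendsto_id_nhdsGT_zero.const_mul a).sub hx.lim_p
  have hder : ∀ a, ∀ t ∈ Ioo 0 T, HasDerivAt (fun t => a * t - x t 2)
      (a * 1 - (-redMean N D (x t) * x t 2 + (K + ε * x t 4))) t := fun a t ht =>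
    ((hasDerivAt_id t).const_mul a).sub (hx.deriv_p ht)
  refine tendsto_order.2 ⟨fun a ha => ?_, fun a ha => ?_⟩
  · have h1 : a + a * N - K < 0 := by
      rw [lt_div_iff₀ hN1] at ha; linarith
    obtain ⟨δ, hδ, hsub⟩ := mem_nhdsGT_iff_exists_Ioo_subset.1
      (((hlim a).eventually (gt_mem_nhds h1)).and (Ioo_mem_nhdsGT hT))
    have hδ : (0 : ℝ) < δ := hδ
    have key := pos_of_deriv_gt (T := δ) (M := fun t => redMean N D (x t))
      (fun t ht => (hder a t (hsub ht).2).neg) (fun t ht => (hx.pos_mean P (hsub ht).2).le)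
      (fun t ht => by
        have h2 : a + a * (t * redMean N D (x t)) - (K + ε * x t 4) < 0 := (hsub ht).1
        simp only [Pi.neg_apply]
        nlinarith) (by have := (hat a).neg; rwa [neg_zero] at this)
    filter_upwards [Ioo_mem_nhdsGT hδ] with t ht
    have := key t ht
    rw [lt_div_iff₀ ht.1]
    simp only [Pi.neg_apply] at this
    linarith
  · have h1 : 0 < a + a * N - K := by
      rw [gt_iff_lt, div_lt_iff₀ hN1] at ha; linarith
    obtain ⟨δ, hδ, hsub⟩ := mem_nhdsGT_iff_exists_Ioo_subset.1
      (((hlim a).eventually (lt_mem_nhds h1)).and (Ioo_mem_nhdsGT hT))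
    have hδ : (0 : ℝ) < δ := hδ
    have key := pos_of_deriv_gt (T := δ) (M := fun t => redMean N D (x t))
      (fun t ht => hder a t (hsub ht).2) (fun t ht => (hx.pos_mean P (hsub ht).2).le)
      (fun t ht => by
        have h2 : 0 < a + a * (t * redMean N D (x t)) - (K + ε * x t 4) := (hsub ht).1
        nlinarith) (hat a)
    filter_upwards [Ioo_mem_nhdsGT hδ] with t ht
    have := key t ht
    rw [div_lt_iff₀ ht.1]
    linarith

/-- Writing `Mp = (tM)(p/t)`, the limit is `-N K/(N + 1) + K`. This is the prescribed value of
`-u''` at `0`. -/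
lemma lim_deriv_p (hx : RedSol N D ε K T x) (P : Params N D ε K) (hT : 0 < T) :
    Tendsto (fun t => -redMean N D (x t) * x t 2 + (K + ε * x t 4)) (𝓝[>] 0)
      (𝓝 (K / (N + 1))) := by
  have h := ((hx.lim_mul_mean hT).mul (hx.lim_p_div P hT)).neg.add hx.lim_Z
  have hN1 : (N : ℝ) + 1 ≠ 0 := by positivity
  have e : -((N : ℝ) * (K / (N + 1))) + K = K / (N + 1) := by field_simp; ring
  rw [e] at h
  refine h.congr' ?_
  filter_upwards [self_mem_nhdsWithin] with t ht
  have ht0 : t ≠ 0 := (show (0 : ℝ) < t from ht).ne'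
  field_simp

/-- All terms of the first integral other than `K` are nonnegative. Used to see that the new time
reaches `+∞`. -/
lemma sqrt_le_mean (hx : RedSol N D ε K T x) (P : Params N D ε K) {t : ℝ} (ht : t ∈ Ioo 0 T) :
    √K ≤ redMean N D (x t) := by
  have hN := two_le P
  have hε := P.hε
  have hD := P.hD
  refine Real.sqrt_le_iff.2 ⟨(hx.pos_mean P ht).le, ?_⟩
  rw [hx.conservation P ht]
  have hv := mul_pos hε (hx.pos_v P ht)
  have e3 : 0 ≤ (N : ℝ) * (N - 1) / x t 0 ^ 2 :=
    div_nonneg (mul_nonneg (by linarith) (by linarith)) (sq_nonneg _)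
  have e4 : 0 ≤ (N + D - 1) * (ε / 2) := mul_nonneg (by linarith) (by linarith)
  have e1 : 0 ≤ (N : ℝ) * (x t 1 / x t 0) ^ 2 := by positivity
  have e2 : 0 ≤ D * x t 3 ^ 2 := by positivity
  linarith

/-- The logarithm of the common warping function of the remaining factors. -/
lemma exists_primitive (hx : ∀ T, RedSol N D ε K T x) :
    ∃ γ : ℝ → ℝ, (∀ t, 0 < t → HasDerivAt γ (x t 3) t) ∧ Tendsto γ (𝓝[>] 0) (𝓝 0) := by
  -- Extension by `0` is continuous since `h → 0`, so the integral from `0` is differentiable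
  -- everywhere.
  set h : ℝ → ℝ := fun t => if t ≤ 0 then 0 else x t 3 with hh
  have hpos : ∀ t, 0 < t → h =ᶠ[𝓝 t] fun t => x t 3 := fun t ht => by
    filter_upwards [lt_mem_nhds ht] with s hs
    exact if_neg (not_le.2 hs)
  have hcont : Continuous h := by
    refine continuous_iff_continuousAt.2 fun t => ?_
    rcases lt_trichotomy t 0 with ht | rfl | ht
    · have : h =ᶠ[𝓝 t] fun _ => 0 := by
        filter_upwards [gt_mem_nhds ht] with s hs
        exact if_pos (le_of_lt hs)
      exact continuousAt_const.congr this.symm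
    · refine continuousAt_iff_continuous_left'_right'.2 ⟨?_, ?_⟩
      · refine (continuousWithinAt_const (b := (0 : ℝ))).congr (fun s hs => ?_) ?_
        · exact if_pos (le_of_lt hs)
        · simp [hh]
      · have h0 : h 0 = 0 := by simp [hh]
        rw [ContinuousWithinAt, h0]
        refine (hx 1).lim_h.congr' ?_
        filter_upwards [self_mem_nhdsWithin] with s hs
        exact (if_neg (not_le.2 hs)).symm
    · exact (((hx (t + 1)).deriv_h ⟨ht, by linarith⟩).continuousAt).congr (hpos t ht).symm
  have hd : ∀ t, HasDerivAt (fun t => ∫ r in (0 : ℝ)..t, h r) (h t) t := fun t =>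
    intervalIntegral.integral_hasDerivAt_right (hcont.intervalIntegrable _ _)
      (hcont.stronglyMeasurableAtFilter _ _) hcont.continuousAt
  refine ⟨fun t => ∫ r in (0 : ℝ)..t, h r, fun t ht => ?_, ?_⟩
  · exact (hd t).congr_deriv (hpos t ht).self_of_nhds
  · have := (hd 0).continuousAt.tendsto.mono_left (nhdsWithin_le_nhds (s := Ioi 0))
    simpa using this

end RedSol

/-- A change of time `dt/ds = 1 / M(t)` from the line onto `(0, ∞)`. -/
lemma exists_time_change {M : ℝ → ℝ} (hM : ContinuousOn M (Ioi 0)) (hpos : ∀ t, 0 < t → 0 < M t)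
    {c : ℝ} (hc : 0 < c) (h0 : ∀ᶠ t in 𝓝[>] 0, c ≤ t * M t) (hinf : ∀ᶠ t in atTop, c ≤ t * M t) :
    ∃ τ : ℝ → ℝ, (∀ s, 0 < τ s) ∧ Tendsto τ atBot (𝓝 0) ∧ Tendsto τ atTop atTop ∧
      ∀ s, HasDerivAt τ (1 / M (τ s)) s := by
  -- In logarithmic time `t = exp r`, `ds = M dt` becomes `ds = g dr` on the whole line. The bound
  -- `g ≥ c` near both ends makes `φ` onto, and `τ = exp ∘ φ⁻¹`.
  set g : ℝ → ℝ := fun r => Real.exp r * M (Real.exp r) with hg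
  have gpos : ∀ r, 0 < g r := fun r => mul_pos (Real.exp_pos r) (hpos _ (Real.exp_pos r))
  have gcont : Continuous g := Real.continuous_exp.mul
    (hM.comp_continuous Real.continuous_exp fun r => Real.exp_pos r)
  set φ : ℝ → ℝ := fun y => ∫ r in (0 : ℝ)..y, g r with hφ
  have dφ : ∀ y, HasDerivAt φ (g y) y := fun y =>
    intervalIntegral.integral_hasDerivAt_right (gcont.intervalIntegrable _ _)
      (gcont.stronglyMeasurableAtFilter _ _) gcont.continuousAt
  have mono : StrictMono φ := strictMono_of_deriv_pos fun y => by rw [(dφ y).deriv]; exact gpos y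
  have cφ : Continuous φ := continuous_iff_continuousAt.2 fun y => (dφ y).continuousAt
  have step : ∀ a b, a ≤ b → (∀ r ∈ Ioo a b, c ≤ g r) → φ a + c * (b - a) ≤ φ b := by
    intro a b hab h
    have := le_of_deriv_nonneg_Icc (g := fun y => φ y - c * y) hab
      (fun t _ => (dφ t).sub ((hasDerivAt_id t).const_mul c))
      (fun t ht => by have := h t ht; linarith)
    linarith
  have top : Tendsto φ atTop atTop := by
    obtain ⟨a, ha⟩ := eventually_atTop.1 (Real.tendsto_exp_atTop.eventually hinf)
    have : Tendsto (fun y => φ a + c * (y - a)) atTop atTop :=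
      tendsto_atTop_add_const_left _ _
        ((tendsto_atTop_add_const_right _ (-a) tendsto_id).const_mul_atTop hc)
    refine tendsto_atTop_mono' atTop ?_ this
    filter_upwards [eventually_ge_atTop a] with y hy
    exact step a y hy fun r hr => ha r hr.1.le
  have bot : Tendsto φ atBot atBot := by
    obtain ⟨a, ha⟩ := eventually_atBot.1 (Real.tendsto_exp_atBot_nhdsGT.eventually h0)
    have : Tendsto (fun y => φ a + c * (y - a)) atBot atBot :=
      tendsto_atBot_add_const_left _ _
        ((tendsto_atBot_add_const_right _ (-a) tendsto_id).const_mul_atBot hc)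
    refine tendsto_atBot_mono' atBot ?_ this
    filter_upwards [eventually_le_atBot a] with y hy
    have := step y a hy fun r hr => ha r hr.2.le
    linarith
  set e := mono.orderIsoOfSurjective φ (cφ.surjective top bot) with he
  have hee : ∀ s, φ (e.symm s) = s := fun s => e.apply_symm_apply s
  have dψ : ∀ s, HasDerivAt e.symm (g (e.symm s))⁻¹ s := fun s =>
    HasDerivAt.of_local_left_inverse e.symm.continuous.continuousAt (dφ _) (gpos _).ne'
      (Eventually.of_forall hee)
  refine ⟨fun s => Real.exp (e.symm s), fun s => Real.exp_pos _,
    Real.tendsto_exp_atBot.comp e.symm.tendsto_atBot,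
    Real.tendsto_exp_atTop.comp e.symm.tendsto_atTop, fun s => ?_⟩
  refine (dψ s).exp.congr_deriv ?_
  have h1 := (Real.exp_pos (e.symm s)).ne'
  have h2 := (hpos _ (Real.exp_pos (e.symm s))).ne'
  simp only [hg]
  field_simp

end WarpedSoliton

namespace WarpedSoliton

/-! ### From solitons to the reduced system -/

/-- The assumptions on the dimensions and the Einstein constants. -/
structure Setting (m : ℕ) (d : Fin (m + 1) → ℕ) (μ : Fin (m + 1) → ℝ) (ε : ℝ) : Prop where
  hm : 1 ≤ m
  hd0 : 2 ≤ d 0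
  hd : ∀ i, 1 ≤ d i
  hμ0 : μ 0 = (d 0 : ℝ) - 1
  hμ : ∀ i : Fin m, μ i.succ = 0
  hε : 0 < ε

/-- The dimension of the product of the Ricci flat factors. -/
noncomputable def flatDim {m : ℕ} (d : Fin (m + 1) → ℕ) : ℝ := ∑ i : Fin m, (d i.succ : ℝ)

/-- The state of the reduced system given by a soliton. -/
noncomputable def reduce {m : ℕ} (d : Fin (m + 1) → ℕ) (f : Fin (m + 1) → ℝ → ℝ) (u : ℝ → ℝ)
    (t : ℝ) : Fin 5 → ℝ :=
  ![f 0 t, deriv (f 0) t, -deriv u t,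
    (∑ i : Fin m, (d i.succ : ℝ) * shape f i.succ t) / flatDim d, -u t]

variable {m : ℕ} {d : Fin (m + 1) → ℕ} {μ : Fin (m + 1) → ℝ} {ε : ℝ}
  {f : Fin (m + 1) → ℝ → ℝ} {u : ℝ → ℝ}

namespace Setting

lemma flatDim_pos (A : Setting m d μ ε) : 0 < flatDim d := by
  have : Nonempty (Fin m) := ⟨⟨0, A.hm⟩⟩
  exact Finset.sum_pos (fun i _ => by exact_mod_cast A.hd i.succ) Finset.univ_nonempty

lemma params (A : Setting m d μ ε) {K : ℝ} (hK : 0 < K) : Params (d 0) (flatDim d) ε K :=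
  ⟨A.hd0, A.flatDim_pos.le, A.hε, hK⟩

lemma sum_mu (A : Setting m d μ ε) (g : Fin (m + 1) → ℝ) :
    ∑ i, (d i : ℝ) * μ i * g i = d 0 * (d 0 - 1) * g 0 := by
  rw [Fin.sum_univ_succ, Finset.sum_eq_zero, A.hμ0, add_zero]
  intro i _
  rw [A.hμ i]; ring

end Setting

lemma sum_dim (d : Fin (m + 1) → ℕ) : ∑ i, (d i : ℝ) = d 0 + flatDim d := by
  rw [Fin.sum_univ_succ]; rfl

lemma genMean_eq_redMean (A : Setting m d μ ε) (t : ℝ) :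
    genMean d f u t = redMean (d 0) (flatDim d) (reduce d f u t) := by
  have := A.flatDim_pos.ne'
  simp [genMean, trShape, redMean, reduce, Fin.sum_univ_succ, shape]
  field_simp
  ring

namespace IsSoliton

lemma deriv_warp (h : IsSoliton d μ ε f u) (i : Fin (m + 1)) {t : ℝ} (ht : 0 < t) :
    HasDerivAt (f i) (deriv (f i) t) t :=
  (((contDiffOn_infty_iff_deriv_of_isOpen isOpen_Ioi).1 (h.smooth_f i)).1.differentiableAt
    (Ioi_mem_nhds ht)).hasDerivAt

lemma deriv_deriv_warp (h : IsSoliton d μ ε f u) (i : Fin (m + 1)) {t : ℝ} (ht : 0 < t) :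
    HasDerivAt (deriv (f i)) (deriv (deriv (f i)) t) t :=
  (((contDiffOn_infty_iff_deriv_of_isOpen isOpen_Ioi).1 ((contDiffOn_infty_iff_deriv_of_isOpen
    isOpen_Ioi).1 (h.smooth_f i)).2).1.differentiableAt (Ioi_mem_nhds ht)).hasDerivAt

lemma deriv_pot (h : IsSoliton d μ ε f u) {t : ℝ} (ht : 0 < t) :
    HasDerivAt u (deriv u t) t :=
  (((contDiffOn_infty_iff_deriv_of_isOpen isOpen_Ioi).1 h.smooth_u).1.differentiableAt
    (Ioi_mem_nhds ht)).hasDerivAt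

lemma deriv_deriv_pot (h : IsSoliton d μ ε f u) {t : ℝ} (ht : 0 < t) :
    HasDerivAt (deriv u) (deriv (deriv u) t) t :=
  (((contDiffOn_infty_iff_deriv_of_isOpen isOpen_Ioi).1 ((contDiffOn_infty_iff_deriv_of_isOpen
    isOpen_Ioi).1 h.smooth_u).2).1.differentiableAt (Ioi_mem_nhds ht)).hasDerivAt

lemma deriv_shape (h : IsSoliton d μ ε f u) (i : Fin (m + 1)) {t : ℝ} (ht : 0 < t) :
    HasDerivAt (shape f i) (-genMean d f u t * shape f i t + μ i / f i t ^ 2 + ε / 2) t := by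
  rw [← h.eq_shape i t ht]
  exact ((h.deriv_deriv_warp i ht).div (h.deriv_warp i ht)
    (h.pos i t ht).ne').differentiableAt.hasDerivAt

lemma deriv_trShape (h : IsSoliton d μ ε f u) (A : Setting m d μ ε) {t : ℝ} (ht : 0 < t) :
    HasDerivAt (trShape d f) (-genMean d f u t * trShape d f t + d 0 * (d 0 - 1) / f 0 t ^ 2
      + (d 0 + flatDim d) * (ε / 2)) t := by
  have h1 : HasDerivAt (trShape d f) (∑ i, (d i : ℝ) * (-genMean d f u t * shape f i t
      + μ i / f i t ^ 2 + ε / 2)) t :=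
    HasDerivAt.fun_sum fun i _ => (h.deriv_shape i ht).const_mul (d i : ℝ)
  refine h1.congr_deriv ?_
  have h2 := A.sum_mu fun i => (f i t ^ 2)⁻¹
  have e : (d 0 : ℝ) * (d 0 - 1) / f 0 t ^ 2 = d 0 * (d 0 - 1) * (f 0 t ^ 2)⁻¹ :=
    div_eq_mul_inv _ _
  rw [e, ← h2, ← sum_dim, Finset.sum_mul, trShape, Finset.mul_sum,
    ← Finset.sum_add_distrib, ← Finset.sum_add_distrib]
  exact Finset.sum_congr rfl fun i _ => by ring

lemma deriv_trShapeSq (h : IsSoliton d μ ε f u) (A : Setting m d μ ε) {t : ℝ} (ht : 0 < t) :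
    HasDerivAt (trShapeSq d f) (-2 * genMean d f u t * trShapeSq d f t
      + 2 * (d 0 * (d 0 - 1) * (shape f 0 t / f 0 t ^ 2)) + ε * trShape d f t) t := by
  have h1 : HasDerivAt (trShapeSq d f) (∑ i, (d i : ℝ) * (2 * shape f i t *
      (-genMean d f u t * shape f i t + μ i / f i t ^ 2 + ε / 2))) t :=
    HasDerivAt.fun_sum fun i _ => by
      simpa using ((h.deriv_shape i ht).pow 2).const_mul (d i : ℝ)
  refine h1.congr_deriv ?_
  have h2 := A.sum_mu fun i => shape f i t / f i t ^ 2
  rw [← h2, trShape, trShapeSq, Finset.mul_sum, Finset.mul_sum, Finset.mul_sum,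
    ← Finset.sum_add_distrib, ← Finset.sum_add_distrib]
  exact Finset.sum_congr rfl fun i _ => by ring

lemma deriv_genMean (h : IsSoliton d μ ε f u) (A : Setting m d μ ε) {t : ℝ} (ht : 0 < t) :
    HasDerivAt (genMean d f u) (-trShapeSq d f t + ε / 2) t := by
  rw [← h.eq_mean t ht]
  exact ((h.deriv_deriv_pot ht).neg.add (h.deriv_trShape A ht)).differentiableAt.hasDerivAt

lemma deriv_two_pot (h : IsSoliton d μ ε f u) (A : Setting m d μ ε) {t : ℝ} (ht : 0 < t) :
    -deriv (deriv u) t = -trShapeSq d f t + ε / 2 - (-genMean d f u t * trShape d f t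
      + d 0 * (d 0 - 1) / f 0 t ^ 2 + (d 0 + flatDim d) * (ε / 2)) := by
  have h1 := (h.deriv_deriv_pot ht).neg.add (h.deriv_trShape A ht)
  have := (h.deriv_genMean A ht).unique h1
  linarith

/-- The quantity conserved by the soliton equation. -/
lemma exists_conserved (h : IsSoliton d μ ε f u) (A : Setting m d μ ε) :
    ∃ c, ∀ t, 0 < t → genMean d f u t ^ 2 - trShapeSq d f t - d 0 * (d 0 - 1) / f 0 t ^ 2
      - (d 0 + flatDim d - 1) * (ε / 2) + ε * u t = c := by
  set G : ℝ → ℝ := fun t => genMean d f u t ^ 2 - trShapeSq d f t - d 0 * (d 0 - 1) / f 0 t ^ 2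
      - (d 0 + flatDim d - 1) * (ε / 2) + ε * u t with hG
  have hd : ∀ t ∈ Ioi (0 : ℝ), HasDerivAt G 0 t := by
    intro t ht
    have hf := (h.pos 0 t ht).ne'
    have h1 := ((((((h.deriv_genMean A ht).pow 2).sub (h.deriv_trShapeSq A ht)).sub
      ((((hasDerivAt_const t ((d 0 : ℝ) * (d 0 - 1))).div ((h.deriv_warp 0 ht).pow 2)
        (pow_ne_zero 2 hf)))))).sub_const ((d 0 + flatDim d - 1) * (ε / 2))).add
        ((h.deriv_pot ht).const_mul ε)
    refine h1.congr_deriv ?_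
    have h2 : trShape d f t = genMean d f u t + deriv u t := by simp [genMean]
    rw [h2]
    simp only [shape, Pi.pow_apply]
    field_simp
    ring
  refine ⟨G 1, fun t ht => ?_⟩
  exact IsOpen.is_const_of_deriv_eq_zero isOpen_Ioi isPreconnected_Ioi
    (fun s hs => (hd s hs).differentiableAt.differentiableWithinAt)
    (fun s hs => (hd s hs).deriv) ht (mem_Ioi.2 one_pos)

end IsSoliton

section InitialData

variable {fbar : Fin m → ℝ} {C : ℝ}

lemma HasInitialData.shape_succ (hi : HasInitialData d fbar C f u) (hfbar : ∀ i, 0 < fbar i)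
    (i : Fin m) : Tendsto (shape f i.succ) (𝓝[>] 0) (𝓝 0) := by
  have := (hi.factor_deriv i).div (hi.factor i) (hfbar i).ne'
  rwa [zero_div] at this

lemma HasInitialData.warp_div (hi : HasInitialData d fbar C f u) (h : IsSoliton d μ ε f u) :
    Tendsto (fun t => f 0 t / t) (𝓝[>] 0) (𝓝 1) :=
  HasDerivAt.lhopital_zero_nhdsGT (f := f 0) (f' := deriv (f 0)) (g := fun t => t)
    (g' := fun _ => 1) (l := 𝓝 1) (a := 0)
    (eventually_nhdsWithin_of_forall fun t ht => h.deriv_warp 0 ht)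
    (Eventually.of_forall fun t => hasDerivAt_id t) (Eventually.of_forall fun _ => one_ne_zero)
    hi.sphere tendsto_id_nhdsGT_zero (by simpa using hi.sphere_deriv)

lemma HasInitialData.deriv_pot_div (hi : HasInitialData d fbar C f u) (h : IsSoliton d μ ε f u) :
    Tendsto (fun t => deriv u t / t) (𝓝[>] 0) (𝓝 (C / (d 0 + 1))) :=
  HasDerivAt.lhopital_zero_nhdsGT (f := deriv u) (f' := deriv (deriv u)) (g := fun t => t)
    (g' := fun _ => 1) (a := 0)
    (eventually_nhdsWithin_of_forall fun t ht => h.deriv_deriv_pot ht)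
    (Eventually.of_forall fun t => hasDerivAt_id t) (Eventually.of_forall fun _ => one_ne_zero)
    hi.potential_deriv tendsto_id_nhdsGT_zero (by simpa using hi.potential_deriv_two)

lemma HasInitialData.mul_shape_zero (hi : HasInitialData d fbar C f u)
    (h : IsSoliton d μ ε f u) : Tendsto (fun t => t * shape f 0 t) (𝓝[>] 0) (𝓝 1) := by
  have := hi.sphere_deriv.mul ((hi.warp_div h).inv₀ one_ne_zero)
  rw [inv_one, mul_one] at this
  refine this.congr fun t => ?_
  simp only [shape, inv_div]
  ring

lemma HasInitialData.mul_genMean (hi : HasInitialData d fbar C f u) (hfbar : ∀ i, 0 < fbar i)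
    (h : IsSoliton d μ ε f u) : Tendsto (fun t => t * genMean d f u t) (𝓝[>] 0) (𝓝 (d 0)) := by
  have h1 : Tendsto (fun t => ∑ i : Fin m, (d i.succ : ℝ) * shape f i.succ t) (𝓝[>] 0)
      (𝓝 (∑ i : Fin m, (d i.succ : ℝ) * 0)) :=
    tendsto_finsetSum _ fun i _ => (hi.shape_succ hfbar i).const_mul _
  have h2 := ((tendsto_id_nhdsGT_zero.mul (hi.potential_deriv.neg)).add
    ((hi.mul_shape_zero h).const_mul (d 0 : ℝ))).add (tendsto_id_nhdsGT_zero.mul h1)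
  simp only [mul_zero, Finset.sum_const_zero, zero_add, mul_one, add_zero,
    neg_zero] at h2
  refine h2.congr fun t => ?_
  simp only [genMean, trShape, Fin.sum_univ_succ]
  ring

/-- The conserved quantity is determined by the initial data. -/
lemma HasInitialData.conserved (hi : HasInitialData d fbar C f u) (hfbar : ∀ i, 0 < fbar i)
    (h : IsSoliton d μ ε f u) (A : Setting m d μ ε) {t : ℝ} (ht : 0 < t) :
    genMean d f u t ^ 2 = trShapeSq d f t + d 0 * (d 0 - 1) / f 0 t ^ 2
      + (d 0 + flatDim d - 1) * (ε / 2) + (-C - ε * u t) := by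
  obtain ⟨c, hc⟩ := h.exists_conserved A
  -- By the two soliton equations the conserved quantity equals `-u'' - M u' + εu`. Its limit
  -- follows from `tM → d 0` and `u'/t → C/(d 0 + 1)`, the latter two multiplied together.
  have h1 := (hi.potential_deriv_two.neg.add ((hi.mul_genMean hfbar h).mul
    (hi.deriv_pot_div h).neg)).add (hi.potential.const_mul ε)
  have hN : (d 0 : ℝ) + 1 ≠ 0 := by positivity
  have e : -(C / ((d 0 : ℝ) + 1)) + d 0 * -(C / (d 0 + 1)) + ε * 0 = -C := by field_simp; ring
  rw [e] at h1
  have h2 : Tendsto (fun _ : ℝ => c) (𝓝[>] 0) (𝓝 (-C)) := by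
    refine h1.congr' ?_
    filter_upwards [self_mem_nhdsWithin] with s hs
    have hs : (0 : ℝ) < s := hs
    have hs0 := hs.ne'
    rw [h.deriv_two_pot A hs, ← hc s hs]
    have h3 : trShape d f s = genMean d f u s + deriv u s := by simp [genMean]
    rw [h3]
    field_simp
    ring
  have := tendsto_nhds_unique h2 tendsto_const_nhds
  have := hc t ht
  linarith

/-- A soliton with initial data `(fbar, C)` solves the reduced system. -/
theorem redSol_reduce (A : Setting m d μ ε) (hi : HasInitialData d fbar C f u)
    (hfbar : ∀ i, 0 < fbar i) (h : IsSoliton d μ ε f u) (T : ℝ) :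
    RedSol (d 0) (flatDim d) ε (-C) T (reduce d f u) := by
  have hD := A.flatDim_pos.ne'
  refine ⟨fun t ht => ?_, fun t ht => h.pos 0 t ht.1, ?_⟩
  · have ht := ht.1
    have hf := (h.pos 0 t ht).ne'
    refine hasDerivAt_pi.2 fun i => ?_
    fin_cases i
    · simpa [redField, reduce] using h.deriv_warp 0 ht
    -- The second derivative of `f 0` is read off from `f' = ℓ f`, since the equation is given for
    -- `ℓ`.
    · have h1 : HasDerivAt (fun t => shape f 0 t * f 0 t) _ t :=
        (h.deriv_shape 0 ht).mul (h.deriv_warp 0 ht)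
      have h2 : (fun t => shape f 0 t * f 0 t) =ᶠ[𝓝 t] deriv (f 0) := by
        filter_upwards [lt_mem_nhds ht] with s hs
        exact div_mul_cancel₀ _ (h.pos 0 s hs).ne'
      have h3 := (h1.congr_of_eventuallyEq h2.symm)
      simp only [Fin.mk_one]
      refine HasDerivAt.congr_deriv (f := fun t => reduce d f u t 1)
        (f' := _) (by simpa [reduce] using h3) ?_
      rw [genMean_eq_redMean A, A.hμ0]
      simp [redField, reduce, redMean, shape]
      field_simp
      ring
    · have h1 := (h.deriv_deriv_pot ht).neg
      refine HasDerivAt.congr_deriv (f := fun t => reduce d f u t 2) h1 ?_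
      rw [h.deriv_two_pot A ht]
      have h2 := hi.conserved hfbar h A ht
      have h3 : trShape d f t = genMean d f u t + deriv u t := by simp [genMean]
      rw [h3]
      simp only [redField, Fin.reduceFinMk, Matrix.cons_val]
      rw [← genMean_eq_redMean A]
      simp only [reduce, Matrix.cons_val]
      linarith
    -- As `μ i = 0`, the equations for the flat factors are linear with the same coefficients, so
    -- their weighted mean solves the same equation; equality of the individual terms is not needed.
    · have h1 : HasDerivAt (fun t => (∑ i : Fin m, (d i.succ : ℝ) * shape f i.succ t) / flatDim d)
          _ t :=
        (HasDerivAt.fun_sum fun i _ => (h.deriv_shape i.succ ht).const_mul (d i.succ : ℝ)).div_const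
          (flatDim d)
      refine HasDerivAt.congr_deriv (f := fun t => reduce d f u t 3) h1 ?_
      simp only [redField, Fin.reduceFinMk, Matrix.cons_val]
      rw [← genMean_eq_redMean A]
      simp only [reduce, Matrix.cons_val]
      have h2 : ∑ i : Fin m, (d i.succ : ℝ) * (-genMean d f u t * shape f i.succ t
          + μ i.succ / f i.succ t ^ 2 + ε / 2)
          = -genMean d f u t * (∑ i : Fin m, (d i.succ : ℝ) * shape f i.succ t)
            + flatDim d * (ε / 2) := by
        rw [flatDim, Finset.mul_sum, Finset.sum_mul, ← Finset.sum_add_distrib]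
        refine Finset.sum_congr rfl fun i _ => ?_
        rw [A.hμ i]; ring
      rw [h2]
      field_simp
    · exact HasDerivAt.congr_deriv (f := fun t => reduce d f u t 4) (h.deriv_pot ht).neg
        (by simp [redField, reduce])
  · refine tendsto_pi_nhds.2 fun i => ?_
    fin_cases i
    · simpa [reduce] using hi.sphere
    · simpa [reduce] using hi.sphere_deriv
    · simpa [reduce] using hi.potential_deriv.neg
    · have h1 : Tendsto (fun t => (∑ i : Fin m, (d i.succ : ℝ) * shape f i.succ t) / flatDim d)
          (𝓝[>] 0) (𝓝 ((∑ i : Fin m, (d i.succ : ℝ) * 0) / flatDim d)) :=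
        (tendsto_finsetSum _ fun i _ => (hi.shape_succ hfbar i).const_mul _).div_const _
      simpa [reduce] using h1
    · simpa [reduce] using hi.potential.neg

end InitialData

end WarpedSoliton

namespace WarpedSoliton

variable {m : ℕ} {d : Fin (m + 1) → ℕ} {μ : Fin (m + 1) → ℝ} {ε : ℝ}
  {f : Fin (m + 1) → ℝ → ℝ} {u : ℝ → ℝ} {fbar : Fin m → ℝ} {C : ℝ}

/-! ### Regularity of the trajectories -/

lemma HasInitialData.genMean_pos (hi : HasInitialData d fbar C f u) (A : Setting m d μ ε)
    (hfbar : ∀ i, 0 < fbar i) (hC : C < 0) (h : IsSoliton d μ ε f u) {t : ℝ} (ht : 0 < t) :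
    0 < genMean d f u t := by
  rw [genMean_eq_redMean A]
  exact (redSol_reduce A hi hfbar h (t + 1)).pos_mean (A.params (neg_pos.2 hC))
    ⟨ht, lt_add_one t⟩

/-- The reduced system sees only the mean over the flat factors, so positivity of each one is
derived from its own linear equation. -/
lemma HasInitialData.shape_pos (hi : HasInitialData d fbar C f u) (A : Setting m d μ ε)
    (hfbar : ∀ i, 0 < fbar i) (hC : C < 0) (h : IsSoliton d μ ε f u) (i : Fin (m + 1)) {t : ℝ}
    (ht : 0 < t) : 0 < shape f i t := by
  have P := A.params (neg_pos.2 hC)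
  have ht1 : t ∈ Ioo 0 (t + 1) := ⟨ht, lt_add_one t⟩
  refine Fin.cases ?_ (fun i => ?_) i
  · exact div_pos ((redSol_reduce A hi hfbar h (t + 1)).pos_y P ht1) (h.pos 0 t ht)
  · refine pos_of_deriv_gt (M := fun t => genMean d f u t)
      (fun s hs => h.deriv_shape i.succ hs.1)
      (fun s hs => (hi.genMean_pos A hfbar hC h hs.1).le) (fun s hs => ?_)
      (hi.shape_succ hfbar i) t ht1
    rw [A.hμ i, zero_div]
    linarith [A.hε]

variable {Λ : ℝ → ℝ} {X Y : Fin (m + 1) → ℝ → ℝ}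

/-- The curve induced by a soliton solves the rescaled equations. -/
lemma IsSoliton.isTrajectory (h : IsSoliton d μ ε f u) (A : Setting m d μ ε)
    (hM : ∀ t, 0 < t → 0 < genMean d f u t) (hI : Induces d f u Λ X Y) :
    IsTrajectory d μ ε Λ X Y := by
  obtain ⟨τ, hτ, -, -, dτ, hΛ, hX, hY⟩ := hI
  have hΛM : ∀ s, Λ s * genMean d f u (τ s) = 1 := fun s => by
    rw [hΛ, one_div, inv_mul_cancel₀ (hM _ (hτ s)).ne']
  have hsum : ∀ s, ∑ j, (d j : ℝ) * X j s ^ 2 = Λ s ^ 2 * trShapeSq d f (τ s) := fun s => by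
    rw [trShapeSq, Finset.mul_sum]
    exact Finset.sum_congr rfl fun i _ => by rw [hX]; ring
  have dΛ : ∀ s, HasDerivAt Λ (Λ s ^ 3 * (trShapeSq d f (τ s) - ε / 2)) s := fun s => by
    have h0 := (hM _ (hτ s)).ne'
    have h1 : HasDerivAt (fun s => (genMean d f u (τ s))⁻¹) _ s :=
      ((h.deriv_genMean A (hτ s)).comp s (dτ s)).inv h0
    have e : Λ = fun s => (genMean d f u (τ s))⁻¹ := funext fun s => by rw [hΛ, one_div]
    rw [← e] at h1
    refine h1.congr_deriv ?_
    simp only [Function.comp]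
    rw [hΛ s]
    field_simp
    ring
  refine ⟨fun s => (dΛ s).congr_deriv ?_, fun i s => ?_, fun i s => ?_⟩
  · rw [hsum]; ring
  · have h1 : HasDerivAt (fun s => Λ s * shape f i (τ s)) _ s :=
      (dΛ s).mul ((h.deriv_shape i (hτ s)).comp s (dτ s))
    have e : X i = fun s => Λ s * shape f i (τ s) := funext fun s => hX i s
    rw [← e] at h1
    refine h1.congr_deriv ?_
    rw [hsum, hX, hY]
    linear_combination (-Λ s * shape f i (τ s)) * hΛM s
  · have hf := (h.pos i _ (hτ s)).ne'
    have h1 : HasDerivAt (fun s => Λ s / f i (τ s)) _ s :=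
      (dΛ s).div ((h.deriv_warp i (hτ s)).comp s (dτ s)) hf
    have e : Y i = fun s => Λ s / f i (τ s) := funext fun s => hY i s
    rw [← e] at h1
    refine h1.congr_deriv ?_
    rw [hsum, hX, hY, shape]
    field_simp

/-- Multiplying the first integral by `Λ²` gives `S₁ = -Λ² (-C - εu)`, negative because `u < 0`.
Likewise `S₂ = Λ u'`, and `u' < 0`. The limits as `s → -∞` follow from `t M → d 0`, `t ℓ₀ → 1` and
`f₀/t → 1`. -/
theorem HasInitialData.isRegular (hi : HasInitialData d fbar C f u) (A : Setting m d μ ε)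
    (hfbar : ∀ i, 0 < fbar i) (hC : C < 0) (h : IsSoliton d μ ε f u)
    (hI : Induces d f u Λ X Y) : IsRegular d μ ε Λ X Y := by
  have hM : ∀ t, 0 < t → 0 < genMean d f u t := fun t ht => hi.genMean_pos A hfbar hC h ht
  have htraj := h.isTrajectory A hM hI
  obtain ⟨τ, hτ, τbot, -, -, hΛ, hX, hY⟩ := hI
  have hN : (d 0 : ℝ) ≠ 0 := by have := A.hd0; positivity
  have hτ0 : Tendsto τ atBot (𝓝[>] 0) := tendsto_nhdsWithin_iff.2 ⟨τbot, Eventually.of_forall hτ⟩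
  have eΛ : Λ = fun s => 1 / genMean d f u (τ s) := funext hΛ
  have pΛ : ∀ s, 0 < Λ s := fun s => by rw [hΛ]; exact one_div_pos.2 (hM _ (hτ s))
  -- the rescaled factor `1 / (t M)` tends to `1 / d 0`
  have hq : Tendsto (fun t => (t * genMean d f u t)⁻¹) (𝓝[>] 0) (𝓝 (d 0 : ℝ)⁻¹) :=
    (hi.mul_genMean hfbar h).inv₀ hN
  have lΛ : Tendsto (fun t => 1 / genMean d f u t) (𝓝[>] 0) (𝓝 0) := by
    have h1 := tendsto_id_nhdsGT_zero.mul hq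
    rw [zero_mul] at h1
    refine h1.congr' ?_
    filter_upwards [self_mem_nhdsWithin] with t ht
    have ht : t ≠ 0 := (show (0 : ℝ) < t from ht).ne'
    field_simp
  have limΛ : Tendsto Λ atBot (𝓝 0) := by rw [eΛ]; exact lΛ.comp hτ0
  refine ⟨htraj, limΛ, ?_, ?_, fun i => ?_, fun i => ?_, pΛ, fun i s => ?_, fun i s => ?_,
    fun s => ?_, fun s => ?_⟩
  · have h1 := hq.mul (hi.mul_shape_zero h)
    rw [mul_one, ← one_div] at h1
    refine (h1.comp hτ0).congr fun s => ?_
    have := (hτ s).ne'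
    rw [hX, hΛ]
    simp only [Function.comp]
    field_simp
  · have h1 := hq.mul ((hi.warp_div h).inv₀ one_ne_zero)
    rw [inv_one, mul_one, ← one_div] at h1
    refine (h1.comp hτ0).congr fun s => ?_
    have := (hτ s).ne'
    rw [hY, hΛ]
    simp only [Function.comp]
    field_simp
  · have h1 := limΛ.mul ((hi.shape_succ hfbar i).comp hτ0)
    rw [mul_zero] at h1
    exact h1.congr fun s => (hX _ s).symm
  · have h1 := limΛ.div ((hi.factor i).comp hτ0) (hfbar i).ne'
    rw [zero_div] at h1
    exact h1.congr fun s => (hY _ s).symm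
  · rw [hX]
    exact mul_pos (pΛ s) (hi.shape_pos A hfbar hC h i (hτ s))
  · rw [hY]
    exact div_pos (pΛ s) (h.pos i _ (hτ s))
  · have h1 : ∑ j, (d j : ℝ) * X j s ^ 2 = Λ s ^ 2 * trShapeSq d f (τ s) := by
      rw [trShapeSq, Finset.mul_sum]
      exact Finset.sum_congr rfl fun i _ => by rw [hX]; ring
    have h2 : Λ s * genMean d f u (τ s) = 1 := by
      rw [hΛ, one_div, inv_mul_cancel₀ (hM _ (hτ s)).ne']
    have h3 : Λ s ^ 2 * genMean d f u (τ s) ^ 2 = 1 := by rw [← mul_pow, h2, one_pow]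
    rw [hi.conserved hfbar h A (hτ s)] at h3
    have hv := (redSol_reduce A hi hfbar h (τ s + 1)).pos_v (A.params (neg_pos.2 hC))
      ⟨hτ s, lt_add_one _⟩
    have hv : 0 < -u (τ s) := hv
    have h4 : 0 < Λ s ^ 2 * (-C - ε * u (τ s)) :=
      mul_pos (pow_pos (pΛ s) 2) (by nlinarith [A.hε])
    rw [S1, h1, A.sum_mu fun i => Y i s ^ 2, sum_dim, hY, div_pow]
    linear_combination h4 + h3
  · have h1 : ∑ j, (d j : ℝ) * X j s = Λ s * trShape d f (τ s) := by
      rw [trShape, Finset.mul_sum]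
      exact Finset.sum_congr rfl fun i _ => by rw [hX]; ring
    have h2 : Λ s * genMean d f u (τ s) = 1 := by
      rw [hΛ, one_div, inv_mul_cancel₀ (hM _ (hτ s)).ne']
    have hp := (redSol_reduce A hi hfbar h (τ s + 1)).pos_p (A.params (neg_pos.2 hC))
      ⟨hτ s, lt_add_one _⟩
    have hp : 0 < -deriv u (τ s) := hp
    have h3 : trShape d f (τ s) = genMean d f u (τ s) + deriv u (τ s) := by simp [genMean]
    rw [S2, h1, h3]
    nlinarith [mul_pos (pΛ s) hp]

/-- The ratio `X 0 / Y 0` is `deriv (f 0)` in the new time. -/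
lemma Induces.tendsto_ratio (hI : Induces d f u Λ X Y)
    (hM : ∀ t, 0 < t → 0 < genMean d f u t) (h : IsSoliton d μ ε f u) {l : ℝ}
    (hl : Tendsto (deriv (f 0)) atTop (𝓝 l)) : Tendsto (fun s => X 0 s / Y 0 s) atTop (𝓝 l) := by
  obtain ⟨τ, hτ, -, τtop, -, hΛ, hX, hY⟩ := hI
  refine (hl.comp τtop).congr fun s => ?_
  have h1 := (h.pos 0 _ (hτ s)).ne'
  have h2 := (hM _ (hτ s)).ne'
  rw [hX, hY, hΛ, shape, Function.comp]
  field_simp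

end WarpedSoliton

namespace WarpedSoliton

/-! ### From the reduced system to solitons -/

/-- The warping functions of the soliton given by a solution of the reduced system. -/
noncomputable def lift {m : ℕ} (fbar : Fin m → ℝ) (x : ℝ → Fin 5 → ℝ) (γ : ℝ → ℝ) :
    Fin (m + 1) → ℝ → ℝ :=
  Fin.cons (fun t => x t 0) fun i t => fbar i * Real.exp (γ t)

section Lift

variable {m : ℕ} {d : Fin (m + 1) → ℕ} {μ : Fin (m + 1) → ℝ} {ε K : ℝ} {N : ℕ} {D : ℝ}
  {x : ℝ → Fin 5 → ℝ} {γ : ℝ → ℝ} {fbar : Fin m → ℝ}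

lemma shape_lift_zero (hx : ∀ T, RedSol N D ε K T x) {t : ℝ} (ht : 0 < t) :
    shape (lift fbar x γ) 0 t = x t 1 / x t 0 := by
  rw [shape]
  exact congrArg (· / x t 0) ((hx (t + 1)).deriv_f ⟨ht, lt_add_one t⟩).deriv

lemma hasDerivAt_lift_succ (hγ : ∀ t, 0 < t → HasDerivAt γ (x t 3) t) (i : Fin m) {t : ℝ}
    (ht : 0 < t) :
    HasDerivAt (lift fbar x γ i.succ) (fbar i * (Real.exp (γ t) * x t 3)) t :=
  (hγ t ht).exp.const_mul (fbar i)

lemma shape_lift_succ (hγ : ∀ t, 0 < t → HasDerivAt γ (x t 3) t) (hfbar : ∀ i, 0 < fbar i)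
    (i : Fin m) {t : ℝ} (ht : 0 < t) : shape (lift fbar x γ) i.succ t = x t 3 := by
  rw [shape, (hasDerivAt_lift_succ hγ i ht).deriv]
  have h1 := (hfbar i).ne'
  have h2 := (Real.exp_pos (γ t)).ne'
  change _ / (fbar i * Real.exp (γ t)) = _
  field_simp

lemma deriv_neg_pot (hx : ∀ T, RedSol N D ε K T x) {t : ℝ} (ht : 0 < t) :
    deriv (fun t => -x t 4) t = -x t 2 :=
  ((hx (t + 1)).deriv_v ⟨ht, lt_add_one t⟩).neg.deriv

lemma genMean_lift (hx : ∀ T, RedSol (d 0) (flatDim d) ε K T x)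
    (hγ : ∀ t, 0 < t → HasDerivAt γ (x t 3) t) (hfbar : ∀ i, 0 < fbar i) {t : ℝ} (ht : 0 < t) :
    genMean d (lift fbar x γ) (fun t => -x t 4) t = redMean (d 0) (flatDim d) (x t) := by
  rw [genMean, trShape, Fin.sum_univ_succ, deriv_neg_pot hx ht, shape_lift_zero hx ht, redMean,
    flatDim, Finset.sum_mul, neg_neg, add_assoc]
  simp only [shape_lift_succ hγ hfbar _ ht]

lemma trShapeSq_lift (hx : ∀ T, RedSol (d 0) (flatDim d) ε K T x)
    (hγ : ∀ t, 0 < t → HasDerivAt γ (x t 3) t) (hfbar : ∀ i, 0 < fbar i) {t : ℝ} (ht : 0 < t) :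
    trShapeSq d (lift fbar x γ) t = d 0 * (x t 1 / x t 0) ^ 2 + flatDim d * x t 3 ^ 2 := by
  rw [trShapeSq, Fin.sum_univ_succ, shape_lift_zero hx ht, flatDim, Finset.sum_mul]
  simp only [shape_lift_succ hγ hfbar _ ht]

/-- All flat factors receive the logarithmic derivative `h`, so `tr L²` is exactly `N (y/f)² + D
h²`, and the mean equation becomes `RedSol.deriv_mean`. -/
theorem isSoliton_lift (A : Setting m d μ ε) (hK : 0 < K)
    (hx : ∀ T, RedSol (d 0) (flatDim d) ε K T x)
    (hγ : ∀ t, 0 < t → HasDerivAt γ (x t 3) t) (hfbar : ∀ i, 0 < fbar i) :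
    IsSoliton d μ ε (lift fbar x γ) (fun t => -x t 4) := by
  have P := A.params hK
  have hsm : ∀ j, ContDiffOn ℝ ∞ (fun t => x t j) (Ioi 0) :=
    fun j => contDiffOn_pi.1 (RedSol.contDiffOn hx) j
  have hγs : ContDiffOn ℝ ∞ γ (Ioi 0) :=
    (contDiffOn_infty_iff_deriv_of_isOpen isOpen_Ioi).2
      ⟨fun t ht => (hγ t ht).differentiableAt.differentiableWithinAt,
        (hsm 3).congr fun t ht => (hγ t ht).deriv⟩
  have hpos : ∀ t, 0 < t → 0 < x t 0 := fun t ht => (hx (t + 1)).pos_f t ⟨ht, lt_add_one t⟩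
  have hmean : ∀ t, 0 < t → genMean d (lift fbar x γ) (fun t => -x t 4) =ᶠ[𝓝 t]
      fun t => redMean (d 0) (flatDim d) (x t) := fun t ht => by
    filter_upwards [lt_mem_nhds ht] with s hs
    exact genMean_lift hx hγ hfbar hs
  refine ⟨fun i => ?_, (hsm 4).neg, fun i t ht => ?_, fun t ht => ?_, fun i t ht => ?_⟩
  · refine Fin.cases (hsm 0) (fun i => ?_) i
    exact contDiffOn_const.mul hγs.exp
  · refine Fin.cases (hpos t ht) (fun i => ?_) i
    exact mul_pos (hfbar i) (Real.exp_pos _)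
  · rw [(hmean t ht).deriv_eq, ((hx (t + 1)).deriv_mean P ⟨ht, lt_add_one t⟩).deriv,
      trShapeSq_lift hx hγ hfbar ht]
    ring
  · rw [genMean_lift hx hγ hfbar ht]
    refine Fin.cases ?_ (fun i => ?_) i
    · have h1 : shape (lift fbar x γ) 0 =ᶠ[𝓝 t] fun t => x t 1 / x t 0 := by
        filter_upwards [lt_mem_nhds ht] with s hs
        exact shape_lift_zero hx hs
      have ht1 : t ∈ Ioo 0 (t + 1) := ⟨ht, lt_add_one t⟩
      have hf := (hpos t ht).ne'
      have h2 : HasDerivAt (fun t => x t 1 / x t 0) _ t :=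
        ((hx (t + 1)).deriv_y ht1).div ((hx (t + 1)).deriv_f ht1) hf
      rw [h1.deriv_eq, h2.deriv, shape_lift_zero hx ht, A.hμ0, redMean]
      change _ = _ + _ / x t 0 ^ 2 + _
      field_simp
      ring
    · have h1 : shape (lift fbar x γ) i.succ =ᶠ[𝓝 t] fun t => x t 3 := by
        filter_upwards [lt_mem_nhds ht] with s hs
        exact shape_lift_succ hγ hfbar i hs
      rw [h1.deriv_eq, ((hx (t + 1)).deriv_h ⟨ht, lt_add_one t⟩).deriv,
        shape_lift_succ hγ hfbar i ht, A.hμ i]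
      ring

theorem hasInitialData_lift (P : Params (d 0) D ε K)
    (hx : ∀ T, RedSol (d 0) D ε K T x)
    (hγ : ∀ t, 0 < t → HasDerivAt γ (x t 3) t) (hγ0 : Tendsto γ (𝓝[>] 0) (𝓝 0)) :
    HasInitialData d fbar (-K) (lift fbar x γ) (fun t => -x t 4) := by
  have hexp : Tendsto (fun t => Real.exp (γ t)) (𝓝[>] 0) (𝓝 1) := by
    rw [← Real.exp_zero]
    exact (Real.continuous_exp.tendsto 0).comp hγ0
  refine ⟨(hx 1).lim_f, (hx 1).lim_y.congr' ?_, fun i => ?_, fun i => ?_, ?_, ?_, ?_⟩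
  · filter_upwards [self_mem_nhdsWithin] with t ht
    exact ((hx (t + 1)).deriv_f ⟨ht, lt_add_one t⟩).deriv.symm
  · have := hexp.const_mul (fbar i)
    rwa [mul_one] at this
  · have h1 := (hexp.mul (hx 1).lim_h).const_mul (fbar i)
    rw [mul_zero, mul_zero] at h1
    refine h1.congr' ?_
    filter_upwards [self_mem_nhdsWithin] with t ht
    exact (hasDerivAt_lift_succ hγ i ht).deriv.symm
  · simpa using (hx 1).lim_v.neg
  · have h1 := (hx 1).lim_p.neg
    rw [neg_zero] at h1
    refine h1.congr' ?_
    filter_upwards [self_mem_nhdsWithin] with t ht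
    exact (deriv_neg_pot hx ht).symm
  · have h1 := ((hx 1).lim_deriv_p P one_pos).neg
    rw [← neg_div] at h1
    refine h1.congr' ?_
    filter_upwards [self_mem_nhdsWithin] with t ht
    have ht : 0 < t := ht
    have h2 : deriv (fun t => -x t 4) =ᶠ[𝓝 t] fun t => -x t 2 := by
      filter_upwards [lt_mem_nhds ht] with s hs
      exact deriv_neg_pot hx hs
    rw [h2.deriv_eq, ((hx (t + 1)).deriv_p ⟨ht, lt_add_one t⟩).fun_neg.deriv]

/-- The time change of the rescaled equations exists. -/
theorem exists_induces_lift (A : Setting m d μ ε) (hK : 0 < K)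
    (hx : ∀ T, RedSol (d 0) (flatDim d) ε K T x)
    (hγ : ∀ t, 0 < t → HasDerivAt γ (x t 3) t) (hfbar : ∀ i, 0 < fbar i) :
    ∃ (Λ : ℝ → ℝ) (X Y : Fin (m + 1) → ℝ → ℝ),
      Induces d (lift fbar x γ) (fun t => -x t 4) Λ X Y := by
  have P := A.params hK
  set M := genMean d (lift fbar x γ) (fun t => -x t 4) with hMdef
  have hM : ∀ t, 0 < t → M t = redMean (d 0) (flatDim d) (x t) := fun t ht =>
    genMean_lift hx hγ hfbar ht
  have hmem : ∀ t : ℝ, 0 < t → t ∈ Ioo 0 (t + 1) := fun t ht => ⟨ht, lt_add_one t⟩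
  have hcont : ContinuousOn M (Ioi 0) := fun t ht =>
    (((isSoliton_lift A hK hx hγ hfbar).deriv_genMean A ht).continuousAt).continuousWithinAt
  have hN := RedSol.two_le P
  -- Near `0`, `tM → d 0 ≥ 2 > 1`; for `t ≥ 1`, `tM ≥ √K`.
  obtain ⟨τ, h1, h2, h3, h4⟩ := exists_time_change (c := min 1 √K) hcont
    (fun t ht => by rw [hM t ht]; exact (hx (t + 1)).pos_mean P (hmem t ht))
    (lt_min one_pos (Real.sqrt_pos.2 hK))
    (by
      have := ((hx 1).lim_mul_mean one_pos).eventually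
        (lt_mem_nhds (show (1 : ℝ) < d 0 by linarith))
      filter_upwards [this, self_mem_nhdsWithin] with t ht ht0
      rw [hM t ht0]
      exact (min_le_left _ _).trans ht.le)
    (by
      filter_upwards [eventually_ge_atTop (1 : ℝ)] with t ht
      have ht0 : 0 < t := one_pos.trans_le ht
      have := (hx (t + 1)).sqrt_le_mean P (hmem t ht0)
      rw [hM t ht0]
      refine (min_le_right _ _).trans ?_
      nlinarith [Real.sqrt_nonneg K])
  exact ⟨fun s => 1 / M (τ s), fun i s => 1 / M (τ s) * shape (lift fbar x γ) i (τ s),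
    fun i s => 1 / M (τ s) / lift fbar x γ i (τ s), τ, h1, h2, h3, h4, fun _ => rfl,
    fun _ _ => rfl, fun _ _ => rfl⟩

end Lift

end WarpedSoliton

/-! ### Realization of every asymptotic slope. -/

theorem lemma6p1 (m : ℕ) (hm : 1 ≤ m) (d : Fin (m + 1) → ℕ) (hd0 : 2 ≤ d 0)
    (hd : ∀ i, 1 ≤ d i) (μ : Fin (m + 1) → ℝ) (hμ0 : μ 0 = (d 0 : ℝ) - 1)
    (hμ : ∀ i : Fin m, μ i.succ = 0) (ε : ℝ) (hε : 0 < ε)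
    (fbar : Fin m → ℝ) (hfbar : ∀ i, 0 < fbar i) (σ : ℝ) (hσ : 0 < σ) :
    ∃ C : ℝ, C < 0 ∧
      (∃ (f : Fin (m + 1) → ℝ → ℝ) (u Λ : ℝ → ℝ) (X Y : Fin (m + 1) → ℝ → ℝ),
        WarpedSoliton.IsSoliton d μ ε f u ∧ WarpedSoliton.HasInitialData d fbar C f u ∧
        WarpedSoliton.Induces d f u Λ X Y) ∧
      (∀ (f : Fin (m + 1) → ℝ → ℝ) (u Λ : ℝ → ℝ) (X Y : Fin (m + 1) → ℝ → ℝ),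
        WarpedSoliton.IsSoliton d μ ε f u → WarpedSoliton.HasInitialData d fbar C f u →
        WarpedSoliton.Induces d f u Λ X Y →
        WarpedSoliton.IsRegular d μ ε Λ X Y ∧
        Filter.Tendsto (deriv (f 0)) Filter.atTop (nhds σ⁻¹) ∧
        Filter.Tendsto (fun s => X 0 s / Y 0 s) Filter.atTop (nhds σ⁻¹)) := by
  have A : WarpedSoliton.Setting m d μ ε := ⟨hm, hd0, hd, hμ0, hμ, hε⟩
  obtain ⟨K, hK, hlim⟩ := WarpedSoliton.RedSol.exists_param hd0 A.flatDim_pos.le hε hσ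
  refine ⟨-K, neg_lt_zero.2 hK, ?_, fun f u Λ X Y h hi hI => ?_⟩
  · obtain ⟨x, hx⟩ := WarpedSoliton.RedSol.exists_global (A.params hK)
    obtain ⟨γ, hγ, hγ0⟩ := WarpedSoliton.RedSol.exists_primitive hx
    obtain ⟨Λ, X, Y, hI⟩ := WarpedSoliton.exists_induces_lift A hK hx hγ hfbar
    exact ⟨_, _, Λ, X, Y, WarpedSoliton.isSoliton_lift A hK hx hγ hfbar,
      WarpedSoliton.hasInitialData_lift (A.params hK) hx hγ hγ0, hI⟩
  · have hC := neg_lt_zero.2 hK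
    -- Any soliton with these data reduces to a global solution with parameter `K = -C`, and
    -- `exists_param` covers all of them; component `1` of the state is `deriv (f 0)`.
    have hl : Tendsto (deriv (f 0)) atTop (𝓝 σ⁻¹) :=
      hlim (WarpedSoliton.reduce d f u) fun T => by
        simpa using WarpedSoliton.redSol_reduce A hi hfbar h T
    exact ⟨hi.isRegular A hfbar hC h hI, hl,
      hI.tendsto_ratio (fun t ht => hi.genMean_pos A hfbar hC h ht) h hl⟩
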